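/- **Setting.** A weighted simplicial complex (wsc) on $[n]=\{1,\dots,n\}$ is a function $\Omega:\mathcal P([n])\to\mathbb N$ with $\Omega(S)\mid\Omega(T)$ for $S\subseteq T$ and $\Omega(\{i\})\neq0$. Its facets are the maximal $S$ with $\Omega(S)\ne0$; $\widetilde{\mathcal F}$ is the multiset containing each facet $F$ exactly $\Omega(F)$ times, and $\widetilde{\mathcal F}_i$ consists of the copies of facets containing $i$. An action of a group $G$ on $\Omega$ is an action on $[n]$ leaving $\Omega$ invariant together with an action on $\widetilde{\mathcal F}$ compatible with the collapse map to facets; it is external if $gi=i$ implies $gF=F$ for all $F\in\widetilde{\mathcal F}_i$. For $\beta:\widetilde{\mathcal F}_i\to\mathcal I$ put ${}^g\beta:\widetilde{\mathcal F}_{gi}\to\mathcal I$, ${}^g\beta(F)=\beta(g^{-1}F)$; for $\alpha:\widetilde{\mathcal F}\to\mathcal I$ let $\alpha_{|_i}$ be its restriction to $\widetilde{\mathcal F}_i$. * $\mathrm{rank}_{(\Omega,G)}(T)$ is the least $|\mathcal I|$ for which $T=\sum_{\alpha\in\mathcal I^{\widetilde{\mathcal F}}}v^{[1]}_{\alpha_{|_1}}\otimes\cdots\otimes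 v^{[n]}_{\alpha_{|_n}}$ with $v^{[gi]}_{{}^g\beta}=v^{[i]}_\beta$ (for $T\in(\mathbb C^m)^{\otimes n}$ with $v^{[i]}_\beta\in\mathbb C^m$, or for $T\in M_{d,d'}(\mathbb C)^{\otimes n}$ with $v^{[i]}_\beta\in M_{d,d'}(\mathbb C)$). * $\text{psd-rank}_{(\Omega,G)}(P)$, for $P\in(\mathbb R^d)^{\otimes n}$, is the least $|\mathcal I|$ for which $P_{j_1\dots j_n}=\sum_{\alpha,\alpha'}\prod_i (E^{[i]}_{j_i})_{\alpha_{|_i},\alpha'_{|_i}}$ with complex positive semidefinite matrices $E^{[i]}_j$ satisfying $(E^{[gi]}_j)_{{}^g\beta,{}^g\beta'}=(E^{[i]}_j)_{\beta,\beta'}$. * $\text{puri-rank}_{(\Omega,G)}(\rho)$ is the least value of $\mathrm{rank}_{(\Omega,G)}(L)$ over all $d'$ and all $L\in M_{d,d'}(\mathbb C)^{\otimes n}$ with $\rho=LL^\dagger$. A rank is $\infty$ if there is no such decomposition. * $\mathsf{CCorr}(n,d,r)$ is the set of all $P_{j_1\dots j_n}=\sum_{\alpha=1}^r q_\alpha\prod_i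 p_i(j_i|\alpha)$ with $q$ a probability distribution on $[r]$ and $p_i(\cdot|\alpha)$ probability distributions on $[d]$. * $\mathsf{CQCorr}_{(\Omega,G)}(n,d,r)$ is the set of all probability distributions $P_{j_1\dots j_n}=\langle\psi|A^{[1]}_{j_1}\otimes\cdots\otimes A^{[n]}_{j_n}|\psi\rangle$ on $[d]^n$, where $m\in\mathbb N$ is arbitrary, $\psi\in(\mathbb C^m)^{\otimes n}$ is normalized with $\mathrm{rank}_{(\Omega,G)}(\psi)\le r$, and $(A^{[i]}_j)_{j=1}^d$ are POVMs with $A^{[gi]}_j=A^{[i]}_j$. * $\mathsf{QQCorr}_{(\Omega,G)}(n,d,r)$ is the set of all density matrices $\rho=(\mathcal E_1\otimes\cdots\otimes\mathcal E_n)(|\psi\rangle\langle\psi|)\in M_d(\mathbb C)^{\otimes n}$ with $\psi$ as before and quantum channels $\mathcal E_i:M_m(\mathbb C)\to M_d(\mathbb C)$ satisfying $\mathcal E_{gi}=\mathcal E_i$. For trivial $G$ the subscript $G$ is omitted. A witness for $p\notin S$ is a continuous real function $f$ with $f(p)<0$ and $f(q)\ge0$ for all $q\in S$. We say that $S$ is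 *not closed at $p$* if $S$ is not closed, $p\in\overline S\setminus S$, and there is no witness for $p\notin S$. Let $\Sigma_n$ be the full simplex (all weights $1$) with its action of $S_n$. Let $\Theta_n$ be the $n$-cycle (weight $1$ on $\emptyset$, on the singletons and on $\{i,i+1\}$ with indices mod $n$, weight $0$ elsewhere) with the action of the group $C_n$ of translations. Let $\widehat W_n$ be the uniform probability distribution on the $n$ tuples in $\{0,\dots,d-1\}^n$ having one entry $1$ and all others $0$. A tree is a wsc with weights in $\{0,1\}$, all of whose facets have at most two elements and form a graph without cycles (connectedness is not required). **Theorem.** 1. Let $G$ act externally on $\Omega$, and let $d,r\in\mathbb N$. If $P_k\to P$, where the $P_k$ are probability distributions on $[d]^n$ with $\text{psd-rank}_{(\Omega,G)}(P_k)\le r<\text{psd-rank}_{(\Omega,G)}(P)$ for all $k$, then $P_k\in\mathsf{CQCorr}_{(\Omega,G)}(n,d,r)$ for all $k$, and this set is not closed at $P$. Likewise, if $\rho_k\to\rho$, where the $\rho_k\in M_d(\mathbb C)^{\otimes n}$ are density matrices with $\text{puri-rank}_{(\Omega,G)}(\rho_k)\le r<\text{puri-rank}_{(\Omega,G)}(\rho)$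 for all $k$, then $\rho_k\in\mathsf{QQCorr}_{(\Omega,G)}(n,d,r)$ for all $k$, and this set is not closed at $\rho$. 2. For every $d\ge2$, the set $\mathsf{CQCorr}_{(\Omega,G)}(n,d,2)$ is not closed at $\widehat W_n$, and $\mathsf{QQCorr}_{(\Omega,G)}(n,d,2)$ is not closed at the diagonal matrix $\mathrm{Diag}(\widehat W_n)$, in each of the following cases: (i) $\Omega=\Sigma_n$, $G$ trivial, $n\ge5$ (standard tensor rank); (ii) $(\Omega,G)=(\Sigma_n,S_n)$, $n\ge3$ (symmetric tensor rank); (iii) $(\Omega,G)=(\Theta_n,C_n)$, $n\ge17$ (translational invariant operator Schmidt rank, i.e. translational invariant matrix product states). 3. For all $n,d,r\in\mathbb N$ the set $\mathsf{CCorr}(n,d,r)$ is closed, and for every $P\notin\mathsf{CCorr}(n,d,r)$ there is a witness. 4. If $\Omega$ is a tree, then $\mathsf{CQCorr}_\Omega(n,d,r)$ and $\mathsf{QQCorr}_\Omega(n,d,r)$ are closed for all $d,r\in\mathbb N$. -/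

import Mathlib

open scoped Topology ComplexOrder

/-- A weighted simplicial complex on the vertex set `Fin n`. -/
structure WSC (n : ℕ) where
  weight : Finset (Fin n) → ℕ
  weight_dvd : ∀ S T : Finset (Fin n), S ⊆ T → weight S ∣ weight T
  weight_singleton : ∀ i : Fin n, weight {i} ≠ 0

namespace WSC

variable {n : ℕ}

/-- The facets of `Ω`: the inclusion-maximal simplices (sets of nonzero weight). -/
def IsFacet (Ω : WSC n) (S : Finset (Fin n)) : Prop :=
  Maximal (fun T => Ω.weight T ≠ 0) S

/-- The multiset of facets: each facet `F` occurs `Ω F` many times. -/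
def MultiFacet (Ω : WSC n) : Type :=
  (F : {S : Finset (Fin n) // Ω.IsFacet S}) × Fin (Ω.weight F.1)

/-- The collapse map, sending a copy of a facet to the facet. -/
def MultiFacet.collapse {Ω : WSC n} (F : Ω.MultiFacet) : Finset (Fin n) := F.1.1

/-- The copies of the facets containing the vertex `i`. -/
def MultiFacetAt (Ω : WSC n) (i : Fin n) : Type :=
  {F : Ω.MultiFacet // i ∈ F.collapse}

instance (Ω : WSC n) : Finite Ω.MultiFacet := by
  unfold MultiFacet; infer_instance

instance (Ω : WSC n) (i : Fin n) : Finite (Ω.MultiFacetAt i) := by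
  unfold MultiFacetAt; infer_instance

noncomputable instance (Ω : WSC n) : Fintype Ω.MultiFacet := Fintype.ofFinite _

noncomputable instance (Ω : WSC n) (i : Fin n) : Fintype (Ω.MultiFacetAt i) := Fintype.ofFinite _

noncomputable instance (Ω : WSC n) : DecidableEq Ω.MultiFacet := Classical.decEq _

noncomputable instance (Ω : WSC n) (i : Fin n) : DecidableEq (Ω.MultiFacetAt i) :=
  Classical.decEq _

/-- The restriction of an index assignment to the facets containing `i`. -/
def restrict {Ω : WSC n} {I : Type} (α : Ω.MultiFacet → I) (i : Fin n) :
    Ω.MultiFacetAt i → I :=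
  fun F => α F.1

theorem MultiFacet.ext' {Ω : WSC n} {F F' : Ω.MultiFacet}
    (h : F.collapse = F'.collapse) (h' : (F.2 : ℕ) = (F'.2 : ℕ)) : F = F' := by
  obtain ⟨⟨S, hS⟩, k⟩ := F
  obtain ⟨⟨T, hT⟩, l⟩ := F'
  simp only [collapse] at h
  subst h
  have : k = l := Fin.ext h'
  subst this
  rfl

theorem IsFacet.map {Ω : WSC n} (σ : Equiv.Perm (Fin n))
    (h : ∀ S, Ω.weight (S.map σ.toEmbedding) = Ω.weight S)
    {S : Finset (Fin n)} (hS : Ω.IsFacet S) : Ω.IsFacet (S.map σ.toEmbedding) := by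
  refine ⟨(h S).trans_ne hS.1, fun T hT hle => ?_⟩
  have h1 : (T.map σ.symm.toEmbedding).map σ.toEmbedding = T := by
    ext x; simp
  have h2 : S ⊆ T.map σ.symm.toEmbedding := by
    intro x hx
    have := hle (Finset.mem_map_of_mem σ.toEmbedding hx)
    simpa using this
  have h3 : Ω.weight (T.map σ.symm.toEmbedding) ≠ 0 := by
    rw [← h, h1]; exact hT
  have h4 := Finset.map_subset_map (f := σ.toEmbedding) |>.2 (hS.2 h3 h2)
  rw [h1] at h4
  exact h4

/-- The full simplex `Σ_n`. -/
def simplex (n : ℕ) : WSC n where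
  weight _ := 1
  weight_dvd _ _ _ := dvd_rfl
  weight_singleton _ := one_ne_zero

open Classical in
/-- The cycle `Θ_n`, with edges `{i, i + 1}` modulo `n`. -/
noncomputable def cycle (n : ℕ) : WSC n where
  weight S := if S.card ≤ 1 ∨ ∃ i, S = {i, finRotate n i} then 1 else 0
  weight_dvd S T h := by
    by_cases hT : T.card ≤ 1 ∨ ∃ i, T = {i, finRotate n i}
    · have hS : S.card ≤ 1 ∨ ∃ i, S = {i, finRotate n i} := by
        rcases hT with hT | ⟨i, rfl⟩
        · exact Or.inl ((Finset.card_le_card h).trans hT)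
        · by_cases hc : S.card ≤ 1
          · exact Or.inl hc
          · refine Or.inr ⟨i, Finset.eq_of_subset_of_card_le h ?_⟩
            exact Finset.card_le_two.trans (by omega)
      rw [if_pos hS]; exact one_dvd _
    · rw [if_neg hT]; exact dvd_zero _
  weight_singleton i := by simp

/-- The graph whose edges are the two-element facets of `Ω`. -/
def graph (Ω : WSC n) : SimpleGraph (Fin n) where
  Adj i j := i ≠ j ∧ Ω.IsFacet {i, j}
  symm := ⟨fun i j h => ⟨h.1.symm, by rw [Finset.pair_comm]; exact h.2⟩⟩
  loopless := ⟨fun _ h => h.1 rfl⟩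

/-- `Ω` is a tree: it is a simplicial complex (all weights are `0` or `1`), every facet has at most
two vertices, and the graph formed by the facets has no cycles. (Connectedness is not needed.) -/
def IsTree (Ω : WSC n) : Prop :=
  (∀ S, Ω.weight S ≤ 1) ∧ (∀ S, Ω.IsFacet S → S.card ≤ 2) ∧ Ω.graph.IsAcyclic

/-- A group action of `G` on `Ω`: an action on the vertices leaving the weights invariant, together
with an action on the copies of the facets for which the collapse map is `G`-linear. -/
structure Action (G : Type*) [Group G] (Ω : WSC n) where
  vertex : G →* Equiv.Perm (Fin n)
  facet : G →* Equiv.Perm Ω.MultiFacet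
  weight_map : ∀ g S, Ω.weight (S.map (vertex g).toEmbedding) = Ω.weight S
  collapse_facet : ∀ g F, (facet g F).collapse = F.collapse.map (vertex g).toEmbedding

namespace Action

variable {G : Type*} [Group G] {Ω : WSC n}

/-- The action is external: a group element fixing a vertex fixes all copies of facets at it. -/
def IsExternal (a : Action G Ω) : Prop :=
  ∀ g i, a.vertex g i = i → ∀ F : Ω.MultiFacet, i ∈ F.collapse → a.facet g F = F

/-- `F ↦ g⁻¹ F`, from the facets at `g i` to the facets at `i`. -/
def pull (a : Action G Ω) (g : G) (i : Fin n) (F : Ω.MultiFacetAt (a.vertex g i)) :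
    Ω.MultiFacetAt i :=
  ⟨a.facet g⁻¹ F.1, by
    rw [a.collapse_facet, Finset.mem_map]
    exact ⟨a.vertex g i, F.2, by simp⟩⟩

/-- For an index assignment `β` at `i`, the assignment `F ↦ β (g⁻¹ F)` at `g i`. -/
def shift (a : Action G Ω) (g : G) {i : Fin n} {I : Type} (β : Ω.MultiFacetAt i → I) :
    Ω.MultiFacetAt (a.vertex g i) → I :=
  fun F => β (a.pull g i F)

/-- The action of the trivial group. -/
def trivial (Ω : WSC n) : Action Unit Ω where
  vertex := 1
  facet := 1
  weight_map g S := by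
    congr 1; exact Finset.map_refl
  collapse_facet g F := Finset.map_refl.symm

/-- The action induced by a weight-preserving action on the vertices: the copies of a facet are
moved along with the facet, without being permuted. -/
def induced (Ω : WSC n) (φ : G →* Equiv.Perm (Fin n))
    (h : ∀ g S, Ω.weight (S.map (φ g).toEmbedding) = Ω.weight S) : Action G Ω where
  vertex := φ
  facet := MonoidHom.toHomPerm
    { toFun := fun g F =>
        ⟨⟨F.1.1.map (φ g).toEmbedding, F.1.2.map (φ g) (h g)⟩, Fin.cast (h g F.1.1).symm F.2⟩
      map_one' := by
        funext F
        apply MultiFacet.ext'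
        · change F.1.1.map (φ 1).toEmbedding = F.1.1
          rw [map_one]; exact Finset.map_refl
        · rfl
      map_mul' := fun g g' => by
        funext F
        apply MultiFacet.ext'
        · change F.1.1.map (φ (g * g')).toEmbedding =
            (F.1.1.map (φ g').toEmbedding).map (φ g).toEmbedding
          rw [map_mul, Finset.map_map]; rfl
        · rfl }
  weight_map := h
  collapse_facet g F := rfl

/-- The symmetric group acting on the full simplex. -/
def simplexPerm (n : ℕ) : Action (Equiv.Perm (Fin n)) (simplex n) :=
  induced (simplex n) (MonoidHom.id _) (fun _ _ => rfl)

/-- The cyclic group of translations of `Fin n` (generated by `i ↦ i + 1` modulo `n`) acting on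
the cycle. -/
noncomputable def cycleRotate (n : ℕ) : Action (Subgroup.zpowers (finRotate n)) (cycle n) :=
  induced (cycle n) (Subgroup.zpowers (finRotate n)).subtype (by
    have key : ∀ g ∈ Subgroup.zpowers (finRotate n), ∀ S : Finset (Fin n),
        (∃ i, S = {i, finRotate n i}) → ∃ i, S.map g.toEmbedding = {i, finRotate n i} := by
      rintro g ⟨k, rfl⟩ S ⟨i, rfl⟩
      refine ⟨(finRotate n ^ k) i, ?_⟩
      have hc : (finRotate n ^ k) (finRotate n i) = finRotate n ((finRotate n ^ k) i) := by
        rw [← Equiv.Perm.mul_apply, ← Equiv.Perm.mul_apply,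
          ((Commute.refl (finRotate n)).zpow_left k).eq]
      rw [Finset.map_insert, Finset.map_singleton, Equiv.coe_toEmbedding, hc]
    intro g S
    have h1 : (∃ i, S.map (g : Equiv.Perm (Fin n)).toEmbedding = {i, finRotate n i}) ↔
        ∃ i, S = {i, finRotate n i} := by
      refine ⟨fun h => ?_, key g g.2 S⟩
      have := key _ (inv_mem g.2) _ h
      have e : (S.map (g : Equiv.Perm (Fin n)).toEmbedding).map
          ((g : Equiv.Perm (Fin n))⁻¹).toEmbedding = S := by
        ext x; simp [Equiv.Perm.inv_def]
      rwa [e] at this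
    simp only [cycle, Subgroup.coe_subtype, Finset.card_map, h1])

end Action

end WSC

section Ranks

open WSC

variable {n : ℕ} {G : Type*} [Group G] {Ω : WSC n}

/-- `T ∈ (ℂ^d)^{⊗ n}` has an `(Ω, G)`-decomposition with index set of cardinality `r`. -/
def HasDecomp (a : Action G Ω) {d : ℕ} (T : (Fin n → Fin d) → ℂ) (r : ℕ) : Prop :=
  ∃ v : (i : Fin n) → (Ω.MultiFacetAt i → Fin r) → Fin d → ℂ,
    (∀ g i β, v (a.vertex g i) (a.shift g β) = v i β) ∧
    ∀ j, T j = ∑ α : Ω.MultiFacet → Fin r, ∏ i, v i (restrict α i) (j i)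

/-- The `(Ω, G)`-rank of a tensor (`⊤` if there is no decomposition). -/
noncomputable def tensorRank (a : Action G Ω) {d : ℕ} (T : (Fin n → Fin d) → ℂ) : ℕ∞ :=
  ⨅ (r : ℕ) (_ : HasDecomp a T r), (r : ℕ∞)

/-- `T` has a positive semidefinite `(Ω, G)`-decomposition with index set of cardinality `r`. -/
def HasPsdDecomp (a : Action G Ω) {d : ℕ} (T : (Fin n → Fin d) → ℝ) (r : ℕ) : Prop :=
  ∃ E : (i : Fin n) → Fin d →
      Matrix (Ω.MultiFacetAt i → Fin r) (Ω.MultiFacetAt i → Fin r) ℂ,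
    (∀ i j, (E i j).PosSemidef) ∧
    (∀ g i j β β', E (a.vertex g i) j (a.shift g β) (a.shift g β') = E i j β β') ∧
    ∀ j, (T j : ℂ) = ∑ α : Ω.MultiFacet → Fin r, ∑ α' : Ω.MultiFacet → Fin r,
      ∏ i, E i (j i) (restrict α i) (restrict α' i)

/-- The positive semidefinite `(Ω, G)`-rank of a tensor (`⊤` if there is no decomposition). -/
noncomputable def psdRank (a : Action G Ω) {d : ℕ} (T : (Fin n → Fin d) → ℝ) : ℕ∞ :=
  ⨅ (r : ℕ) (_ : HasPsdDecomp a T r), (r : ℕ∞)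

/-- `L ∈ M_{d,d'}(ℂ)^{⊗ n}` has an `(Ω, G)`-decomposition with index set of cardinality `r`. -/
def HasMatrixDecomp (a : Action G Ω) {d d' : ℕ}
    (L : Matrix (Fin n → Fin d) (Fin n → Fin d') ℂ) (r : ℕ) : Prop :=
  ∃ A : (i : Fin n) → (Ω.MultiFacetAt i → Fin r) → Matrix (Fin d) (Fin d') ℂ,
    (∀ g i β, A (a.vertex g i) (a.shift g β) = A i β) ∧
    ∀ x y, L x y = ∑ α : Ω.MultiFacet → Fin r, ∏ i, A i (restrict α i) (x i) (y i)

/-- The `(Ω, G)`-purification rank of a matrix (`⊤` if there is no purification). -/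
noncomputable def puriRank (a : Action G Ω) {d : ℕ}
    (ρ : Matrix (Fin n → Fin d) (Fin n → Fin d) ℂ) : ℕ∞ :=
  ⨅ (r : ℕ) (_ : ∃ (d' : ℕ) (L : Matrix (Fin n → Fin d) (Fin n → Fin d') ℂ),
    ρ = L * L.conjTranspose ∧ HasMatrixDecomp a L r), (r : ℕ∞)

end Ranks

section Correlations

variable {n : ℕ}

/-- The tensor product `A_1 ⊗ ⋯ ⊗ A_n`. -/
def tensorMatrix {m d : ℕ} (A : Fin n → Matrix (Fin m) (Fin d) ℂ) :
    Matrix (Fin n → Fin m) (Fin n → Fin d) ℂ :=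
  Matrix.of fun x y => ∏ i, A i (x i) (y i)

/-- The `m × m`-matrices `A_1, …, A_d` form a positive operator-valued measure. -/
def IsPOVM {m d : ℕ} (A : Fin d → Matrix (Fin m) (Fin m) ℂ) : Prop :=
  (∀ j, (A j).PosSemidef) ∧ ∑ j, A j = 1

/-- The map `id_k ⊗ E` on block matrices: `E` is applied to each block. -/
def amplify {m d : ℕ} (E : Matrix (Fin m) (Fin m) ℂ →ₗ[ℂ] Matrix (Fin d) (Fin d) ℂ) (k : ℕ)
    (A : Matrix (Fin k × Fin m) (Fin k × Fin m) ℂ) :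
    Matrix (Fin k × Fin d) (Fin k × Fin d) ℂ :=
  Matrix.of fun p q => E (Matrix.of fun x y => A (p.1, x) (q.1, y)) p.2 q.2

/-- Quantum channels: completely positive trace preserving maps. -/
def IsChannel {m d : ℕ} (E : Matrix (Fin m) (Fin m) ℂ →ₗ[ℂ] Matrix (Fin d) (Fin d) ℂ) : Prop :=
  (∀ (k : ℕ) (A : Matrix (Fin k × Fin m) (Fin k × Fin m) ℂ),
    A.PosSemidef → (amplify E k A).PosSemidef) ∧
  ∀ A, (E A).trace = A.trace

/-- The tensor product `E_1 ⊗ ⋯ ⊗ E_n` of linear maps on matrices, written out on the expansion of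
its argument in tensor products of matrix units. -/
def tensorMap {m d : ℕ}
    (E : Fin n → Matrix (Fin m) (Fin m) ℂ →ₗ[ℂ] Matrix (Fin d) (Fin d) ℂ)
    (ρ : Matrix (Fin n → Fin m) (Fin n → Fin m) ℂ) :
    Matrix (Fin n → Fin d) (Fin n → Fin d) ℂ :=
  ∑ x, ∑ y, ρ x y • tensorMatrix fun i => E i (Matrix.single (x i) (y i) 1)

/-- Density matrices. -/
def IsDensity {ι : Type*} [Fintype ι] (ρ : Matrix ι ι ℂ) : Prop :=
  ρ.PosSemidef ∧ ρ.trace = 1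

/-- The matrix `|ψ⟩⟨ψ|`. -/
def ketBra {ι : Type*} (ψ : ι → ℂ) : Matrix ι ι ℂ := Matrix.vecMulVec ψ (star ψ)

/-- Classical correlations: a hidden variable with values in `Fin r` and distribution `q`, and
conditional distributions `p i α` of the `i`-th variable given the value `α`. -/
def CCorr (n d r : ℕ) : Set ((Fin n → Fin d) → ℝ) :=
  {P | ∃ q ∈ stdSimplex ℝ (Fin r), ∃ p : Fin n → Fin r → Fin d → ℝ,
    (∀ i α, p i α ∈ stdSimplex ℝ (Fin d)) ∧ ∀ j, P j = ∑ α, q α * ∏ i, p i α (j i)}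

variable {G : Type*} [Group G] {Ω : WSC n}

/-- The probability distributions obtained from normalized states `ψ ∈ (ℂ^m)^{⊗ n}` (`m` arbitrary)
of `(Ω, G)`-rank at most `r` by `G`-invariant local measurements with `d` outcomes. -/
def CQCorr (a : WSC.Action G Ω) (d r : ℕ) : Set ((Fin n → Fin d) → ℝ) :=
  {P | P ∈ stdSimplex ℝ (Fin n → Fin d) ∧
    ∃ (m : ℕ) (ψ : (Fin n → Fin m) → ℂ) (A : Fin n → Fin d → Matrix (Fin m) (Fin m) ℂ),
      ∑ x, ‖ψ x‖ ^ 2 = 1 ∧ tensorRank a ψ ≤ r ∧ (∀ i, IsPOVM (A i)) ∧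
      (∀ g i, A (a.vertex g i) = A i) ∧
      ∀ j, (P j : ℂ) = (tensorMatrix (fun i => A i (j i)) * ketBra ψ).trace}

/-- The density matrices obtained from normalized states `ψ ∈ (ℂ^m)^{⊗ n}` (`m` arbitrary) of
`(Ω, G)`-rank at most `r` by a `G`-invariant family of local quantum channels. -/
def QQCorr (a : WSC.Action G Ω) (d r : ℕ) : Set (Matrix (Fin n → Fin d) (Fin n → Fin d) ℂ) :=
  {ρ | IsDensity ρ ∧
    ∃ (m : ℕ) (ψ : (Fin n → Fin m) → ℂ)
      (E : Fin n → Matrix (Fin m) (Fin m) ℂ →ₗ[ℂ] Matrix (Fin d) (Fin d) ℂ),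
      ∑ x, ‖ψ x‖ ^ 2 = 1 ∧ tensorRank a ψ ≤ r ∧ (∀ i, IsChannel (E i)) ∧
      (∀ g i, E (a.vertex g i) = E i) ∧ ρ = tensorMap E (ketBra ψ)}

/-- A continuous real function that is negative at `p` and nonnegative on `S`. -/
def IsWitness {X : Type*} [TopologicalSpace X] (S : Set X) (p : X) (f : X → ℝ) : Prop :=
  Continuous f ∧ f p < 0 ∧ ∀ q ∈ S, 0 ≤ f q

/-- `S` is not closed, and its failure to be closed shows at `p`: `p` is a limit of points of `S`
not belonging to `S`, and no continuous witness detects that `p ∉ S`. -/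
def NotClosedAt {X : Type*} [TopologicalSpace X] (S : Set X) (p : X) : Prop :=
  ¬ IsClosed S ∧ p ∉ S ∧ p ∈ closure S ∧ ¬ ∃ f, IsWitness S p f

open Classical in
/-- The normalized `W`-distribution: the uniform distribution on the `n` tuples with one entry `1`
and all other entries `0`. -/
noncomputable def wDist (n d : ℕ) (j : Fin n → Fin d) : ℝ :=
  if ∃ i, ∀ k, (j k : ℕ) = if k = i then 1 else 0 then 1 / n else 0

/-- The diagonal matrix `∑ T_j |j⟩⟨j|`. -/
def diagState {d : ℕ} (T : (Fin n → Fin d) → ℝ) :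
    Matrix (Fin n → Fin d) (Fin n → Fin d) ℂ :=
  Matrix.diagonal fun j => (T j : ℂ)

end Correlations

/-! ### Ranks, closures and Gram matrices -/

section Preliminaries

/-! Everything is reduced to matrices `L` with an invariant decomposition. By Kraus operators in one
direction and vectorization with a partial trace in the other, a density matrix is in the quantum
set exactly when it is `L * Lᴴ` for some `L` of rank at most `r` (`mem_QQCorr_iff`); a distribution
is in its set exactly when it is given by the squared row norms of such an `L` (`mem_CQCorr_iff`).
Thus the second set is bounded by purification rank, and the first by psd-rank: local Gram matrices
turn `L` into a psd decomposition, and for external actions Gram vectors can be chosen equivariantly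
to go back (`HasPsdDecomp.exists_matrixDecomp`). The gap statements follow, since a continuous
witness cannot separate a set from a point of its closure.

The distribution W is a limit because the W-tensor is the derivative at 0 of the product tensor of
`e₀ + ε e₁`: its difference quotients are combinations of two symmetric product tensors, hence have
rank at most 2 for every action on a connected complex (`wDist_mem_closure`). W itself is not
attained. On the simplex, two product terms would give scalars whose products over all sets of sites
agree except on singletons, which three sites already forbid (`not_rank_two_of_w_support`). On the
cycle, invariant decompositions are traces of products of 2 × 2 matrices, and if all words without a
1, or with several, have trace zero, then so do those with exactly one 1
(`TraceVanishing.trace_eq_zero`).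

The classical set is a continuous image of a compact set. For trees, leaves are removed inductively.
Replacing the tensor at a leaf by an orthonormal system makes it range over a compact set, and the
bond matrix is absorbed by the neighbour, so limits of decompositions exist
(`isClosed_factorizations`, `isClosed_networkSet`). Bounding the ancillary dimension then exhibits
the quantum set as the image of a compact set of `L`, and the distributions as its preimage under
the diagonal embedding. -/

theorem ENat.iInf_natCast_le_iff {p : ℕ → Prop} {r : ℕ} :
    (⨅ (s : ℕ) (_ : p s), (s : ℕ∞)) ≤ r ↔ ∃ s ≤ r, p s := by
  classical
  refine ⟨fun h => ?_, fun ⟨s, hs, hp⟩ => (iInf₂_le s hp).trans (by exact_mod_cast hs)⟩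
  by_contra! hc
  have h1 : ((r + 1 : ℕ) : ℕ∞) ≤ ⨅ (s : ℕ) (_ : p s), (s : ℕ∞) := by
    refine le_iInf₂ fun s hp => ?_
    have : ¬ s ≤ r := fun hs => hc s hs hp
    exact_mod_cast (by omega : r + 1 ≤ s)
  have h2 := h1.trans h
  have h3 : r + 1 ≤ r := by exact_mod_cast h2
  omega

/-- The set where a witness is nonnegative is closed, so it contains the closure of `S` and
therefore `p`. -/
theorem NotClosedAt.of_mem_closure {X : Type*} [TopologicalSpace X] {S : Set X} {p : X}
    (h1 : p ∉ S) (h2 : p ∈ closure S) : NotClosedAt S p := by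
  refine ⟨fun h => h1 (h.closure_eq ▸ h2), h1, h2, ?_⟩
  rintro ⟨f, hf, hp, hS⟩
  have : p ∈ {q | 0 ≤ f q} :=
    closure_minimal (fun q hq => hS q hq) (isClosed_le continuous_const hf) h2
  exact absurd hp (not_lt.2 this)

/-- A positive semidefinite matrix is a Gram matrix of vectors in a space of prescribed, large
enough, dimension. -/
theorem Matrix.PosSemidef.exists_gram {ι : Type*} [Fintype ι] {E : Matrix ι ι ℂ}
    (hE : E.PosSemidef) {K : ℕ} (hK : Fintype.card ι ≤ K) :
    ∃ B : Fin K → ι → ℂ, ∀ x y, E x y = ∑ k, B k x * star (B k y) := by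
  classical
  open scoped MatrixOrder in
  obtain ⟨C, hC⟩ := CStarAlgebra.nonneg_iff_eq_star_mul_self.mp hE.nonneg
  -- The Gram vectors are padded by zeros, so that different sites can share one dimension `K`.
  obtain ⟨e⟩ : Nonempty (ι ↪ Fin K) := by
    rw [Function.Embedding.nonempty_iff_card_le]; simpa using hK
  refine ⟨fun k x => ∑ z, if e z = k then star (C z x) else 0, fun x y => ?_⟩
  have h1 : ∀ k, (∑ z, if e z = k then star (C z x) else 0) *
      star (∑ z, if e z = k then star (C z y) else 0) =
      ∑ z, if e z = k then star (C z x) * C z y else 0 := by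
    intro k
    by_cases hk : ∃ z, e z = k
    · obtain ⟨z, rfl⟩ := hk
      simp
    · have : ∀ z, e z ≠ k := fun z hz => hk ⟨z, hz⟩
      simp [this]
  simp_rw [h1]
  rw [Finset.sum_comm]
  simp [hC, Matrix.mul_apply, Matrix.star_eq_conjTranspose]

theorem Matrix.PosSemidef.of_gram {ι κ : Type*} [Finite ι] [Fintype κ] (B : κ → ι → ℂ) :
    (Matrix.of fun x y => ∑ k, B k x * star (B k y) : Matrix ι ι ℂ).PosSemidef := by
  have := Matrix.posSemidef_self_mul_conjTranspose (Matrix.of fun x k => B k x : Matrix ι κ ℂ)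
  convert this using 1
  ext x y
  simp [Matrix.mul_apply]

theorem Matrix.mul_conjTranspose_apply_self {ι κ : Type*} [Fintype κ] (L : Matrix ι κ ℂ) (x : ι) :
    (L * L.conjTranspose) x x = ((∑ y, ‖L x y‖ ^ 2 : ℝ) : ℂ) := by
  simp [Matrix.mul_apply, Complex.mul_conj']

end Preliminaries

/-! ### Correlation sets in terms of matrices with decompositions -/

section Forms

open WSC

variable {n : ℕ} {G : Type*} [Group G] {Ω : WSC n}

/-- Gram matrices of products multiply out along the vertices. -/
theorem sum_prod_mul_star {V κ S : Type*} [Fintype V] [DecidableEq V] [Fintype κ] [Fintype S]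
    (A B : V → S → κ → ℂ) :
    ∑ y : V → κ, (∑ α, ∏ i, A i α (y i)) * star (∑ α, ∏ i, B i α (y i)) =
      ∑ α, ∑ α', ∏ i, ∑ k, A i α k * star (B i α' k) := by
  simp_rw [Fintype.prod_sum, star_sum, Finset.sum_mul_sum, star_prod, Finset.prod_mul_distrib]
  rw [Finset.sum_comm]
  refine Finset.sum_congr rfl fun α _ => ?_
  rw [Finset.sum_comm]

theorem tensorMap_apply {m d : ℕ}
    (E : Fin n → Matrix (Fin m) (Fin m) ℂ →ₗ[ℂ] Matrix (Fin d) (Fin d) ℂ)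
    (ρ : Matrix (Fin n → Fin m) (Fin n → Fin m) ℂ) (p q : Fin n → Fin d) :
    tensorMap E ρ p q =
      ∑ x, ∑ y, ρ x y * ∏ i, E i (Matrix.single (x i) (y i) 1) (p i) (q i) := by
  simp [tensorMap, Matrix.sum_apply, tensorMatrix]

/-- Complete positivity makes the Choi matrix positive semidefinite, and its Gram vectors are the
Kraus operators. Their number depends on the dimensions only, hence is common to all sites. -/
theorem IsChannel.exists_kraus {m d : ℕ}
    {E : Matrix (Fin m) (Fin m) ℂ →ₗ[ℂ] Matrix (Fin d) (Fin d) ℂ} (hE : IsChannel E) :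
    ∃ K : Fin (m * d) → Fin d → Fin m → ℂ, ∀ x y p q,
      E (Matrix.single x y 1) p q = ∑ k, K k p x * star (K k q y) := by
  have h0 : (Matrix.vecMulVec (fun z : Fin m × Fin m => if z.1 = z.2 then (1 : ℂ) else 0)
      (star fun z : Fin m × Fin m => if z.1 = z.2 then (1 : ℂ) else 0)).PosSemidef :=
    Matrix.posSemidef_vecMulVec_self_star _
  obtain ⟨B, hB⟩ := (hE.1 m _ h0).exists_gram (K := m * d) (by simp)
  refine ⟨fun k p x => B k (x, p), fun x y p q => ?_⟩
  rw [← hB (x, p) (y, q)]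
  have : (Matrix.single x y 1 : Matrix (Fin m) (Fin m) ℂ) = Matrix.of fun x' y' =>
      Matrix.vecMulVec (fun z : Fin m × Fin m => if z.1 = z.2 then (1 : ℂ) else 0)
      (star fun z : Fin m × Fin m => if z.1 = z.2 then (1 : ℂ) else 0) (x, x') (y, y') := by
    ext x' y'
    by_cases h1 : x = x' <;> by_cases h2 : y = y' <;>
      simp [Matrix.vecMulVec_apply, h1, h2]
  simp only [amplify, this, Matrix.of_apply]

/-- The partial trace over the second tensor factor, with respect to an identification of indices
with pairs. -/
def partialTrace {m d K : ℕ} (f : Fin m ≃ Fin d × Fin K) :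
    Matrix (Fin m) (Fin m) ℂ →ₗ[ℂ] Matrix (Fin d) (Fin d) ℂ where
  toFun X := Matrix.of fun p q => ∑ k, X (f.symm (p, k)) (f.symm (q, k))
  map_add' X Y := by ext p q; simp [Finset.sum_add_distrib]
  map_smul' c X := by ext p q; simp [Finset.mul_sum]

theorem isChannel_partialTrace {m d K : ℕ} (f : Fin m ≃ Fin d × Fin K) :
    IsChannel (partialTrace f) := by
  constructor
  · intro k A hA
    have : amplify (partialTrace f) k A =
        ∑ l, A.submatrix (fun z : Fin k × Fin d => (z.1, f.symm (z.2, l)))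
          (fun z : Fin k × Fin d => (z.1, f.symm (z.2, l))) := by
      ext p q; simp [amplify, partialTrace, Matrix.sum_apply]
    rw [this]
    exact Matrix.posSemidef_sum _ fun l _ => hA.submatrix _
  · intro A
    simp only [Matrix.trace, partialTrace, LinearMap.coe_mk, AddHom.coe_mk, Matrix.diag_apply,
      Matrix.of_apply]
    rw [← Fintype.sum_prod_type' (f := fun p k => A (f.symm (p, k)) (f.symm (p, k)))]
    exact f.symm.sum_comp fun z => A z z

theorem IsDensity.sum_norm_sq {ι κ : Type*} [Fintype ι] [Fintype κ] {ρ : Matrix ι ι ℂ}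
    (h : IsDensity ρ) {L : Matrix ι κ ℂ} (hL : ρ = L * L.conjTranspose) :
    ∑ x, ∑ y, ‖L x y‖ ^ 2 = 1 := by
  have h1 := h.2
  rw [hL, Matrix.trace] at h1
  simp only [Matrix.diag_apply, Matrix.mul_conjTranspose_apply_self] at h1
  exact_mod_cast h1

/-- Identification of tuples with values in `Fin m ≃ Fin d × Fin K` with pairs of tuples. -/
def tupleEquiv {m d K : ℕ} (f : Fin m ≃ Fin d × Fin K) :
    (Fin n → Fin m) ≃ (Fin n → Fin d) × (Fin n → Fin K) :=
  (Equiv.arrowCongr (Equiv.refl _) f).trans (Equiv.arrowProdEquivProdArrow _ _ _)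

@[simp] theorem tupleEquiv_symm_apply {m d K : ℕ} (f : Fin m ≃ Fin d × Fin K)
    (p : Fin n → Fin d) (k : Fin n → Fin K) (i : Fin n) :
    (tupleEquiv f).symm (p, k) i = f.symm (p i, k i) := rfl

/-- The vectorization of a matrix. -/
def vectorize {m d K : ℕ} (f : Fin m ≃ Fin d × Fin K)
    (L : Matrix (Fin n → Fin d) (Fin n → Fin K) ℂ) (z : Fin n → Fin m) : ℂ :=
  L (tupleEquiv f z).1 (tupleEquiv f z).2

theorem HasMatrixDecomp.vectorize {a : Action G Ω} {m d K r : ℕ} (f : Fin m ≃ Fin d × Fin K)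
    {L : Matrix (Fin n → Fin d) (Fin n → Fin K) ℂ} (h : HasMatrixDecomp a L r) :
    HasDecomp a (vectorize f L) r := by
  obtain ⟨A, hA, hL⟩ := h
  refine ⟨fun i β z => A i β (f z).1 (f z).2, fun g i β => ?_, fun j => ?_⟩
  · funext z; simp only [hA g i β]
  · simp only [_root_.vectorize, hL]; rfl

theorem sum_vectorize {m d K : ℕ} (f : Fin m ≃ Fin d × Fin K)
    (L : Matrix (Fin n → Fin d) (Fin n → Fin K) ℂ) :
    ∑ z, ‖vectorize f L z‖ ^ 2 = ∑ x, ∑ y, ‖L x y‖ ^ 2 := by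
  rw [← Fintype.sum_prod_type' (f := fun x y => ‖L x y‖ ^ 2)]
  exact (tupleEquiv f).sum_comp fun z => ‖L z.1 z.2‖ ^ 2

/-- The tensors obtained from a tensor with a decomposition by local linear maps, written as
matrices with the local outputs split into two parts. -/
theorem HasDecomp.localMaps {a : Action G Ω} {m d K r : ℕ} {ψ : (Fin n → Fin m) → ℂ}
    (h : HasDecomp a ψ r) (B : Fin n → Fin K → Fin d → Fin m → ℂ)
    (hB : ∀ g i, B (a.vertex g i) = B i) :
    HasMatrixDecomp a (Matrix.of fun p k => ∑ x, ψ x * ∏ i, B i (k i) (p i) (x i)) r := by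
  obtain ⟨v, hv, hψ⟩ := h
  refine ⟨fun i β => Matrix.of fun p k => ∑ x, v i β x * B i k p x, fun g i β => ?_,
    fun p k => ?_⟩
  · simp only [hv g i β, hB]
  · simp only [Matrix.of_apply, hψ, Finset.sum_mul]
    rw [Finset.sum_comm]
    refine Finset.sum_congr rfl fun α _ => ?_
    rw [Fintype.prod_sum]
    simp_rw [Finset.prod_mul_distrib]

/-- Kraus operators applied locally to `ψ` give `L`, with the Kraus indices as columns. Conversely
the state is the vectorization of `L`, and every channel traces out the column index. Normalization
of the state is the trace condition. -/
theorem mem_QQCorr_iff {a : Action G Ω} {d r : ℕ}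
    {ρ : Matrix (Fin n → Fin d) (Fin n → Fin d) ℂ} :
    ρ ∈ QQCorr a d r ↔ IsDensity ρ ∧ ∃ s ≤ r, ∃ (K : ℕ)
      (L : Matrix (Fin n → Fin d) (Fin n → Fin K) ℂ),
      ρ = L * L.conjTranspose ∧ HasMatrixDecomp a L s := by
  classical
  constructor
  · rintro ⟨hρ, m, ψ, E, -, hr, hE, hinv, rfl⟩
    obtain ⟨s, hs, hdec⟩ := ENat.iInf_natCast_le_iff.1 hr
    -- The Kraus operators are chosen as a function of the channel and not of the site, so that
    -- equal channels receive equal operators and invariance passes to `L`.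
    choose! K hK using fun (F : Matrix (Fin m) (Fin m) ℂ →ₗ[ℂ] Matrix (Fin d) (Fin d) ℂ)
      (hF : IsChannel F) => hF.exists_kraus
    refine ⟨hρ, s, hs, m * d, _, ?_, hdec.localMaps (fun i => K (E i)) fun g i => by rw [hinv]⟩
    ext p q
    rw [tensorMap_apply, Matrix.mul_apply]
    simp_rw [hK _ (hE _), Matrix.conjTranspose_apply, Matrix.of_apply, Fintype.prod_sum,
      star_sum, Finset.sum_mul_sum, star_mul', star_prod, Finset.prod_mul_distrib,
      Finset.mul_sum]
    rw [Finset.sum_comm]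
    rw [Finset.sum_comm (s := (Finset.univ : Finset (Fin n → Fin (m * d))))]
    rw [Finset.sum_comm]
    refine Finset.sum_congr rfl fun x _ => ?_
    rw [Finset.sum_comm (s := (Finset.univ : Finset (Fin n → Fin (m * d))))]
    refine Finset.sum_congr rfl fun y _ => Finset.sum_congr rfl fun k _ => ?_
    simp only [ketBra, Matrix.vecMulVec_apply, Pi.star_apply]
    ring
  · rintro ⟨hρ, s, hs, K, L, hL, hdec⟩
    refine ⟨hρ, d * K, vectorize finProdFinEquiv.symm L,
      fun _ => partialTrace finProdFinEquiv.symm, ?_, ?_,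
      fun _ => isChannel_partialTrace _, fun _ _ => rfl, ?_⟩
    · rw [sum_vectorize, hρ.sum_norm_sq hL]
    · exact ENat.iInf_natCast_le_iff.2 ⟨s, hs, hdec.vectorize _⟩
    · set f : Fin (d * K) ≃ Fin d × Fin K := finProdFinEquiv.symm
      ext p q
      have key : ∀ x y : Fin n → Fin (d * K),
          ∏ i, partialTrace f (Matrix.single (x i) (y i) 1) (p i) (q i) =
          ∑ k : Fin n → Fin K, if x = (tupleEquiv f).symm (p, k) ∧
            y = (tupleEquiv f).symm (q, k) then 1 else 0 := by
        intro x y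
        simp only [partialTrace, LinearMap.coe_mk, AddHom.coe_mk, Matrix.of_apply,
          Matrix.single_apply, Fintype.prod_sum]
        refine Finset.sum_congr rfl fun k _ => ?_
        rw [Finset.prod_ite_zero]
        simp [funext_iff, forall_and]
      rw [tensorMap_apply, hL, Matrix.mul_apply]
      simp_rw [key, Finset.mul_sum]
      simp_rw [Finset.sum_comm (t := (Finset.univ : Finset (Fin n → Fin K)))]
      refine Finset.sum_congr rfl fun k _ => ?_
      simp only [ite_and, mul_ite, mul_one, mul_zero]
      simp [ketBra, Matrix.vecMulVec_apply, vectorize]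

theorem isDensity_diagState_iff {d : ℕ} {P : (Fin n → Fin d) → ℝ} :
    IsDensity (diagState P) ↔ P ∈ stdSimplex ℝ (Fin n → Fin d) := by
  rw [IsDensity, diagState, Matrix.posSemidef_diagonal_iff, Matrix.trace_diagonal, stdSimplex]
  refine and_congr (forall_congr' fun j => ?_) ?_
  · exact Complex.zero_le_real
  · exact_mod_cast Iff.rfl

/-- Storing a copy of the row index in the column index makes different rows orthogonal and
preserves their norms. The copy is made site by site, so the decomposition survives. -/
theorem diagState_mem_QQCorr_iff' {a : Action G Ω} {d r : ℕ} {P : (Fin n → Fin d) → ℝ} :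
    diagState P ∈ QQCorr a d r ↔ P ∈ stdSimplex ℝ (Fin n → Fin d) ∧ ∃ s ≤ r, ∃ (K : ℕ)
      (L : Matrix (Fin n → Fin d) (Fin n → Fin K) ℂ),
      (∀ j, P j = ∑ y, ‖L j y‖ ^ 2) ∧ HasMatrixDecomp a L s := by
  rw [mem_QQCorr_iff, isDensity_diagState_iff]
  refine and_congr_right fun _ => exists_congr fun s => and_congr_right fun _ => ?_
  constructor
  · rintro ⟨K, L, hL, h⟩
    refine ⟨K, L, fun j => ?_, h⟩
    have := congrFun (congrFun hL j) j
    rw [Matrix.mul_conjTranspose_apply_self, diagState, Matrix.diagonal_apply_eq] at this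
    exact_mod_cast this
  · rintro ⟨K, L, hL, A, hA, hLA⟩
    let f : Fin (d * K) ≃ Fin d × Fin K := finProdFinEquiv.symm
    let L' : Matrix (Fin n → Fin d) (Fin n → Fin (d * K)) ℂ := Matrix.of fun x z =>
      if x = (tupleEquiv f z).1 then L x (tupleEquiv f z).2 else 0
    refine ⟨d * K, L', ?_, fun i β => Matrix.of fun x z =>
      if x = (f z).1 then A i β x (f z).2 else 0, fun g i β => ?_, fun x z => ?_⟩
    · ext x y
      rw [Matrix.mul_apply, ← (tupleEquiv f).symm.sum_comp, Fintype.sum_prod_type]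
      simp only [L', Matrix.conjTranspose_apply, Matrix.of_apply, Equiv.apply_symm_apply]
      rw [Finset.sum_eq_single x (fun b _ hb => by simp [hb.symm]) (by simp)]
      by_cases hxy : x = y
      · subst hxy
        simp only [diagState, Matrix.diagonal_apply_eq, hL, if_true]
        simp [Complex.mul_conj']
      · simp [diagState, Matrix.diagonal_apply_ne _ hxy, Ne.symm hxy]
    · simp only [hA g i β]
    · simp only [L', Matrix.of_apply, Finset.prod_ite_zero]
      by_cases hx : x = (tupleEquiv f z).1
      · rw [if_pos hx, hLA]
        have : ∀ i, x i = (f (z i)).1 := fun i => congrFun hx i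
        simp only [Finset.mem_univ, this, forall_true_left]
        simp only [implies_true, if_true]
        rfl
      · rw [if_neg hx]
        have : ¬ ∀ i, x i = (f (z i)).1 := fun h => hx (funext h)
        simp [this]

theorem IsPOVM.exists_sqrt {m d : ℕ} {A : Fin d → Matrix (Fin m) (Fin m) ℂ} (hA : IsPOVM A) :
    ∃ B : Fin d → Fin m → Fin m → ℂ, ∀ j x y, A j x y = ∑ k, star (B j k x) * B j k y := by
  choose B hB using fun j => (hA.1 j).exists_gram (K := m) (by simp)
  exact ⟨fun j k x => star (B j k x), fun j x y => by simpa using hB j x y⟩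

/-- Square roots of the measurement operators, applied locally to the state, give `L`. Conversely
the vectorization of `L` is measured in the standard basis of its row part; these measurements are
the same at all sites. -/
theorem mem_CQCorr_iff {a : Action G Ω} {d r : ℕ} {P : (Fin n → Fin d) → ℝ} :
    P ∈ CQCorr a d r ↔ P ∈ stdSimplex ℝ (Fin n → Fin d) ∧ ∃ s ≤ r, ∃ (K : ℕ)
      (L : Matrix (Fin n → Fin d) (Fin n → Fin K) ℂ),
      (∀ j, P j = ∑ y, ‖L j y‖ ^ 2) ∧ HasMatrixDecomp a L s := by
  classical
  constructor
  · rintro ⟨hP, m, ψ, A, -, hr, hA, hinv, hPA⟩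
    obtain ⟨s, hs, hdec⟩ := ENat.iInf_natCast_le_iff.1 hr
    choose! B hB using fun (F : Fin d → Matrix (Fin m) (Fin m) ℂ)
      (hF : IsPOVM F) => hF.exists_sqrt
    refine ⟨hP, s, hs, m, _, fun j => ?_,
      hdec.localMaps (fun i k p x => B (A i) p k x) fun g i => by rw [hinv]⟩
    have h1 : (P j : ℂ) = ∑ k : Fin n → Fin m, (∑ x, ψ x * ∏ i, B (A i) (j i) (k i) (x i)) *
        star (∑ x, ψ x * ∏ i, B (A i) (j i) (k i) (x i)) := by
      rw [hPA, Matrix.trace]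
      simp_rw [Matrix.diag_apply, Matrix.mul_apply, tensorMatrix, Matrix.of_apply, hB _ (hA _),
        Fintype.prod_sum, star_sum, Finset.sum_mul_sum, star_mul', star_prod,
        Finset.prod_mul_distrib, Finset.sum_mul]
      rw [Finset.sum_comm (s := (Finset.univ : Finset (Fin n → Fin m)))
        (f := fun k x => ∑ y, ψ x * (∏ i, B (A i) (j i) (k i) (x i)) *
          (star (ψ y) * ∏ i, star (B (A i) (j i) (k i) (y i))))]
      rw [Finset.sum_comm]
      refine Finset.sum_congr rfl fun x _ => ?_
      rw [Finset.sum_comm]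
      refine Finset.sum_congr rfl fun y _ => Finset.sum_congr rfl fun k _ => ?_
      simp only [ketBra, Matrix.vecMulVec_apply, Pi.star_apply]
      ring
    simp only [Matrix.of_apply]
    have h2 : ∀ z : ℂ, z * star z = ((‖z‖ ^ 2 : ℝ) : ℂ) := fun z => by
      simpa using Complex.mul_conj' z
    simp_rw [h2] at h1
    exact_mod_cast h1
  · rintro ⟨hP, s, hs, K, L, hL, hdec⟩
    set f : Fin (d * K) ≃ Fin d × Fin K := finProdFinEquiv.symm
    refine ⟨hP, d * K, vectorize f L, fun _ j => Matrix.diagonal fun z => if (f z).1 = j then 1 else 0,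
      ?_, ENat.iInf_natCast_le_iff.2 ⟨s, hs, hdec.vectorize _⟩, fun i => ⟨fun j => ?_, ?_⟩,
      fun _ _ => rfl, fun j => ?_⟩
    · rw [sum_vectorize]
      simp_rw [← hL]
      exact hP.2
    · refine Matrix.posSemidef_diagonal_iff.2 fun z => ?_
      split_ifs <;> simp
    · ext x y
      by_cases hxy : x = y
      · subst hxy; simp [Matrix.sum_apply]
      · simp [Matrix.sum_apply, Matrix.diagonal_apply_ne _ hxy, Matrix.one_apply_ne hxy]
    · have h1 : tensorMatrix (fun i : Fin n => (Matrix.diagonal fun z =>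
          if (f z).1 = j i then (1 : ℂ) else 0)) =
          Matrix.diagonal fun z => if (tupleEquiv f z).1 = j then 1 else 0 := by
        ext x y
        by_cases hxy : x = y
        · subst hxy
          simp only [tensorMatrix, Matrix.of_apply, Matrix.diagonal_apply_eq,
            Finset.prod_ite_zero, Finset.prod_const_one]
          congr 1
          simp [funext_iff, tupleEquiv]
        · rw [Matrix.diagonal_apply_ne _ hxy]
          obtain ⟨i, hi⟩ := Function.ne_iff.1 hxy
          exact Finset.prod_eq_zero (Finset.mem_univ i) (Matrix.diagonal_apply_ne _ hi)
      rw [h1, Matrix.trace, ← (tupleEquiv f).symm.sum_comp, Fintype.sum_prod_type, hL]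
      simp only [Matrix.diag_apply, Matrix.diagonal_mul, Equiv.apply_symm_apply]
      rw [Finset.sum_eq_single j (fun b _ hb => by simp [hb]) (by simp)]
      simp [ketBra, Matrix.vecMulVec_apply, vectorize, Complex.mul_conj']

theorem diagState_mem_QQCorr_iff {a : Action G Ω} {d r : ℕ} {P : (Fin n → Fin d) → ℝ} :
    diagState P ∈ QQCorr a d r ↔ P ∈ CQCorr a d r :=
  diagState_mem_QQCorr_iff'.trans mem_CQCorr_iff.symm

theorem continuous_diagState {d : ℕ} :
    Continuous (diagState : ((Fin n → Fin d) → ℝ) → _) := by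
  unfold diagState
  fun_prop

/-- A distribution not in the set but in the closure of the classical-quantum correlations yields
the failure of closedness both for it and for its diagonal state. -/
theorem notClosedAt_of_mem_closure {a : Action G Ω} {d r : ℕ} {P : (Fin n → Fin d) → ℝ}
    (h1 : P ∉ CQCorr a d r) (h2 : P ∈ closure (CQCorr a d r)) :
    NotClosedAt (CQCorr a d r) P ∧ NotClosedAt (QQCorr a d r) (diagState P) := by
  refine ⟨.of_mem_closure h1 h2, .of_mem_closure (mt diagState_mem_QQCorr_iff.1 h1) ?_⟩
  exact map_mem_closure continuous_diagState h2 fun P hP => diagState_mem_QQCorr_iff.2 hP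

end Forms

/-! ### Psd-rank, external actions and gaps -/

section PsdForms

open WSC

variable {n : ℕ} {G : Type*} [Group G] {Ω : WSC n}

theorem Complex.ofReal_sum_norm_sq {κ : Type*} [Fintype κ] (z : κ → ℂ) :
    ((∑ y, ‖z y‖ ^ 2 : ℝ) : ℂ) = ∑ y, z y * star (z y) := by
  simp [Complex.mul_conj']

theorem HasMatrixDecomp.hasPsdDecomp {a : Action G Ω} {d K r : ℕ}
    {L : Matrix (Fin n → Fin d) (Fin n → Fin K) ℂ} (h : HasMatrixDecomp a L r)
    {P : (Fin n → Fin d) → ℝ} (hP : ∀ j, P j = ∑ y, ‖L j y‖ ^ 2) : HasPsdDecomp a P r := by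
  obtain ⟨A, hA, hL⟩ := h
  refine ⟨fun i j => Matrix.of fun β β' => ∑ k, A i β j k * star (A i β' j k), fun i j => ?_,
    fun g i j β β' => ?_, fun j => ?_⟩
  · exact Matrix.PosSemidef.of_gram fun k β => A i β j k
  · simp only [Matrix.of_apply, hA g i β, hA g i β']
  · rw [hP, Complex.ofReal_sum_norm_sq]
    simp only [hL]
    exact sum_prod_mul_star (fun i α k => A i (restrict α i) (j i) k)
      (fun i α k => A i (restrict α i) (j i) k)

namespace WSC.Action

theorem facet_mem {a : Action G Ω} {g : G} {i i' : Fin n} (h : a.vertex g i = i')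
    {F : Ω.MultiFacet} (hF : i ∈ F.collapse) : i' ∈ (a.facet g F).collapse := by
  rw [a.collapse_facet, Finset.mem_map]
  exact ⟨i, hF, h⟩

/-- Transport of facets along a group element taking `i` to `i'`. -/
def push {a : Action G Ω} {g : G} {i i' : Fin n} (h : a.vertex g i = i') (F : Ω.MultiFacetAt i) :
    Ω.MultiFacetAt i' :=
  ⟨a.facet g F.1, facet_mem h F.2⟩

theorem shift_comp_push (a : Action G Ω) (g : G) {i : Fin n} {I : Type}
    (β : Ω.MultiFacetAt (a.vertex g i) → I) :
    a.shift g (fun F : Ω.MultiFacetAt i => β (push (a := a) (g := g) rfl F)) = β := by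
  funext F
  refine congrArg β (Subtype.ext ?_)
  change a.facet g (a.facet g⁻¹ F.1) = F.1
  simp

theorem exists_orbit_representative (a : Action G Ω) :
    ∃ (o : Fin n → Fin n) (γ : Fin n → G), (∀ i, a.vertex (γ i) (o i) = i) ∧
      ∀ g i, o (a.vertex g i) = o i := by
  let S : Setoid (Fin n) :=
    { r := fun i j => ∃ g, a.vertex g i = j
      iseqv := ⟨fun i => ⟨1, by simp⟩,
        fun {i j} ⟨g, h⟩ => ⟨g⁻¹, by simp [← h]⟩,
        fun {i j k} ⟨g, h⟩ ⟨g', h'⟩ => ⟨g' * g, by rw [map_mul, Equiv.Perm.mul_apply, h, h']⟩⟩ }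
  have h : ∀ i : Fin n, ∃ g, a.vertex g (Quotient.out (Quotient.mk S i)) = i :=
    fun i => Quotient.exact (Quotient.out_eq (Quotient.mk S i))
  choose γ hγ using h
  refine ⟨fun i => Quotient.out (Quotient.mk S i), γ, hγ, fun g i => ?_⟩
  have : Quotient.mk S (a.vertex g i) = Quotient.mk S i := by
    exact (Quotient.sound (show ∃ g', a.vertex g' i = a.vertex g i from ⟨g, rfl⟩)).symm
  simp only [this]

end WSC.Action

/-- Gram vectors are not unique, so independent choices at all sites would break invariance. They
are chosen at one representative of each orbit and transported. Externality makes the transport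
independent of the group element: an element of the stabilizer acts trivially on the facets there.
-/
theorem HasPsdDecomp.exists_matrixDecomp {a : Action G Ω} (ha : a.IsExternal) {d r : ℕ}
    {P : (Fin n → Fin d) → ℝ} (h : HasPsdDecomp a P r) :
    ∃ (K : ℕ) (L : Matrix (Fin n → Fin d) (Fin n → Fin K) ℂ),
      (∀ j, P j = ∑ y, ‖L j y‖ ^ 2) ∧ HasMatrixDecomp a L r := by
  obtain ⟨E, hE, hinv, hP⟩ := h
  obtain ⟨o, γ, hγ, ho⟩ := a.exists_orbit_representative
  -- Any common upper bound for the sizes of the local matrices would do.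
  set K := ∑ i : Fin n, Fintype.card (Ω.MultiFacetAt i → Fin r)
  choose B hB using fun i j => (hE i j).exists_gram (K := K)
    (Finset.single_le_sum (f := fun i => Fintype.card (Ω.MultiFacetAt i → Fin r))
      (fun _ _ => Nat.zero_le _) (Finset.mem_univ i))
  have hE' : ∀ (g : G) (i i' : Fin n) (h : a.vertex g i = i') j β β',
      E i' j β β' = E i j (β ∘ Action.push h) (β' ∘ Action.push h) := by
    rintro g i _ rfl j β β'
    rw [← hinv g i j]
    exact congrArg₂ (E _ j) (a.shift_comp_push g β).symm (a.shift_comp_push g β').symm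
  -- Representatives of the same orbit are only propositionally equal, so assignments at them are
  -- compared on the underlying facets.
  have hB' : ∀ i i' j (β : Ω.MultiFacetAt i → Fin r) (β' : Ω.MultiFacetAt i' → Fin r), i = i' →
      (∀ F h h', β ⟨F, h⟩ = β' ⟨F, h'⟩) → ∀ k, B i j k β = B i' j k β' := by
    rintro i _ j β β' rfl h k
    congr 1
    funext F
    exact h F.1 F.2 F.2
  let A : (i : Fin n) → (Ω.MultiFacetAt i → Fin r) → Matrix (Fin d) (Fin K) ℂ := fun i β =>
    Matrix.of fun j k => B (o i) j k (β ∘ Action.push (hγ i))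
  refine ⟨K, Matrix.of fun x y => ∑ α : Ω.MultiFacet → Fin r,
    ∏ i, A i (restrict α i) (x i) (y i), fun j => ?_, A, fun g i β => ?_, fun x y => rfl⟩
  · have h1 : (P j : ℂ) = ((∑ y : Fin n → Fin K, ‖∑ α : Ω.MultiFacet → Fin r,
        ∏ i, A i (restrict α i) (j i) (y i)‖ ^ 2 : ℝ) : ℂ) := by
      rw [Complex.ofReal_sum_norm_sq, hP]
      refine Eq.trans ?_ (sum_prod_mul_star (fun i α k => A i (restrict α i) (j i) k)
        (fun i α k => A i (restrict α i) (j i) k)).symm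
      refine Finset.sum_congr rfl fun α _ => Finset.sum_congr rfl fun α' _ =>
        Finset.prod_congr rfl fun i _ => ?_
      rw [hE' _ _ _ (hγ i), hB]
      rfl
    exact_mod_cast h1
  · ext j k
    refine hB' _ _ _ _ _ (ho g i) (fun F h h' => ?_) k
    change β ⟨a.facet g⁻¹ (a.facet (γ (a.vertex g i)) F), _⟩ = β ⟨a.facet (γ i) F, _⟩
    congr 2
    -- The two ways of transporting from `o i` to `g i` differ by an element fixing `o i`.
    have h2 : a.facet ((γ i)⁻¹ * g⁻¹ * γ (a.vertex g i)) F = F := by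
      refine ha _ (o i) ?_ F h'
      have h3 := hγ (a.vertex g i)
      rw [ho] at h3
      rw [map_mul, map_mul, Equiv.Perm.mul_apply, Equiv.Perm.mul_apply, h3, map_inv, map_inv,
        Equiv.Perm.inv_eq_iff_eq, Equiv.Perm.inv_eq_iff_eq, hγ]
    rw [map_mul, map_mul, Equiv.Perm.mul_apply, Equiv.Perm.mul_apply, map_inv a.facet (γ i),
      Equiv.Perm.inv_eq_iff_eq] at h2
    exact h2

theorem psdRank_le_of_mem_CQCorr {a : Action G Ω} {d r : ℕ} {P : (Fin n → Fin d) → ℝ}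
    (h : P ∈ CQCorr a d r) : psdRank a P ≤ r := by
  obtain ⟨-, s, hs, K, L, hP, hL⟩ := mem_CQCorr_iff.1 h
  exact ENat.iInf_natCast_le_iff.2 ⟨s, hs, hL.hasPsdDecomp hP⟩

theorem mem_CQCorr_of_psdRank_le {a : Action G Ω} (ha : a.IsExternal) {d r : ℕ}
    {P : (Fin n → Fin d) → ℝ} (h1 : P ∈ stdSimplex ℝ (Fin n → Fin d)) (h : psdRank a P ≤ r) :
    P ∈ CQCorr a d r := by
  obtain ⟨s, hs, hP⟩ := ENat.iInf_natCast_le_iff.1 h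
  exact mem_CQCorr_iff.2 ⟨h1, s, hs, hP.exists_matrixDecomp ha⟩

theorem mem_QQCorr_iff_puriRank_le {a : Action G Ω} {d r : ℕ}
    {ρ : Matrix (Fin n → Fin d) (Fin n → Fin d) ℂ} :
    ρ ∈ QQCorr a d r ↔ IsDensity ρ ∧ puriRank a ρ ≤ r := by
  rw [mem_QQCorr_iff, puriRank, ENat.iInf_natCast_le_iff]

theorem cqCorr_gap {a : Action G Ω} (ha : a.IsExternal) {d r : ℕ}
    {P : ℕ → (Fin n → Fin d) → ℝ} {P' : (Fin n → Fin d) → ℝ}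
    (h1 : ∀ k, P k ∈ stdSimplex ℝ (Fin n → Fin d)) (h2 : Filter.Tendsto P Filter.atTop (𝓝 P'))
    (h3 : ∀ k, psdRank a (P k) ≤ r) (h4 : (r : ℕ∞) < psdRank a P') :
    (∀ k, P k ∈ CQCorr a d r) ∧ NotClosedAt (CQCorr a d r) P' := by
  have h5 : ∀ k, P k ∈ CQCorr a d r := fun k => mem_CQCorr_of_psdRank_le ha (h1 k) (h3 k)
  exact ⟨h5, .of_mem_closure (fun h => not_le.2 h4 (psdRank_le_of_mem_CQCorr h))
    (mem_closure_of_tendsto h2 (Filter.Eventually.of_forall h5))⟩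

theorem qqCorr_gap {a : Action G Ω} {d r : ℕ}
    {ρ : ℕ → Matrix (Fin n → Fin d) (Fin n → Fin d) ℂ}
    {ρ' : Matrix (Fin n → Fin d) (Fin n → Fin d) ℂ}
    (h1 : ∀ k, IsDensity (ρ k)) (h2 : Filter.Tendsto ρ Filter.atTop (𝓝 ρ'))
    (h3 : ∀ k, puriRank a (ρ k) ≤ r) (h4 : (r : ℕ∞) < puriRank a ρ') :
    (∀ k, ρ k ∈ QQCorr a d r) ∧ NotClosedAt (QQCorr a d r) ρ' := by
  have h5 : ∀ k, ρ k ∈ QQCorr a d r := fun k => mem_QQCorr_iff_puriRank_le.2 ⟨h1 k, h3 k⟩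
  exact ⟨h5, .of_mem_closure (fun h => not_le.2 h4 (mem_QQCorr_iff_puriRank_le.1 h).2)
    (mem_closure_of_tendsto h2 (Filter.Eventually.of_forall h5))⟩

end PsdForms

/-! ### Classical correlations -/

section Classical

/-- The witness is the distance to `p` minus the radius of a ball around `p` that misses `S`. -/
theorem exists_isWitness_of_isClosed {X : Type*} [PseudoMetricSpace X] {S : Set X}
    (hS : IsClosed S) {p : X} (hp : p ∉ S) : ∃ f, IsWitness S p f := by
  obtain ⟨ε, hε, h⟩ := Metric.isOpen_iff.1 hS.isOpen_compl p hp
  refine ⟨fun q => dist q p - ε, by fun_prop, by simpa using hε, fun q hq => ?_⟩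
  by_contra! hc
  exact h (show q ∈ Metric.ball p ε by simpa using hc) hq

theorem isCompact_CCorr (n d r : ℕ) : IsCompact (CCorr n d r) := by
  have h1 : IsCompact (stdSimplex ℝ (Fin r) ×ˢ (Set.univ.pi fun _ : Fin n =>
      Set.univ.pi fun _ : Fin r => stdSimplex ℝ (Fin d))) :=
    (isCompact_stdSimplex ..).prod (isCompact_univ_pi fun _ => isCompact_univ_pi fun _ =>
      isCompact_stdSimplex ..)
  have h2 : Continuous fun z : (Fin r → ℝ) × (Fin n → Fin r → Fin d → ℝ) =>
      fun j : Fin n → Fin d => ∑ α, z.1 α * ∏ i, z.2 i α (j i) := by fun_prop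
  convert h1.image h2 using 1
  ext P
  constructor
  · rintro ⟨q, hq, p, hp, hP⟩
    exact ⟨(q, p), ⟨hq, fun i _ α _ => hp i α⟩, (funext hP).symm⟩
  · rintro ⟨⟨q, p⟩, ⟨hq, hp⟩, rfl⟩
    exact ⟨q, hq, p, fun i α => hp i trivial α trivial, fun j => rfl⟩

end Classical

/-! ### Facets and vertices -/

namespace WSC

variable {n : ℕ} {Ω : WSC n}

/-- Once there is a vertex, the empty set lies strictly below a singleton of nonzero weight and
cannot be a facet. Without vertices the label of an empty facet would be seen by no local tensor. -/
theorem MultiFacet.exists_mem_collapse (i₀ : Fin n) (F : Ω.MultiFacet) : ∃ i, i ∈ F.collapse := by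
  by_contra! h
  have h1 : F.collapse = ∅ := Finset.eq_empty_of_forall_notMem h
  have h2 : ({i₀} : Finset (Fin n)) ⊆ F.collapse :=
    F.1.2.2 (Ω.weight_singleton i₀) (by rw [← MultiFacet.collapse, h1]; exact Finset.empty_subset _)
  exact h i₀ (h2 (Finset.mem_singleton_self i₀))

instance nonempty_multiFacetAt (Ω : WSC n) (i : Fin n) : Nonempty (Ω.MultiFacetAt i) := by
  obtain ⟨S, hS, hmax⟩ := (Set.toFinite {T | Ω.weight T ≠ 0}).exists_le_maximal
    (Ω.weight_singleton i)
  exact ⟨⟨⟨⟨S, hmax⟩, ⟨0, Nat.pos_of_ne_zero hmax.1⟩⟩, hS (Finset.mem_singleton_self i)⟩⟩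

end WSC

/-! ### The W-distribution as a limit of rank two -/

section UpperBound

open WSC

variable {n : ℕ} {G : Type*} [Group G] {Ω : WSC n}

/-- Local tensors are extended by zero to the new labels. Every facet contains a vertex, where a new
label on it makes the product vanish. -/
theorem HasMatrixDecomp.mono {a : Action G Ω} {d K s t : ℕ} (i₀ : Fin n)
    {L : Matrix (Fin n → Fin d) (Fin n → Fin K) ℂ} (h : HasMatrixDecomp a L s) (hst : s ≤ t) :
    HasMatrixDecomp a L t := by
  classical
  obtain ⟨A, hA, hL⟩ := h
  refine ⟨fun i β => if h : ∀ F, (β F : ℕ) < s then A i fun F => ⟨β F, h F⟩ else 0,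
    fun g i β => ?_, fun x y => ?_⟩
  · have h1 : (∀ F, ((a.shift g β F : Fin t) : ℕ) < s) ↔ ∀ F, (β F : ℕ) < s := by
      constructor
      · intro h F
        have := h (Action.push (a := a) (g := g) rfl F)
        simp only [Action.shift] at this
        convert this
        apply Subtype.ext
        change F.1 = a.facet g⁻¹ (a.facet g F.1)
        simp
      · exact fun h F => h _
    by_cases h2 : ∀ F, (β F : ℕ) < s
    · simp only [dif_pos h2, dif_pos (h1.2 h2)]
      exact hA g i fun F => ⟨β F, h2 F⟩
    · simp only [dif_neg h2, dif_neg (mt h1.1 h2)]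
  · rw [hL]
    refine Fintype.sum_of_injective (fun α F => Fin.castLE hst (α F)) ?_ _ _ ?_ ?_
    · intro α α' h
      funext F
      exact Fin.castLE_injective hst (congrFun h F)
    · intro α hα
      have h1 : ¬ ∀ F, (α F : ℕ) < s := fun h => hα ⟨fun F => ⟨α F, h F⟩, rfl⟩
      push Not at h1
      obtain ⟨F, hF⟩ := h1
      obtain ⟨i, hi⟩ := F.exists_mem_collapse i₀
      refine Finset.prod_eq_zero (Finset.mem_univ i) ?_
      have h2 : ¬ ∀ F, ((restrict α i F : Fin t) : ℕ) < s :=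
        fun h => not_lt.2 hF (h ⟨F, hi⟩)
      exact congrArg (fun M : Matrix (Fin d) (Fin K) ℂ => M (x i) (y i)) (dif_neg h2)
    · intro α
      refine Finset.prod_congr rfl fun i _ => ?_
      have h2 : ∀ F, ((restrict (fun F => Fin.castLE hst (α F)) i F : Fin t) : ℕ) < s :=
        fun F => (α F.1).2
      change _ = (dite _ _ _ : Matrix (Fin d) (Fin K) ℂ) (x i) (y i)
      rw [dif_pos h2]
      rfl

/-- Connectedness of a complex, in terms of labellings of its facets. -/
def WSC.IsConnected (Ω : WSC n) : Prop :=
  ∀ (I : Type) (α : Ω.MultiFacet → I),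
    (∀ i, ∃ s, ∀ F : Ω.MultiFacetAt i, α F.1 = s) → ∃ s, ∀ F, α F = s

/-- The local tensor vanishes unless all facets at the vertex carry the same label; by connectedness
only the constant labellings contribute. Using the same vectors at every site makes the
decomposition invariant under any action. -/
theorem hasMatrixDecomp_sum_prod {a : Action G Ω} (i₀ : Fin n) (hΩ : Ω.IsConnected) {d r : ℕ}
    (w : Fin r → Fin d → ℂ) :
    HasMatrixDecomp (d' := 1) a (Matrix.of fun x _ => ∑ s, ∏ i, w s (x i)) r := by
  classical
  refine ⟨fun i β => Matrix.of fun x _ => ∑ s, if ∀ F, β F = s then w s x else 0,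
    fun g i β => ?_, fun x y => ?_⟩
  · have h1 : ∀ s, (∀ F, a.shift g β F = s) ↔ ∀ F, β F = s := by
      intro s
      constructor
      · intro h F
        have := h (Action.push (a := a) (g := g) rfl F)
        simp only [Action.shift] at this
        convert this
        apply Subtype.ext
        change F.1 = a.facet g⁻¹ (a.facet g F.1)
        simp
      · exact fun h F => h _
    simp only [h1]
  · obtain ⟨F₀⟩ := nonempty_multiFacetAt Ω i₀
    simp only [Matrix.of_apply]
    refine Fintype.sum_of_injective (fun s _ => s) (fun s s' h => congrFun h F₀.1) _ _ ?_ ?_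
    · intro α hα
      by_contra hne
      obtain ⟨s, hs⟩ := hΩ _ α fun i => by
        by_contra! hi
        refine hne (Finset.prod_eq_zero (Finset.mem_univ i) (Finset.sum_eq_zero fun s _ => ?_))
        obtain ⟨F, hF⟩ := hi s
        exact if_neg fun h => hF (h F)
      exact hα ⟨s, funext fun F => (hs F).symm⟩
    · intro s
      refine Finset.prod_congr rfl fun i _ => ?_
      obtain ⟨F⟩ := nonempty_multiFacetAt Ω i
      rw [Finset.sum_eq_single s]
      · exact (if_pos fun _ => rfl).symm
      · intro s' _ hs'
        exact if_neg fun h => hs' (h F).symm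
      · simp

/-- The scalars in front of the two products are distributed evenly over the sites as complex `n`-th
roots, which keeps all sites equal. -/
theorem mem_CQCorr_of_sub_prod {a : Action G Ω} (i₀ : Fin n) (hΩ : Ω.IsConnected) {d : ℕ}
    (x y : Fin d → ℝ) (c : ℝ) {g : (Fin n → Fin d) → ℝ}
    (hg : ∀ j, g j = c * (∏ i, x (j i) - ∏ i, y (j i))) (hN : ∑ j, g j ^ 2 ≠ 0) :
    (fun j => g j ^ 2 / ∑ j', g j' ^ 2) ∈ CQCorr a d 2 := by
  have hn : 0 < n := Fin.pos i₀
  set N := ∑ j, g j ^ 2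
  have hN0 : 0 ≤ N := Finset.sum_nonneg fun j _ => sq_nonneg _
  set c' : ℂ := ((c / Real.sqrt N : ℝ) : ℂ)
  obtain ⟨u, hu⟩ := IsAlgClosed.exists_pow_nat_eq c' hn
  obtain ⟨v, hv⟩ := IsAlgClosed.exists_pow_nat_eq (-c') hn
  refine mem_CQCorr_iff.2 ⟨⟨fun j => by positivity, ?_⟩, 2, le_rfl, 1, _, fun j => ?_,
    hasMatrixDecomp_sum_prod i₀ hΩ ![fun z => u * x z, fun z => v * y z]⟩
  · rw [← Finset.sum_div, div_self hN]
  · simp only [Matrix.of_apply, Fin.sum_univ_two, Matrix.cons_val_zero, Matrix.cons_val_one,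
      Finset.prod_mul_distrib, Finset.prod_const, Finset.card_univ, Fintype.card_fin, hu, hv]
    rw [Fintype.sum_unique]
    have : c' * ∏ i, (x (j i) : ℂ) + -c' * ∏ i, (y (j i) : ℂ) =
        ((g j / Real.sqrt N : ℝ) : ℂ) := by
      rw [hg]; simp only [c']; push_cast; ring
    rw [this, Complex.norm_real, Real.norm_eq_abs, sq_abs, div_pow, Real.sq_sqrt hN0]

/-- The tuple with entries `1` where `b` is true and `0` elsewhere. -/
def bitWord {d : ℕ} (hd : 2 ≤ d) (b : Fin n → Bool) : Fin n → Fin d :=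
  fun i => if b i then ⟨1, hd⟩ else ⟨0, by omega⟩

theorem wDist_eq {d : ℕ} (hd : 2 ≤ d) (j : Fin n → Fin d) :
    wDist n d j = (∑ i, if j = bitWord hd (fun k => decide (k = i)) then 1 else 0) / n := by
  have h1 : ∀ i, (j = bitWord hd (fun k => decide (k = i))) ↔
      ∀ k, (j k : ℕ) = if k = i then 1 else 0 := by
    intro i
    rw [funext_iff]
    refine forall_congr' fun k => ?_
    by_cases hk : k = i <;> simp [bitWord, hk, Fin.ext_iff]
  simp_rw [h1, wDist]
  by_cases h : ∃ i, ∀ k, (j k : ℕ) = if k = i then 1 else 0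
  · rw [if_pos h]
    obtain ⟨i, hi⟩ := h
    rw [Finset.sum_eq_single i, if_pos hi]
    · intro i' _ hne
      refine if_neg fun h' => ?_
      have := (hi i).symm.trans (h' i)
      simp [hne.symm] at this
    · simp
  · rw [if_neg h]
    push Not at h
    rw [Finset.sum_eq_zero fun i _ => if_neg fun h' => ?_, zero_div]
    obtain ⟨k, hk⟩ := h i
    exact hk (h' k)

theorem bitWord_single_injective {d : ℕ} (hd : 2 ≤ d) :
    Function.Injective fun i : Fin n => bitWord hd fun k => decide (k = i) := by
  intro i i' h
  have := congrFun h i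
  by_contra hne
  simp [bitWord, hne, Fin.ext_iff] at this

/-- `D` is the unnormalized W-tensor, obtained by the product rule as the derivative at 0 of the
product tensors of `x ε`. The normalized squares of the difference quotients converge to the
normalized square of `D`. -/
theorem wDist_mem_closure {a : Action G Ω} (i₀ : Fin n) (hΩ : Ω.IsConnected) {d : ℕ}
    (hd : 2 ≤ d) : wDist n d ∈ closure (CQCorr a d 2) := by
  have hn : (n : ℝ) ≠ 0 := by exact_mod_cast (Fin.pos i₀).ne'
  set e : Fin n → Fin n → Fin d := fun i => bitWord hd fun k => decide (k = i) with he
  let x : ℝ → Fin d → ℝ := fun ε z => if (z : ℕ) = 0 then 1 else if (z : ℕ) = 1 then ε else 0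
  let D : (Fin n → Fin d) → ℝ := fun j => ∑ i, if j = e i then 1 else 0
  have hder : ∀ j : Fin n → Fin d, HasDerivAt (fun ε => ∏ i, x ε (j i)) (D j) 0 := by
    intro j
    have h1 : ∀ i ∈ Finset.univ, HasDerivAt (fun ε => x ε (j i))
        (if (j i : ℕ) = 1 then 1 else 0) 0 := by
      intro i _
      by_cases h0 : (j i : ℕ) = 0
      · simp only [x, h0, if_true]; simpa using hasDerivAt_const (0 : ℝ) (1 : ℝ)
      · by_cases h1 : (j i : ℕ) = 1
        · simp only [x, h1, if_true]; simpa using hasDerivAt_id' (0 : ℝ)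
        · simp only [x, h0, h1, if_false]; exact hasDerivAt_const (0 : ℝ) (0 : ℝ)
    refine (HasDerivAt.fun_finsetProd h1).congr_deriv (Eq.symm ?_)
    refine Finset.sum_congr rfl fun i _ => ?_
    have h2 : ∀ z : Fin d, x 0 z = if (z : ℕ) = 0 then 1 else 0 := fun z => by
      simp only [x]; split_ifs <;> rfl
    simp only [h2, Finset.prod_ite_zero, Finset.prod_const_one, smul_eq_mul, ← ite_and,
      mul_ite, mul_one, mul_zero]
    refine if_congr ?_ rfl rfl
    rw [funext_iff]
    constructor
    · intro h
      refine ⟨by simp [h i, he, bitWord], fun k hk => ?_⟩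
      simp [h k, he, bitWord, (Finset.mem_erase.1 hk).1]
    · rintro ⟨h1, h2⟩ k
      by_cases hk : k = i
      · subst hk; simp [he, bitWord, Fin.ext_iff, h1]
      · rw [Fin.ext_iff, h2 k (by simp [hk])]; simp [he, bitWord, hk]
  -- The amplitudes are 0 or 1, so squaring them into probabilities changes nothing.
  have hDsq : ∀ j, D j ^ 2 = D j := by
    intro j
    by_cases h : ∃ i, j = e i
    · obtain ⟨i, rfl⟩ := h
      have : D (e i) = 1 := by
        simp only [D]
        rw [Finset.sum_eq_single i, if_pos rfl]
        · exact fun i' _ hne => if_neg fun h => hne (bitWord_single_injective hd h).symm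
        · simp
      rw [this]; norm_num
    · have : D j = 0 := Finset.sum_eq_zero fun i _ => if_neg fun h' => h ⟨i, h'⟩
      rw [this]; norm_num
  have hDsum : ∑ j, D j = n := by
    simp only [D]
    rw [Finset.sum_comm]
    simp
  have hlim : ∀ j, Filter.Tendsto (slope (fun ε => ∏ i, x ε (j i)) 0) (𝓝[≠] 0) (𝓝 (D j)) :=
    fun j => hasDerivAt_iff_tendsto_slope.1 (hder j)
  have hN : Filter.Tendsto (fun ε => ∑ j : Fin n → Fin d, slope (fun ε => ∏ i, x ε (j i)) 0 ε ^ 2)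
      (𝓝[≠] 0) (𝓝 n) := by
    have := tendsto_finsetSum Finset.univ fun j (_ : j ∈ Finset.univ) => (hlim j).pow 2
    simpa only [hDsq, hDsum] using this
  refine mem_closure_of_tendsto (b := 𝓝[≠] (0 : ℝ)) (f := fun ε j =>
    slope (fun ε => ∏ i, x ε (j i)) 0 ε ^ 2 /
      ∑ j' : Fin n → Fin d, slope (fun ε => ∏ i, x ε (j' i)) 0 ε ^ 2) ?_ ?_
  · rw [tendsto_pi_nhds]
    intro j
    rw [wDist_eq hd]
    have := ((hlim j).pow 2).div hN hn
    rwa [hDsq] at this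
  · filter_upwards [hN.eventually_ne hn] with ε hε
    refine mem_CQCorr_of_sub_prod i₀ hΩ (x ε) (x 0) ε⁻¹ (fun j => ?_) hε
    simp [slope]

end UpperBound

/-! ### The W-distribution on the simplex -/

section SimplexLowerBound

open WSC

/-- If the first term does not vanish on the all-`false` word, both terms are normalized to 1 at one
ancilla value `k₀`; their ratios then obey a contradictory system on three sites. Otherwise each
term has a site where its `false` vectors are all zero, and a single `true` at a third site leaves
both terms zero. -/
theorem not_rank_two_of_w_support {ι κ : Type*} [Fintype ι] [DecidableEq ι]
    (hι : 3 ≤ Fintype.card ι) (f g : ι → Bool → κ → ℂ)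
    (h0 : ∀ b : ι → Bool, (¬ ∃ i, ∀ k, b k = decide (k = i)) → ∀ k : ι → κ,
      ∏ i, f i (b i) (k i) + ∏ i, g i (b i) (k i) = 0)
    (h1 : ∀ i, ∃ k : ι → κ,
      ∏ j, f j (decide (j = i)) (k j) + ∏ j, g j (decide (j = i)) (k j) ≠ 0) : False := by
  have hcard : ∀ a b : ι, ∃ c, c ≠ a ∧ c ≠ b := by
    intro a b
    have : ({a, b} : Finset ι) ≠ Finset.univ := by
      intro h
      have h2 := Finset.card_le_two (a := a) (b := b)
      rw [h, Finset.card_univ] at h2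
      omega
    obtain ⟨c, hc⟩ := not_forall.1 (mt Finset.eq_univ_iff_forall.2 this)
    simp only [Finset.mem_insert, Finset.mem_singleton, not_or] at hc
    exact ⟨c, hc⟩
  obtain ⟨i₀⟩ : Nonempty ι := Fintype.card_pos_iff.1 (by omega)
  have hzero : ¬ ∃ i, ∀ k : ι, false = decide (k = i) := by
    rintro ⟨i, h⟩; simpa using h i
  by_cases hf : ∀ i, ∃ k, f i false k ≠ 0
  · choose k₀ hk₀ using hf
    set F := fun i => f i false (k₀ i)
    set H := fun i => g i false (k₀ i)
    have hFp : ∏ i, F i ≠ 0 := Finset.prod_ne_zero_iff.2 fun i _ => hk₀ i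
    have hFH : ∏ i, F i + ∏ i, H i = 0 := h0 (fun _ => false) hzero k₀
    have hH : ∀ i, H i ≠ 0 := by
      intro i hi
      rw [Finset.prod_eq_zero (f := H) (Finset.mem_univ i) hi, add_zero] at hFH
      exact hFp hFH
    have hval : ∀ (b : ι → Bool) (k : ι → κ),
        ∏ i, f i (b i) (k i) + ∏ i, g i (b i) (k i) = (∏ i, F i) *
          (∏ i, f i (b i) (k i) / F i - ∏ i, g i (b i) (k i) / H i) := by
      intro b k
      rw [Finset.prod_div_distrib, Finset.prod_div_distrib, eq_neg_of_add_eq_zero_right hFH]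
      field_simp
      ring
    -- Changing the ancilla at one site only shows that the normalized `false` vectors of both terms
    -- coincide.
    have hprop : ∀ j k, f j false k / F j = g j false k / H j := by
      intro j k
      have h2 := h0 (fun _ => false) hzero (Function.update k₀ j k)
      rw [hval, mul_eq_zero, or_iff_right hFp, sub_eq_zero] at h2
      have h3 : ∀ (q : ι → Bool → κ → ℂ), (∀ i, q i false (k₀ i) ≠ 0) →
          ∏ i, q i false (Function.update k₀ j k i) / q i false (k₀ i) =
          q j false k / q j false (k₀ j) := by
        intro q hq
        rw [Finset.prod_eq_single j] <;> simp +contextual [hq]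
      exact (h3 f hk₀).symm.trans (h2.trans (h3 g hH))
    have hne : ∀ i, ∃ k, f i true k / F i ≠ g i true k / H i := by
      intro i
      by_contra! hc
      obtain ⟨k, hk⟩ := h1 i
      refine hk ?_
      rw [hval, mul_eq_zero, or_iff_right hFp, sub_eq_zero]
      refine Finset.prod_congr rfl fun j _ => ?_
      by_cases hj : j = i
      · subst hj; simp only [decide_true]; exact hc _
      · simp only [hj, decide_false]; exact hprop j _
    choose κ₁ hκ using hne
    set X := fun i => f i true (κ₁ i) / F i
    set Y := fun i => g i true (κ₁ i) / H i
    -- The word that is `true` exactly on `S` contributes factors 1 outside `S`.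
    have hS : ∀ S : Finset ι, S.card ≠ 1 → ∏ i ∈ S, X i = ∏ i ∈ S, Y i := by
      intro S hS
      have h2 := h0 (fun i => decide (i ∈ S)) (by
        rintro ⟨i, hi⟩
        refine hS (Finset.card_eq_one.2 ⟨i, ?_⟩)
        ext k; simpa using hi k) (fun i => if i ∈ S then κ₁ i else k₀ i)
      rw [hval, mul_eq_zero, or_iff_right hFp, sub_eq_zero] at h2
      have h3 : ∀ (q : ι → Bool → κ → ℂ), (∀ i, q i false (k₀ i) ≠ 0) →
          ∏ i, q i (decide (i ∈ S)) (if i ∈ S then κ₁ i else k₀ i) / q i false (k₀ i) =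
          ∏ i ∈ S, q i true (κ₁ i) / q i false (k₀ i) := by
        intro q hq
        rw [← Finset.prod_subset (Finset.subset_univ S)]
        · exact Finset.prod_congr rfl fun i hi => by simp [hi]
        · intro i _ hi; simp [hi, hq]
      exact (h3 f hk₀).symm.trans (h2.trans (h3 g hH))
    obtain ⟨b, hb, -⟩ := hcard i₀ i₀
    obtain ⟨c, hca, hcb⟩ := hcard i₀ b
    have e1 := hS {i₀, b} (by rw [Finset.card_pair hb.symm]; decide)
    have e2 := hS {i₀, c} (by rw [Finset.card_pair hca.symm]; decide)
    have e3 := hS {b, c} (by rw [Finset.card_pair hcb.symm]; decide)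
    have e4 := hS {i₀, b, c} (by
      rw [Finset.card_eq_three.2 ⟨i₀, b, c, hb.symm, hca.symm, hcb.symm, rfl⟩]; decide)
    rw [Finset.prod_pair hb.symm, Finset.prod_pair hb.symm] at e1
    rw [Finset.prod_pair hca.symm, Finset.prod_pair hca.symm] at e2
    rw [Finset.prod_pair hcb.symm, Finset.prod_pair hcb.symm] at e3
    rw [Finset.prod_insert (by simp [hb.symm, hca.symm]), Finset.prod_pair hcb.symm,
      Finset.prod_insert (by simp [hb.symm, hca.symm]), Finset.prod_pair hcb.symm] at e4
    have k1 : X i₀ ≠ Y i₀ := hκ i₀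
    have k2 : X b ≠ Y b := hκ b
    have k3 : X c ≠ Y c := hκ c
    generalize X i₀ = x₁ at *
    generalize Y i₀ = y₁ at *
    generalize X b = x₂ at *
    generalize Y b = y₂ at *
    generalize X c = x₃ at *
    generalize Y c = y₃ at *
    -- The relations for pairs and the triple force all products of two `x` and of two `y` to
    -- vanish. Then at most one `x` and at most one `y` are nonzero, and at one of the three sites
    -- they agree.
    have m1 : x₁ * x₂ = 0 := by
      refine (mul_eq_zero.1 (?_ : x₁ * x₂ * (x₃ - y₃) = 0)).resolve_right (sub_ne_zero.2 k3)
      linear_combination e4 - y₃ * e1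
    have m2 : x₁ * x₃ = 0 := by
      refine (mul_eq_zero.1 (?_ : x₁ * x₃ * (x₂ - y₂) = 0)).resolve_right (sub_ne_zero.2 k2)
      linear_combination e4 - y₂ * e2
    have m3 : x₂ * x₃ = 0 := by
      refine (mul_eq_zero.1 (?_ : x₂ * x₃ * (x₁ - y₁) = 0)).resolve_right (sub_ne_zero.2 k1)
      linear_combination e4 - y₁ * e3
    rw [m1, eq_comm] at e1
    rw [m2, eq_comm] at e2
    rw [m3, eq_comm] at e3
    simp only [mul_eq_zero] at *
    grind
  · push Not at hf
    obtain ⟨a, ha⟩ := hf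
    have hg : ∃ b, ∀ k, g b false k = 0 := by
      by_contra! hg
      choose k hk using hg
      have h2 := h0 (fun _ => false) hzero k
      rw [Finset.prod_eq_zero (Finset.mem_univ a) (ha _), zero_add] at h2
      exact Finset.prod_ne_zero_iff.2 (fun i _ => hk i) h2
    obtain ⟨b, hb⟩ := hg
    obtain ⟨c, hca, hcb⟩ := hcard a b
    obtain ⟨k, hk⟩ := h1 c
    refine hk ?_
    rw [Finset.prod_eq_zero (Finset.mem_univ a) (by simp [hca.symm, ha]),
      Finset.prod_eq_zero (Finset.mem_univ b) (by simp [hcb.symm, hb]), add_zero]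

variable {n : ℕ}

/-- A sum of squared norms vanishes only if every term does, so the support of the distribution
becomes the support of the amplitudes. -/
theorem sum_norm_sq_support_of_wDist {d K : ℕ} (hd : 2 ≤ d)
    {L : Matrix (Fin n → Fin d) (Fin n → Fin K) ℂ}
    (hL : ∀ j, wDist n d j = ∑ y, ‖L j y‖ ^ 2) :
    (∀ b : Fin n → Bool, (¬ ∃ i, ∀ k, b k = decide (k = i)) → ∀ y, L (bitWord hd b) y = 0) ∧
    ∀ i, ∃ y, L (bitWord hd fun k => decide (k = i)) y ≠ 0 := by
  have hinj : ∀ b b' : Fin n → Bool, bitWord hd b = bitWord hd b' → b = b' := by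
    intro b b' h
    funext k
    have := congrFun h k
    cases h1 : b k <;> cases h2 : b' k <;> simp [bitWord, h1, h2, Fin.ext_iff] at this ⊢
  constructor
  · intro b hb y
    have h1 := hL (bitWord hd b)
    rw [wDist_eq hd, Finset.sum_eq_zero, zero_div, eq_comm,
      Finset.sum_eq_zero_iff_of_nonneg (fun _ _ => sq_nonneg _)] at h1
    · simpa using h1 y (Finset.mem_univ y)
    · exact fun i _ => if_neg fun h => hb ⟨i, congrFun (hinj _ _ h)⟩
  · intro i
    by_contra! hc
    have h1 := hL (bitWord hd fun k => decide (k = i))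
    rw [Finset.sum_eq_zero (fun y _ => by simp [hc y]), wDist_eq hd, Finset.sum_eq_single i] at h1
    · have : (n : ℝ) ≠ 0 := by exact_mod_cast (Fin.pos i).ne'
      simp [this] at h1
    · intro i' _ hne
      exact if_neg fun h => hne (bitWord_single_injective hd h).symm
    · simp

theorem isFacet_simplex_iff {S : Finset (Fin n)} : (simplex n).IsFacet S ↔ S = Finset.univ := by
  constructor
  · intro h
    exact Finset.univ_subset_iff.1 (h.2 (y := Finset.univ) one_ne_zero (Finset.subset_univ S))
  · rintro rfl
    exact ⟨one_ne_zero, fun T _ _ => Finset.subset_univ T⟩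

instance : Unique (simplex n).MultiFacet where
  default := ⟨⟨Finset.univ, isFacet_simplex_iff.2 rfl⟩, ⟨0, Nat.one_pos⟩⟩
  uniq F := by
    refine MultiFacet.ext' (isFacet_simplex_iff.1 F.1.2) ?_
    exact Nat.lt_one_iff.1 F.2.2

theorem isConnected_simplex : (simplex n).IsConnected := fun _ α _ =>
  ⟨α default, fun F => congrArg α (Subsingleton.elim F default)⟩

/-- The simplex has a single facet, so two labels mean two product terms. Invariance plays no role,
which covers all groups at once. -/
theorem wDist_notMem_CQCorr_simplex {G : Type*} [Group G] (a : Action G (simplex n)) {d : ℕ}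
    (hn : 3 ≤ n) (hd : 2 ≤ d) : wDist n d ∉ CQCorr a d 2 := by
  intro h
  obtain ⟨-, s, hs, K, L, hP, hdec⟩ := mem_CQCorr_iff.1 h
  obtain ⟨A, -, hL⟩ := hdec.mono ⟨0, by omega⟩ hs
  obtain ⟨h0, h1⟩ := sum_norm_sq_support_of_wDist hd hP
  have hL' : ∀ x y, L x y = ∏ i, A i (fun _ => 0) (x i) (y i) + ∏ i, A i (fun _ => 1) (x i) (y i) := by
    intro x y
    rw [hL, ← (Equiv.funUnique (simplex n).MultiFacet (Fin 2)).symm.sum_comp, Fin.sum_univ_two]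
    rfl
  refine not_rank_two_of_w_support (by simpa using hn)
    (fun i b k => A i (fun _ => 0) (if b then ⟨1, hd⟩ else ⟨0, by omega⟩) k)
    (fun i b k => A i (fun _ => 1) (if b then ⟨1, hd⟩ else ⟨0, by omega⟩) k) ?_ ?_
  · intro b hb k
    rw [← h0 b hb k, hL']
    rfl
  · intro i
    obtain ⟨y, hy⟩ := h1 i
    exact ⟨y, fun h => hy (by rw [hL']; exact h)⟩

theorem notClosedAt_simplex {G : Type*} [Group G] (a : Action G (simplex n)) {d : ℕ}
    (hn : 3 ≤ n) (hd : 2 ≤ d) : NotClosedAt (CQCorr a d 2) (wDist n d) ∧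
      NotClosedAt (QQCorr a d 2) (diagState (wDist n d)) :=
  notClosedAt_of_mem_closure (wDist_notMem_CQCorr_simplex a hn hd)
    (wDist_mem_closure ⟨0, by omega⟩ isConnected_simplex hd)

end SimplexLowerBound

/-! ### Words of 2 × 2 matrices: a diagonal letter -/

section TwoByTwo

/-- The traces of all words of length `n` in two spaces of matrices vanish, except possibly for
those with exactly one letter from the space labelled `true`. -/
def TraceVanishing (n : ℕ) (V : Bool → Submodule ℂ (Matrix (Fin 2) (Fin 2) ℂ)) : Prop :=
  ∀ w : List (Bool × Matrix (Fin 2) (Fin 2) ℂ), w.length = n → w.countP Prod.fst ≠ 1 →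
    (∀ p ∈ w, p.2 ∈ V p.1) → (w.map Prod.snd).prod.trace = 0

namespace TraceVanishing

variable {n : ℕ} {V : Bool → Submodule ℂ (Matrix (Fin 2) (Fin 2) ℂ)}

theorem exists_entries (A : Matrix (Fin 2) (Fin 2) ℂ) :
    ∃ a b c d, A = !![a, b; c, d] := ⟨_, _, _, _, A.eta_fin_two⟩

theorem diag_pow (ζ : ℂ) (k : ℕ) : !![1, 0; 0, ζ] ^ k = !![1, 0; 0, ζ ^ k] := by
  induction k with
  | zero => simp [Matrix.one_fin_two]
  | succ k ih => rw [pow_succ, ih, Matrix.mul_fin_two]; simp [pow_succ]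

/-- Words made of some letters followed by copies of a fixed letter. -/
theorem append_replicate (h : TraceVanishing n V) {X : Matrix (Fin 2) (Fin 2) ℂ}
    (hX : X ∈ V false) (w : List (Bool × Matrix (Fin 2) (Fin 2) ℂ)) (l : ℕ)
    (hl : w.length + l = n) (hc : w.countP Prod.fst ≠ 1) (hw : ∀ p ∈ w, p.2 ∈ V p.1) :
    ((w.map Prod.snd).prod * X ^ l).trace = 0 := by
  have := h (w ++ List.replicate l (false, X)) (by simp [hl]) (by
    rw [List.countP_append, List.countP_replicate]; simpa using hc) (by
    intro p hp
    rcases List.mem_append.1 hp with hp | hp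
    · exact hw p hp
    · rw [List.eq_of_mem_replicate hp]; exact hX)
  simpa using this

theorem zero_entries_mem (V : Bool → Submodule ℂ (Matrix (Fin 2) (Fin 2) ℂ)) :
    !![0, 0; 0, 0] ∈ V false := by
  convert (V false).zero_mem using 1
  ext i j
  fin_cases i <;> fin_cases j <;> rfl

variable {ζ : ℂ}

theorem trace_pair (h : TraceVanishing n V) (hX : !![1, 0; 0, ζ] ∈ V false) {s : Bool}
    {a b c d a' b' c' d' : ℂ} (h1 : !![a, b; c, d] ∈ V s) (h2 : !![a', b'; c', d'] ∈ V s)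
    (k l : ℕ) (hkl : k + l + 2 = n) :
    a * a' + b * c' * ζ ^ k + c * b' * ζ ^ l + d * d' * ζ ^ (k + l) = 0 := by
  have := h.append_replicate hX ((s, !![a, b; c, d]) :: (List.replicate k (false, !![1, 0; 0, ζ]) ++
    [(s, !![a', b'; c', d'])])) l (by simp; omega) (by
      cases s <;> simp [List.countP_replicate]) (by
      intro p hp
      simp only [List.mem_cons, List.mem_append, List.mem_replicate, List.not_mem_nil,
        or_false] at hp
      rcases hp with rfl | ⟨-, rfl⟩ | rfl <;> assumption)
  simp only [List.map_cons, List.map_append, List.map_replicate, List.map_nil, List.prod_cons,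
    List.prod_append, List.prod_replicate, List.prod_nil, mul_one, diag_pow, Matrix.mul_fin_two,
    Matrix.trace_fin_two_of] at this
  rw [← this]
  ring

/-- This is the trace of the word with one such letter and `n - 1` copies of the diagonal one. -/
theorem diag_ratio (h : TraceVanishing n V) (hX : !![1, 0; 0, ζ] ∈ V false) (hζ : ζ ^ n = -1)
    (hn : 6 ≤ n) {a b c d : ℂ} (h1 : !![a, b; c, d] ∈ V false) : d = a * ζ := by
  have := h.append_replicate hX [(false, !![a, b; c, d])] (n - 1) (by simp; omega) (by simp)
    (by simpa using h1)
  simp only [List.map_cons, List.map_nil, List.prod_cons, List.prod_nil, mul_one, diag_pow,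
    Matrix.mul_fin_two, Matrix.trace_fin_two_of] at this
  obtain ⟨m, rfl⟩ : ∃ m, n = m + 1 := ⟨n - 1, by omega⟩
  simp only [add_tsub_cancel_right] at this
  linear_combination -ζ * this + d * hζ

theorem off_mem (h : TraceVanishing n V) (hX : !![1, 0; 0, ζ] ∈ V false) (hζ : ζ ^ n = -1)
    (hn : 6 ≤ n) {a b c d : ℂ} (h1 : !![a, b; c, d] ∈ V false) : !![0, b; c, 0] ∈ V false := by
  have h2 := (V false).sub_mem h1 ((V false).smul_mem a hX)
  have h3 := h.diag_ratio hX hζ hn h1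
  convert h2 using 1
  ext i j
  fin_cases i <;> fin_cases j <;> simp [h3]

/-- Two different spacings of the letters along the cyclic word give independent linear equations
for the two products, as `ζ ^ 2 ≠ 1`. -/
theorem off_mul_eq_zero (h : TraceVanishing n V) (hX : !![1, 0; 0, ζ] ∈ V false)
    (hζ : ζ ^ n = -1) (hn : 6 ≤ n) (hζ2 : ζ ^ 2 ≠ 1) {b c b' c' : ℂ}
    (h1 : !![0, b; c, 0] ∈ V false) (h2 : !![0, b'; c', 0] ∈ V false) :
    b * c' = 0 ∧ c * b' = 0 := by
  obtain ⟨m, rfl⟩ : ∃ m, n = m + 3 := ⟨n - 3, by omega⟩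
  have hζ0 : ζ ≠ 0 := by rintro rfl; simp at hζ
  have e1 := h.trace_pair hX h1 h2 0 (m + 1) (by ring)
  have e2 := h.trace_pair hX h1 h2 1 m (by ring)
  have h3 : c * b' = 0 := by
    refine (mul_eq_zero.1 (?_ : c * b' * (ζ ^ m * (ζ ^ 2 - 1)) = 0)).resolve_right
      (mul_ne_zero (pow_ne_zero _ hζ0) (sub_ne_zero.2 hζ2))
    linear_combination ζ * e1 - e2
  exact ⟨by linear_combination e1 - ζ ^ (m + 1) * h3, h3⟩

/-- Words with two copies of the letter at three spacings force `b * c = 0`. Words with two and with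
three copies then say that `a * ζ` and `d` have equal squares and equal cubes. -/
theorem trace_diag_of_sq_ne_one (h : TraceVanishing n V) (hX : !![1, 0; 0, ζ] ∈ V false)
    (hζ : ζ ^ n = -1) (hn : 6 ≤ n) (hζ2 : ζ ^ 2 ≠ 1) {a b c d : ℂ}
    (h1 : !![a, b; c, d] ∈ V true) : a * ζ = d := by
  obtain ⟨m, rfl⟩ : ∃ m, n = m + 4 := ⟨n - 4, by omega⟩
  have hζ1 : 1 - ζ ≠ 0 := by
    intro h
    exact hζ2 (by linear_combination (-1 - ζ) * h)
  have e0 := h.trace_pair hX h1 h1 0 (m + 2) (by ring)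
  have e1 := h.trace_pair hX h1 h1 1 (m + 1) (by ring)
  have e2 := h.trace_pair hX h1 h1 2 m (by ring)
  have hbc : b * c = 0 := by
    by_contra hbc
    have f1 : 1 - ζ ^ m * ζ = 0 := by
      refine (mul_eq_zero.1 (?_ : (b * c * (1 - ζ)) * (1 - ζ ^ m * ζ) = 0)).resolve_left
        (mul_ne_zero hbc hζ1)
      linear_combination e0 - e1
    have f2 : ζ - ζ ^ m = 0 := by
      refine (mul_eq_zero.1 (?_ : (b * c * (1 - ζ)) * (ζ - ζ ^ m) = 0)).resolve_left
        (mul_ne_zero hbc hζ1)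
      linear_combination e1 - e2
    exact hζ2 (by linear_combination -f1 + ζ * f2)
  have e3 := h.append_replicate hX [(true, !![a, b; c, d]), (true, !![a, b; c, d]),
    (true, !![a, b; c, d])] (m + 1) (by simp; omega) (by simp) (by simpa using h1)
  simp only [List.map_cons, List.map_nil, List.prod_cons, List.prod_nil, mul_one, diag_pow,
    Matrix.mul_fin_two, Matrix.trace_fin_two_of] at e3
  have g2 : (a * ζ) ^ 2 = d ^ 2 := by
    linear_combination ζ ^ 2 * e0 - (ζ ^ 2 + ζ ^ (m + 4)) * hbc - d ^ 2 * hζ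
  have g3 : (a * ζ) ^ 3 = d ^ 3 := by
    linear_combination ζ ^ 3 * e3 - (2 * a + d) * ζ ^ 3 * hbc - (a + 2 * d) * ζ ^ (m + 4) * hbc -
      d ^ 3 * hζ
  by_cases hd : d = 0
  · rw [hd] at g2 ⊢
    simpa using g2
  · refine mul_right_cancel₀ (pow_ne_zero 2 hd) ?_
    rw [← g2]; rw [g2]
    linear_combination g3 - a * ζ * g2

theorem trace_off_of_sq_ne_one (h : TraceVanishing n V) (hX : !![1, 0; 0, ζ] ∈ V false)
    (hζ : ζ ^ n = -1) (hn : 6 ≤ n) (hζ2 : ζ ^ 2 ≠ 1) {a b c d y z : ℂ}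
    (h1 : !![a, b; c, d] ∈ V true) (h2 : !![0, y; z, 0] ∈ V false) : b * z = 0 ∧ c * y = 0 := by
  have hζ0 : ζ ≠ 0 := by rintro rfl; rw [zero_pow (by omega)] at hζ; simp at hζ
  have e := h.append_replicate hX [(true, !![a, b; c, d]), (false, !![0, y; z, 0]),
    (true, !![a, b; c, d]), (false, !![0, y; z, 0])] (n - 4) (by simp; omega) (by simp)
    (by simp [h1, h2])
  simp only [List.map_cons, List.map_nil, List.prod_cons, List.prod_nil, mul_one, diag_pow,
    Matrix.mul_fin_two, Matrix.trace_fin_two_of] at e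
  have hyz := (h.off_mul_eq_zero hX hζ hn hζ2 h2 h2).1
  rcases mul_eq_zero.1 hyz with rfl | rfl
  · refine ⟨pow_eq_zero_iff (two_ne_zero) |>.1 ?_, mul_zero _⟩
    linear_combination e
  · refine ⟨mul_zero _, pow_eq_zero_iff (two_ne_zero) |>.1 ?_⟩
    refine (mul_eq_zero.1 (?_ : (c * y) ^ 2 * ζ ^ (n - 4) = 0)).resolve_right
      (pow_ne_zero _ hζ0)
    linear_combination e

/-- Products of off-diagonal parts vanish, so a product is linear in them. Each off-diagonal part
has at most one nonzero entry, so rescaling that entry by powers of `ζ` stays inside the space. -/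
theorem prod_of_sq_ne_one (h : TraceVanishing n V) (hX : !![1, 0; 0, ζ] ∈ V false)
    (hζ : ζ ^ n = -1) (hn : 6 ≤ n) (hζ2 : ζ ^ 2 ≠ 1)
    (l : List (Matrix (Fin 2) (Fin 2) ℂ)) (hl : ∀ U ∈ l, U ∈ V false) :
    ∃ p y z, l.prod = !![p, y; z, p * ζ ^ l.length] ∧ !![0, y; z, 0] ∈ V false := by
  induction l with
  | nil => exact ⟨1, 0, 0, by simp [Matrix.one_fin_two], zero_entries_mem V⟩
  | cons U l ih =>
    obtain ⟨p, y, z, hp, hyz⟩ := ih fun U hU => hl U (List.mem_cons_of_mem _ hU)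
    have hU := hl U List.mem_cons_self
    obtain ⟨a, b, c, d, rfl⟩ := exists_entries U
    obtain rfl := h.diag_ratio hX hζ hn hU
    have hbc := h.off_mem hX hζ hn hU
    obtain ⟨k1, k2⟩ := h.off_mul_eq_zero hX hζ hn hζ2 hbc hyz
    refine ⟨a * p, a * y + b * (p * ζ ^ l.length), c * p + a * ζ * z, ?_, ?_⟩
    · rw [List.prod_cons, hp, Matrix.mul_fin_two, k1, k2, List.length_cons]
      congr 1
      simp; ring
    · have m1 : !![0, b * ζ ^ l.length; c, 0] ∈ V false := by
        rcases mul_eq_zero.1 (h.off_mul_eq_zero hX hζ hn hζ2 hbc hbc).1 with rfl | rfl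
        · simpa using hbc
        · simpa [mul_comm] using (V false).smul_mem (ζ ^ l.length) hbc
      have m2 : !![0, y; ζ * z, 0] ∈ V false := by
        rcases mul_eq_zero.1 (h.off_mul_eq_zero hX hζ hn hζ2 hyz hyz).1 with rfl | rfl
        · simpa using (V false).smul_mem ζ hyz
        · simpa using hyz
      convert (V false).add_mem ((V false).smul_mem a m2) ((V false).smul_mem p m1) using 1
      ext i j
      fin_cases i <;> fin_cases j <;> simp <;> ring

/-- The off-diagonal contributions vanish separately, and the diagonal one is a multiple of `1 + ζ ^
n`. -/
theorem trace_of_sq_ne_one (h : TraceVanishing n V) (hX : !![1, 0; 0, ζ] ∈ V false)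
    (hζ : ζ ^ n = -1) (hn : 6 ≤ n) (hζ2 : ζ ^ 2 ≠ 1) {Y : Matrix (Fin 2) (Fin 2) ℂ}
    (hY : Y ∈ V true) (l : List (Matrix (Fin 2) (Fin 2) ℂ)) (hl : ∀ U ∈ l, U ∈ V false)
    (hlen : l.length + 1 = n) : (Y * l.prod).trace = 0 := by
  obtain ⟨p, y, z, hp, hyz⟩ := h.prod_of_sq_ne_one hX hζ hn hζ2 l hl
  obtain ⟨a, b, c, d, rfl⟩ := exists_entries Y
  obtain ⟨e1, e2⟩ := h.trace_off_of_sq_ne_one hX hζ hn hζ2 hY hyz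
  obtain rfl := h.trace_diag_of_sq_ne_one hX hζ hn hζ2 hY
  rw [← hlen, pow_succ] at hζ
  rw [hp, Matrix.mul_fin_two, Matrix.trace_fin_two_of]
  linear_combination e1 + e2 + a * p * hζ

/-- For `ζ = -1` the off-diagonal parts need not multiply to zero, but they satisfy `b * c' = c *
b'`. This symmetry keeps the shape of the product up to signs depending on the parity of the length.
-/
theorem prod_of_neg_one (h : TraceVanishing n V) (hX : !![1, 0; 0, (-1 : ℂ)] ∈ V false)
    (hodd : Odd n) (hn : 6 ≤ n)
    (l : List (Matrix (Fin 2) (Fin 2) ℂ)) (hl : ∀ U ∈ l, U ∈ V false) :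
    ∃ p y z, l.prod = !![p, y; z * (-1) ^ (l.length + 1), p * (-1) ^ l.length] ∧
      !![0, y; z, 0] ∈ V false := by
  have hζ : (-1 : ℂ) ^ n = -1 := hodd.neg_one_pow
  induction l with
  | nil => exact ⟨1, 0, 0, by simp [Matrix.one_fin_two], zero_entries_mem V⟩
  | cons U l ih =>
    obtain ⟨p, y, z, hp, hyz⟩ := ih fun U hU => hl U (List.mem_cons_of_mem _ hU)
    have hU := hl U List.mem_cons_self
    obtain ⟨a, b, c, d, rfl⟩ := exists_entries U
    obtain rfl := h.diag_ratio hX hζ hn hU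
    have hbc := h.off_mem hX hζ hn hU
    have k := h.trace_pair hX hbc hyz 0 (n - 2) (by omega)
    have k2 : (-1 : ℂ) ^ (n - 2) = -1 := by
      obtain ⟨m, rfl⟩ : ∃ m, n = m + 2 := ⟨n - 2, by omega⟩
      simpa [pow_add] using hζ
    rw [k2] at k
    refine ⟨a * p + b * (z * (-1) ^ (l.length + 1)), a * y + b * (p * (-1) ^ l.length),
      (c * p + a * -1 * (z * (-1) ^ (l.length + 1))) * (-1) ^ (l.length), ?_, ?_⟩
    · rw [List.prod_cons, hp, Matrix.mul_fin_two, List.length_cons]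
      rcases neg_one_pow_eq_or ℂ l.length with e | e <;> simp [pow_succ, e]
      · linear_combination -k
      · linear_combination -k
    · rcases neg_one_pow_eq_or ℂ l.length with e | e
      · convert (V false).add_mem ((V false).smul_mem a hyz) ((V false).smul_mem p hbc) using 1
        ext i j
        fin_cases i <;> fin_cases j <;> simp [pow_succ, e] <;> ring
      · convert (V false).sub_mem ((V false).smul_mem a hyz) ((V false).smul_mem p hbc) using 1
        ext i j
        fin_cases i <;> fin_cases j <;> simp [pow_succ, e] <;> ring

/-- As `n - 1` is even, the trace is `(a + d) * p + (c * y - b * z)`. Each bracket is shown to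
vanish by words containing the `true` letter two or three times. -/
theorem trace_of_neg_one (h : TraceVanishing n V) (hX : !![1, 0; 0, (-1 : ℂ)] ∈ V false)
    (hodd : Odd n) (hn : 6 ≤ n) {Y : Matrix (Fin 2) (Fin 2) ℂ}
    (hY : Y ∈ V true) (l : List (Matrix (Fin 2) (Fin 2) ℂ)) (hl : ∀ U ∈ l, U ∈ V false)
    (hlen : l.length + 1 = n) : (Y * l.prod).trace = 0 := by
  obtain ⟨p, y, z, hp, hyz⟩ := h.prod_of_neg_one hX hodd hn l hl
  obtain ⟨m, rfl⟩ : ∃ m, n = m + 6 := ⟨n - 6, by omega⟩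
  have hm : (-1 : ℂ) ^ m = -1 := by
    have := hodd.neg_one_pow (α := ℂ)
    linear_combination this
  have hlen' : (-1 : ℂ) ^ l.length = 1 := by
    obtain rfl : m = l.length - 5 := by omega
    have : l.length = (l.length - 5) + 5 := by omega
    rw [this, pow_add, hm]; norm_num
  rw [pow_succ, hlen'] at hp
  obtain ⟨a, b, c, d, rfl⟩ := exists_entries Y
  have e1 := h.trace_pair hX hY hY 0 (m + 4) (by ring)
  have e2 := h.append_replicate hX [(true, !![a, b; c, d]), (true, !![a, b; c, d]),
    (true, !![a, b; c, d])] (m + 3) (by simp; omega) (by simp) (by simpa using hY)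
  have e3 := h.append_replicate hX [(true, !![a, b; c, d]), (false, !![1, 0; 0, -1]),
    (true, !![a, b; c, d]), (true, !![a, b; c, d])] (m + 2) (by simp; omega) (by simp)
    (by simp [hY, hX])
  -- This word of six prescribed letters is the longest one needed, whence the bound `6 ≤ n`.
  have e4 := h.append_replicate hX [(true, !![a, b; c, d]), (false, !![1, 0; 0, -1]),
    (false, !![0, y; z, 0]), (true, !![a, b; c, d]), (false, !![1, 0; 0, -1]),
    (false, !![0, y; z, 0])] m (by simp; omega) (by simp) (by simp [hY, hX, hyz])
  have e5 := h.append_replicate hX [(true, !![a, b; c, d]), (true, !![a, b; c, d]),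
    (true, !![a, b; c, d]), (false, !![1, 0; 0, -1]),
    (false, !![0, y; z, 0])] (m + 1) (by simp; omega) (by simp) (by simp [hY, hX, hyz])
  have e6 := h.append_replicate hX [(true, !![a, b; c, d]), (false, !![1, 0; 0, -1]),
    (false, !![0, y; z, 0]), (true, !![a, b; c, d])] (m + 2) (by simp; omega) (by simp)
    (by simp [hY, hX, hyz])
  simp only [List.map_cons, List.map_nil, List.prod_cons, List.prod_nil, mul_one, diag_pow,
    Matrix.mul_fin_two, Matrix.trace_fin_two_of, pow_add, hm] at e1 e2 e3 e4 e5 e6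
  have had : a + d = 0 := by
    by_contra had
    have : a = d := by
      refine sub_eq_zero.1 ((mul_eq_zero.1 (?_ : (a + d) * (a - d) = 0)).resolve_left had)
      linear_combination e1
    subst this
    have : a ^ 3 = 0 := by linear_combination (1 / 8 : ℂ) * e2 + (3 / 8 : ℂ) * e3
    exact had (by simp [pow_eq_zero_iff] at this; simp [this])
  obtain rfl : d = -a := by linear_combination had
  have hs : c * y - b * z = 0 := by
    by_contra hs
    have ha : a = 0 := by
      refine (mul_eq_zero.1 (?_ : (c * y - b * z) * a = 0)).resolve_left hs
      linear_combination (1 / 2 : ℂ) * e6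
    subst ha
    have h1 : b * z + c * y = 0 := by
      refine (mul_eq_zero.1 (?_ : (c * y - b * z) * (b * z + c * y) = 0)).resolve_left hs
      linear_combination -e4
    have h2 : b * c = 0 := by
      refine (mul_eq_zero.1 (?_ : (c * y - b * z) * (b * c) = 0)).resolve_left hs
      linear_combination e5
    rcases mul_eq_zero.1 h2 with rfl | rfl
    · exact hs (by linear_combination h1)
    · exact hs (by linear_combination -h1)
  rw [hp, Matrix.mul_fin_two, Matrix.trace_fin_two_of]
  linear_combination hs

end TraceVanishing

end TwoByTwo

/-! ### Words of 2 × 2 matrices: reduction to a diagonal letter -/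

section TwoByTwo

namespace TraceVanishing

variable {n : ℕ} {V : Bool → Submodule ℂ (Matrix (Fin 2) (Fin 2) ℂ)}

/-- Polarization gives anticommutation, and nilpotency gives trace zero. Then `k4`, `k6` and `k7`
say that the two matrices are proportional. -/
theorem mul_eq_zero_of_sq_eq_zero {W : Submodule ℂ (Matrix (Fin 2) (Fin 2) ℂ)}
    (h : ∀ X ∈ W, X * X = 0) {X Z : Matrix (Fin 2) (Fin 2) ℂ} (hX : X ∈ W) (hZ : Z ∈ W) :
    X * Z = 0 := by
  have h1 : X * Z + Z * X = 0 := by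
    have := h _ (W.add_mem hX hZ)
    rw [add_mul, mul_add, mul_add, h X hX, h Z hZ] at this
    simpa using this
  have h2 : ∀ A : Matrix (Fin 2) (Fin 2) ℂ, A * A = 0 → A.trace = 0 := by
    intro A hA
    have : IsNilpotent A := ⟨2, by rw [pow_two, hA]⟩
    exact (Matrix.isNilpotent_trace_of_isNilpotent this).eq_zero
  have tX := h2 X (h X hX)
  have tZ := h2 Z (h Z hZ)
  have hXX := h X hX
  have hZZ := h Z hZ
  obtain ⟨a, b, c, d, rfl⟩ := exists_entries X
  obtain ⟨p, q, r, s, rfl⟩ := exists_entries Z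
  rw [Matrix.trace_fin_two_of] at tX tZ
  obtain rfl : d = -a := by linear_combination tX
  obtain rfl : s = -p := by linear_combination tZ
  rw [Matrix.mul_fin_two] at hXX hZZ
  rw [Matrix.mul_fin_two, Matrix.mul_fin_two] at h1
  have k1 : a * a + b * c = 0 := by simpa using congrFun (congrFun hXX 0) 0
  have k2 : p * p + q * r = 0 := by simpa using congrFun (congrFun hZZ 0) 0
  have k3 : a * p + b * r + (p * a + q * c) = 0 := by simpa using congrFun (congrFun h1 0) 0
  have k4 : b * r = c * q := by
    refine sub_eq_zero.1 (pow_eq_zero_iff two_ne_zero |>.1 ?_)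
    linear_combination (b * r + c * q - 2 * a * p) * k3 + 4 * p * p * k1 - 4 * b * c * k2
  have k5 : a * p + b * r = 0 := by linear_combination (1 / 2 : ℂ) * k3 + (1 / 2 : ℂ) * k4
  have k6 : a * q - b * p = 0 := by
    refine pow_eq_zero_iff two_ne_zero |>.1 ?_
    linear_combination q * q * k1 + b * b * k2 - b * q * k3
  have k7 : c * p - a * r = 0 := by
    refine pow_eq_zero_iff two_ne_zero |>.1 ?_
    linear_combination c * c * k2 + r * r * k1 - c * r * k3
  rw [Matrix.mul_fin_two]
  ext i j
  fin_cases i <;> fin_cases j <;> simp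
  · exact k5
  · linear_combination k6
  · linear_combination k7
  · linear_combination k5 - k4

theorem trace_of_diag (h : TraceVanishing n V) {ζ : ℂ} (hX : !![1, 0; 0, ζ] ∈ V false)
    (hζ : ζ ^ n = -1) (hn : 6 ≤ n) {Y : Matrix (Fin 2) (Fin 2) ℂ}
    (hY : Y ∈ V true) (l : List (Matrix (Fin 2) (Fin 2) ℂ)) (hl : ∀ U ∈ l, U ∈ V false)
    (hlen : l.length + 1 = n) : (Y * l.prod).trace = 0 := by
  by_cases hζ2 : ζ ^ 2 = 1
  · rcases mul_self_eq_one_iff.1 ((sq ζ).symm.trans hζ2) with rfl | rfl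
    · norm_num at hζ
    · refine h.trace_of_neg_one hX ?_ hn hY l hl hlen
      by_contra hodd
      rw [(Nat.not_odd_iff_even.1 hodd).neg_one_pow] at hζ
      norm_num at hζ
  · exact h.trace_of_sq_ne_one hX hζ hn hζ2 hY l hl hlen

/-- Conjugation by an invertible element. -/
def conjEquiv (u : (Matrix (Fin 2) (Fin 2) ℂ)ˣ) :
    Matrix (Fin 2) (Fin 2) ℂ ≃ₐ[ℂ] Matrix (Fin 2) (Fin 2) ℂ where
  toFun A := u * A * ↑u⁻¹
  invFun A := ↑u⁻¹ * A * u
  left_inv A := by simp [mul_assoc]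
  right_inv A := by simp [mul_assoc]
  map_mul' A B := by simp [mul_assoc]
  map_add' A B := by simp [mul_add, add_mul]
  commutes' r := by simp [← Algebra.commutes]

theorem trace_conjEquiv (u : (Matrix (Fin 2) (Fin 2) ℂ)ˣ) (A : Matrix (Fin 2) (Fin 2) ℂ) :
    (conjEquiv u A).trace = A.trace := by
  change (_ * A * _ : Matrix (Fin 2) (Fin 2) ℂ).trace = _
  rw [mul_assoc, Matrix.trace_mul_comm, mul_assoc, Units.inv_mul, mul_one]

theorem comap_conjEquiv (h : TraceVanishing n V) (u : (Matrix (Fin 2) (Fin 2) ℂ)ˣ) :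
    TraceVanishing n fun b => (V b).comap (conjEquiv u).toLinearMap := by
  intro w hw hc hV
  have := h (w.map fun p => (p.1, conjEquiv u p.2)) (by simpa using hw) (by
    rw [List.countP_map]; exact hc) (by
    intro p hp
    obtain ⟨q, hq, rfl⟩ := List.mem_map.1 hp
    exact hV q hq)
  rw [List.map_map] at this
  have e : (w.map (Prod.snd ∘ fun p => (p.1, conjEquiv u p.2))) =
      (w.map Prod.snd).map (conjEquiv u) := by simp
  rwa [e, ← map_list_prod, trace_conjEquiv] at this

/-- By Cayley–Hamilton both sides satisfy the same two-step recursion. -/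
theorem trace_pow_fin_two (X : Matrix (Fin 2) (Fin 2) ℂ) {s t : ℂ} (h1 : s + t = X.trace)
    (h2 : s * t = X.det) (k : ℕ) : (X ^ k).trace = s ^ k + t ^ k := by
  have hX : X * X = (s + t) • X - (s * t) • 1 := by
    rw [h1, h2]
    obtain ⟨a, b, c, d, rfl⟩ := exists_entries X
    rw [Matrix.trace_fin_two_of, Matrix.det_fin_two_of, Matrix.mul_fin_two]
    ext i j
    fin_cases i <;> fin_cases j <;> simp <;> ring
  induction k using Nat.twoStepInduction with
  | zero => simp; norm_num
  | one => simp [h1]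
  | more k ih1 ih2 =>
    have : X ^ (k + 2) = (s + t) • X ^ (k + 1) - (s * t) • X ^ k := by
      rw [pow_succ, pow_succ, mul_assoc, hX, mul_sub, mul_smul_comm, mul_smul_comm, mul_one]
    rw [this, Matrix.trace_sub, Matrix.trace_smul, Matrix.trace_smul, ih1, ih2, smul_eq_mul,
      smul_eq_mul]
    ring

theorem exists_add_mul_eq (p q : ℂ) : ∃ s t : ℂ, s + t = p ∧ s * t = q := by
  obtain ⟨z, hz⟩ := IsAlgClosed.exists_pow_nat_eq (p ^ 2 - 4 * q) two_pos
  exact ⟨(p + z) / 2, (p - z) / 2, by ring, by linear_combination (-1 / 4 : ℂ) * hz⟩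

theorem exists_diagonalization (X : Matrix (Fin 2) (Fin 2) ℂ) {s t : ℂ} (hst : s ≠ t)
    (h1 : s + t = X.trace) (h2 : s * t = X.det) :
    ∃ P : Matrix (Fin 2) (Fin 2) ℂ, P.det ≠ 0 ∧ X * P = P * !![s, 0; 0, t] := by
  obtain ⟨a, b, c, d, rfl⟩ := exists_entries X
  rw [Matrix.trace_fin_two_of] at h1
  rw [Matrix.det_fin_two_of] at h2
  have hs : s ^ 2 - s * (a + d) + (a * d - b * c) = 0 := by
    linear_combination s * h1 - h2
  have ht : t ^ 2 - t * (a + d) + (a * d - b * c) = 0 := by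
    linear_combination t * h1 - h2
  by_cases hb : b = 0
  · by_cases hc : c = 0
    · subst hb hc
      have : (s - a) * (s - d) = 0 := by linear_combination hs
      rcases mul_eq_zero.1 this with h | h
      · obtain rfl : s = a := sub_eq_zero.1 h
        obtain rfl : t = d := by linear_combination h1
        exact ⟨1, by simp, by simp⟩
      · obtain rfl : s = d := sub_eq_zero.1 h
        obtain rfl : t = a := by linear_combination h1
        exact ⟨!![0, 1; 1, 0], by simp, by simp⟩
    · refine ⟨!![s - d, t - d; c, c], ?_, ?_⟩
      · rw [Matrix.det_fin_two_of]
        have : (s - d) * c - (t - d) * c = c * (s - t) := by ring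
        rw [this]
        exact mul_ne_zero hc (sub_ne_zero.2 hst)
      · rw [Matrix.mul_fin_two, Matrix.mul_fin_two]
        ext i j
        fin_cases i <;> fin_cases j <;> simp
        · linear_combination -hs
        · linear_combination -ht
        · ring
        · ring
  · refine ⟨!![b, b; s - a, t - a], ?_, ?_⟩
    · rw [Matrix.det_fin_two_of]
      have : b * (t - a) - b * (s - a) = b * (t - s) := by ring
      rw [this]
      exact mul_ne_zero hb (sub_ne_zero.2 hst.symm)
    · rw [Matrix.mul_fin_two, Matrix.mul_fin_two]
      ext i j
      fin_cases i <;> fin_cases j <;> simp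
      · ring
      · ring
      · linear_combination -hs
      · linear_combination -ht

/-- If the traces of all words with no or several letters from the second space vanish, then so do
those with exactly one such letter, provided the words are long enough. -/
theorem trace_eq_zero (h : TraceVanishing n V) (hn : 6 ≤ n) {Y : Matrix (Fin 2) (Fin 2) ℂ}
    (hY : Y ∈ V true) (l : List (Matrix (Fin 2) (Fin 2) ℂ)) (hl : ∀ U ∈ l, U ∈ V false)
    (hlen : l.length + 1 = n) : (Y * l.prod).trace = 0 := by
  -- If all squares vanish, two neighbouring `false` letters already multiply to zero. Otherwise a
  -- letter with nonzero square has eigenvalues with `s ^ n + t ^ n = 0`; they are nonzero and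
  -- distinct, so it is diagonalizable.
  by_cases hnil : ∀ X ∈ V false, X * X = 0
  · obtain ⟨U, U', l, rfl⟩ : ∃ U U' l', l = U :: U' :: l' := by
      rcases l with _ | ⟨U, _ | ⟨U', l⟩⟩
      · simp at hlen; omega
      · simp at hlen; omega
      · exact ⟨U, U', l, rfl⟩
    rw [List.prod_cons, List.prod_cons, ← mul_assoc U, mul_eq_zero_of_sq_eq_zero hnil
      (hl U (by simp)) (hl U' (by simp)), zero_mul, mul_zero, Matrix.trace_zero]
  · push Not at hnil
    obtain ⟨X, hX, hX2⟩ := hnil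
    obtain ⟨s, t, h1, h2⟩ := exists_add_mul_eq X.trace X.det
    have hpow : s ^ n + t ^ n = 0 := by
      rw [← trace_pow_fin_two X h1 h2]
      simpa using h.append_replicate hX [] n (by simp) (by simp) (by simp)
    have hn0 : n ≠ 0 := by omega
    have hs : s ≠ 0 := by
      rintro rfl
      obtain rfl : t = 0 := by simpa [zero_pow hn0, hn0] using hpow
      refine hX2 ?_
      obtain ⟨a, b, c, d, rfl⟩ := exists_entries X
      rw [Matrix.trace_fin_two_of] at h1
      rw [Matrix.det_fin_two_of] at h2
      rw [Matrix.mul_fin_two]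
      ext i j
      fin_cases i <;> fin_cases j <;> simp
      · linear_combination h2 - a * h1
      · linear_combination -b * h1
      · linear_combination -c * h1
      · linear_combination h2 - d * h1
    have hst : s ≠ t := by
      rintro rfl
      have : s ^ n = 0 := by linear_combination (1 / 2 : ℂ) * hpow
      exact hs (pow_eq_zero_iff hn0 |>.1 this)
    obtain ⟨P, hP, hPX⟩ := exists_diagonalization X hst h1 h2
    have hPu : IsUnit P := by
      rw [Matrix.isUnit_iff_isUnit_det]; exact isUnit_iff_ne_zero.2 hP
    obtain ⟨u, rfl⟩ := hPu
    -- Traces are unchanged by conjugation, and the space is closed under scaling, so the letter may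
    -- be normalized to have first eigenvalue 1.
    have hX' : !![1, 0; 0, t / s] ∈ (V false).comap (conjEquiv u).toLinearMap := by
      have e : conjEquiv u !![1, 0; 0, t / s] = s⁻¹ • X := by
        have e1 : !![1, 0; 0, t / s] = s⁻¹ • !![s, 0; 0, t] := by
          ext i j
          fin_cases i <;> fin_cases j <;> simp [hs]
          field_simp
        rw [e1, map_smul]
        congr 1
        change (u : Matrix (Fin 2) (Fin 2) ℂ) * _ * _ = X
        rw [← hPX, mul_assoc, Units.mul_inv, mul_one]
      rw [Submodule.mem_comap]
      change conjEquiv u _ ∈ _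
      rw [e]
      exact (V false).smul_mem _ hX
    have hz : (t / s) ^ n = -1 := by
      rw [div_pow, div_eq_iff (pow_ne_zero n hs)]
      linear_combination hpow
    have := (h.comap_conjEquiv u).trace_of_diag hX' hz hn (Y := (conjEquiv u).symm Y)
      (by rw [Submodule.mem_comap]; change conjEquiv u _ ∈ _; simpa using hY)
      (l.map (conjEquiv u).symm) (by
        intro U hU
        obtain ⟨U', hU', rfl⟩ := List.mem_map.1 hU
        rw [Submodule.mem_comap]; change conjEquiv u _ ∈ _; simpa using hl U' hU') (by simpa using hlen)
    rwa [← map_list_prod, ← map_mul, ← trace_conjEquiv u, AlgEquiv.apply_symm_apply] at this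

/-- It suffices to consider words in generators. -/
theorem of_span {S : Bool → Set (Matrix (Fin 2) (Fin 2) ℂ)}
    (h : ∀ w : List (Bool × Matrix (Fin 2) (Fin 2) ℂ), w.length = n → w.countP Prod.fst ≠ 1 →
      (∀ p ∈ w, p.2 ∈ S p.1) → (w.map Prod.snd).prod.trace = 0) :
    TraceVanishing n fun b => Submodule.span ℂ (S b) := by
  -- The prefix `w₁` consists of generators. Letters of `w₂` are expanded by linearity and moved to
  -- the prefix one at a time.
  have key : ∀ (w₁ w₂ : List (Bool × Matrix (Fin 2) (Fin 2) ℂ)), w₁.length + w₂.length = n →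
      w₁.countP Prod.fst + w₂.countP Prod.fst ≠ 1 → (∀ p ∈ w₁, p.2 ∈ S p.1) →
      (∀ p ∈ w₂, p.2 ∈ Submodule.span ℂ (S p.1)) →
      ((w₁.map Prod.snd).prod * (w₂.map Prod.snd).prod).trace = 0 := by
    intro w₁ w₂
    induction w₂ generalizing w₁ with
    | nil =>
      intro h1 h2 h3 _
      simpa using h w₁ (by simpa using h1) (by simpa using h2) h3
    | cons p w ih =>
      intro h1 h2 h3 h4
      have hp := h4 p List.mem_cons_self
      have h5 : ∀ q ∈ w, q.2 ∈ Submodule.span ℂ (S q.1) :=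
        fun q hq => h4 q (List.mem_cons_of_mem _ hq)
      obtain ⟨b, X⟩ := p
      simp only [List.map_cons, List.prod_cons]
      simp only at hp
      induction hp using Submodule.span_induction with
      | mem x hx =>
        have := ih (w₁ ++ [(b, x)]) (by simp at h1 ⊢; omega) (by
          simp [List.countP_cons] at h2 ⊢; omega) (by
          intro q hq
          rcases List.mem_append.1 hq with hq | hq
          · exact h3 q hq
          · rw [List.mem_singleton.1 hq]; exact hx) h5
        simpa [mul_assoc] using this
      | zero => simp
      | add x y hx hy ihx ihy =>
        rw [add_mul, mul_add, Matrix.trace_add,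
          ihx (by simpa using h1) (by simpa [List.countP_cons] using h2) ?_,
          ihy (by simpa using h1) (by simpa [List.countP_cons] using h2) ?_, add_zero]
        · intro q hq
          rcases List.mem_cons.1 hq with rfl | hq
          · exact hy
          · exact h5 q hq
        · intro q hq
          rcases List.mem_cons.1 hq with rfl | hq
          · exact hx
          · exact h5 q hq
      | smul c x hx ihx =>
        rw [smul_mul_assoc, mul_smul_comm, Matrix.trace_smul,
          ihx (by simpa using h1) (by simpa [List.countP_cons] using h2) ?_, smul_zero]
        intro q hq
        rcases List.mem_cons.1 hq with rfl | hq
        · exact hx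
        · exact h5 q hq
  intro w h1 h2 h3
  simpa using key [] w (by simpa using h1) (by simpa using h2) (by simp) h3

end TraceVanishing

end TwoByTwo

/-! ### Traces of products as sums over closed paths -/

section CyclicTrace

/-- The entries of a product of matrices as sums over paths. -/
theorem Matrix.prod_ofFn_apply {R ι : Type*} [CommRing R] [Fintype ι] [DecidableEq ι] (m : ℕ)
    (N : Fin (m + 1) → Matrix ι ι R) (s t : ι) :
    (List.ofFn N).prod s t = ∑ α : Fin m → ι, ∏ i : Fin (m + 1),
      N i (Fin.cons (α := fun _ => ι) s α i) (Fin.snoc (α := fun _ => ι) α t i) := by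
  induction m generalizing s with
  | zero =>
    rw [Fintype.sum_unique]
    simp [Fin.snoc]
  | succ m ih =>
    rw [List.ofFn_succ, List.prod_cons, Matrix.mul_apply]
    simp_rw [ih, Finset.mul_sum]
    rw [← Fintype.sum_prod_type', ← (Fin.consEquiv fun _ => ι).sum_comp]
    refine Finset.sum_congr rfl fun ⟨u, α⟩ _ => ?_
    rw [Fin.prod_univ_succ (n := m + 1)]
    simp only [Fin.consEquiv, Equiv.coe_fn_mk, Fin.cons_zero, Fin.cons_succ,
      ← Fin.cons_snoc_eq_snoc_cons]

theorem Matrix.trace_prod_ofFn {R ι : Type*} [CommRing R] [Fintype ι] [DecidableEq ι] {n : ℕ}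
    (hn : 0 < n) (N : Fin n → Matrix ι ι R) :
    (List.ofFn N).prod.trace = ∑ α : Fin n → ι, ∏ i, N i (α i) (α (finRotate n i)) := by
  obtain ⟨m, rfl⟩ : ∃ m, n = m + 1 := ⟨n - 1, by omega⟩
  rw [Matrix.trace, ← (Fin.consEquiv fun _ => ι).sum_comp, Fintype.sum_prod_type]
  refine Finset.sum_congr rfl fun s _ => ?_
  rw [Matrix.diag_apply, Matrix.prod_ofFn_apply]
  refine Finset.sum_congr rfl fun α _ => Finset.prod_congr rfl fun i _ => ?_
  rw [Fin.snoc_eq_cons_rotate]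
  rfl

end CyclicTrace

/-! ### The cycle and the W-distribution on it -/

section CycleComplex

namespace WSC

variable {n : ℕ}

theorem finRotate_ne (hn : 3 ≤ n) (i : Fin n) : finRotate n i ≠ i := by
  obtain ⟨m, rfl⟩ : ∃ m, n = m + 3 := ⟨n - 3, by omega⟩
  simp

theorem finRotate_finRotate_ne (hn : 3 ≤ n) (i : Fin n) : finRotate n (finRotate n i) ≠ i := by
  obtain ⟨m, rfl⟩ : ∃ m, n = m + 3 := ⟨n - 3, by omega⟩
  rw [finRotate_apply, finRotate_apply, add_assoc]
  intro h
  have h1 : (1 + 1 : Fin (m + 3)) = 0 := by simpa using h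
  have h2 := congrArg Fin.val h1
  simp [Fin.val_add] at h2
  rw [Nat.mod_eq_of_lt (by omega)] at h2
  omega

theorem weight_cycle_edge (i : Fin n) : (cycle n).weight {i, finRotate n i} = 1 :=
  if_pos (Or.inr ⟨i, rfl⟩)

theorem isFacet_cycle_iff (hn : 3 ≤ n) {S : Finset (Fin n)} :
    (cycle n).IsFacet S ↔ ∃ i, S = {i, finRotate n i} := by
  have hw : ∀ T, (cycle n).weight T ≠ 0 → T.card ≤ 1 ∨ ∃ i, T = {i, finRotate n i} := by
    intro T hT
    by_contra hc
    exact hT (if_neg hc)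
  constructor
  · intro hS
    rcases hw S hS.1 with h | h
    · obtain ⟨i, hi⟩ : ∃ i, S ⊆ {i, finRotate n i} := by
        have : Nonempty (Fin n) := ⟨⟨0, by omega⟩⟩
        obtain ⟨i, hi⟩ := Finset.card_le_one_iff_subset_singleton.1 h
        exact ⟨i, hi.trans (by simp)⟩
      have h2 : ({i, finRotate n i} : Finset (Fin n)) ⊆ S :=
        hS.2 (y := {i, finRotate n i}) ((weight_cycle_edge i).trans_ne one_ne_zero) hi
      have h3 := Finset.card_le_card h2
      rw [Finset.card_pair (finRotate_ne hn i).symm] at h3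
      omega
    · exact h
  · rintro ⟨i, rfl⟩
    refine ⟨(weight_cycle_edge i).trans_ne one_ne_zero, fun T hT hsub => ?_⟩
    have hc := Finset.card_le_card hsub
    rw [Finset.card_pair (finRotate_ne hn i).symm] at hc
    rcases hw T hT with h | ⟨k, rfl⟩
    · omega
    · refine (Finset.eq_of_subset_of_card_le hsub ?_).ge
      rw [Finset.card_pair (finRotate_ne hn i).symm]
      exact Finset.card_le_two

theorem MultiFacet.ext_of_weight_le_one {Ω : WSC n} (h : ∀ S, Ω.weight S ≤ 1)
    {F F' : Ω.MultiFacet} (hF : F.collapse = F'.collapse) : F = F' := by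
  refine MultiFacet.ext' hF ?_
  have h1 := F.2.2
  have h2 := F'.2.2
  have h3 := h F.1.1
  have h4 := h F'.1.1
  omega

theorem weight_cycle_le_one (S : Finset (Fin n)) : (cycle n).weight S ≤ 1 := by
  simp only [cycle]; split_ifs <;> simp

/-- The edge of the cycle leaving the vertex `i`. -/
noncomputable def cycleEdge (hn : 3 ≤ n) (i : Fin n) : (cycle n).MultiFacet :=
  ⟨⟨{i, finRotate n i}, (isFacet_cycle_iff hn).2 ⟨i, rfl⟩⟩,
    ⟨0, by rw [weight_cycle_edge]; exact one_pos⟩⟩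

theorem collapse_cycleEdge (hn : 3 ≤ n) (i : Fin n) :
    (cycleEdge hn i).collapse = {i, finRotate n i} := rfl

theorem cycleEdge_bijective (hn : 3 ≤ n) : Function.Bijective (cycleEdge hn) := by
  constructor
  · intro i k h
    have h1 : ({i, finRotate n i} : Finset (Fin n)) = {k, finRotate n k} :=
      congrArg MultiFacet.collapse h
    have h2 : i ∈ ({k, finRotate n k} : Finset (Fin n)) := by rw [← h1]; simp
    have h3 : k ∈ ({i, finRotate n i} : Finset (Fin n)) := by rw [h1]; simp
    simp only [Finset.mem_insert, Finset.mem_singleton] at h2 h3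
    rcases h2 with h2 | h2
    · exact h2
    -- Two edges with the same vertices in opposite orientation would require `n = 2`.
    · rcases h3 with h3 | h3
      · exact h3.symm
      · rw [h2] at h3
        exact absurd h3.symm (finRotate_finRotate_ne hn k)
  · intro F
    obtain ⟨i, hi⟩ := (isFacet_cycle_iff hn).1 F.1.2
    exact ⟨i, MultiFacet.ext_of_weight_le_one weight_cycle_le_one hi.symm⟩

/-- The labelling of the two edges at `i` by `s` and `t`. -/
noncomputable def cycleLabel (hn : 3 ≤ n) {I : Type} (i : Fin n) (s t : I) :
    (cycle n).MultiFacetAt i → I :=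
  fun F => if F.1 = cycleEdge hn i then t else s

theorem restrict_cycle (hn : 3 ≤ n) {I : Type} (α : (cycle n).MultiFacet → I) (i : Fin n) :
    restrict α i = cycleLabel hn i (α (cycleEdge hn ((finRotate n).symm i)))
      (α (cycleEdge hn i)) := by
  funext ⟨F, hF⟩
  obtain ⟨k, rfl⟩ := (cycleEdge_bijective hn).2 F
  simp only [restrict, cycleLabel]
  split_ifs with h
  · rw [h]
  · rw [collapse_cycleEdge, Finset.mem_insert, Finset.mem_singleton] at hF
    rcases hF with rfl | rfl
    · exact absurd rfl h
    · rw [Equiv.symm_apply_apply]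

theorem facet_cycleEdge (hn : 3 ≤ n) (g : Subgroup.zpowers (finRotate n)) (i : Fin n) :
    (Action.cycleRotate n).facet g (cycleEdge hn i) =
      cycleEdge hn ((Action.cycleRotate n).vertex g i) := by
  refine MultiFacet.ext_of_weight_le_one weight_cycle_le_one ?_
  rw [Action.collapse_facet, collapse_cycleEdge, collapse_cycleEdge, Finset.map_insert,
    Finset.map_singleton]
  obtain ⟨_, k, rfl⟩ := g
  change ({(finRotate n ^ k) i, (finRotate n ^ k) (finRotate n i)} : Finset (Fin n)) =
    {(finRotate n ^ k) i, finRotate n ((finRotate n ^ k) i)}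
  rw [← Equiv.Perm.mul_apply, ← Equiv.Perm.mul_apply, ((Commute.refl (finRotate n)).zpow_left k).eq]

/-- Translations preserve the orientation, so incoming and outgoing labels are not exchanged.
Invariance therefore means that one matrix-valued tensor serves all sites. -/
theorem shift_cycleLabel (hn : 3 ≤ n) {I : Type} (g : Subgroup.zpowers (finRotate n)) (i : Fin n)
    (s t : I) : (Action.cycleRotate n).shift g (cycleLabel hn i s t) =
      cycleLabel hn ((Action.cycleRotate n).vertex g i) s t := by
  funext F
  simp only [Action.shift, cycleLabel]
  refine if_congr ?_ rfl rfl
  change (Action.cycleRotate n).facet g⁻¹ F.1 = _ ↔ _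
  rw [map_inv, Equiv.Perm.inv_eq_iff_eq, facet_cycleEdge]

theorem isCycle_finRotate' (hn : 3 ≤ n) : (finRotate n).IsCycle :=
  isCycle_finRotate_of_le (by omega)

theorem isConnected_cycle (hn : 3 ≤ n) : (cycle n).IsConnected := by
  intro I α h
  have h1 : ∀ i, α (cycleEdge hn (finRotate n i)) = α (cycleEdge hn i) := by
    intro i
    obtain ⟨s, hs⟩ := h (finRotate n i)
    exact (hs ⟨cycleEdge hn (finRotate n i), by simp [collapse_cycleEdge]⟩).trans
      (hs ⟨cycleEdge hn i, by simp [collapse_cycleEdge]⟩).symm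
  have h2 : ∀ (k : ℕ) i, α (cycleEdge hn ((finRotate n ^ k) i)) = α (cycleEdge hn i) := by
    intro k
    induction k with
    | zero => intro i; rfl
    | succ k ih => intro i; rw [pow_succ', Equiv.Perm.mul_apply, h1, ih]
  refine ⟨α (cycleEdge hn ⟨0, by omega⟩), fun F => ?_⟩
  obtain ⟨i, rfl⟩ := (cycleEdge_bijective hn).2 F
  obtain ⟨k, rfl⟩ := (isCycle_finRotate' hn).exists_pow_eq (finRotate_ne hn ⟨0, by omega⟩)
    (finRotate_ne hn i)
  exact h2 k _

end WSC

open WSC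

variable {n : ℕ}

/-- Translational invariant decompositions on the cycle are traces of products of matrices. -/
theorem HasMatrixDecomp.exists_trace (hn : 3 ≤ n) {d K r : ℕ}
    {L : Matrix (Fin n → Fin d) (Fin n → Fin K) ℂ}
    (h : HasMatrixDecomp (Action.cycleRotate n) L r) :
    ∃ M : Fin d → Fin K → Matrix (Fin r) (Fin r) ℂ,
      ∀ x y, L x y = (List.ofFn fun i => M (x i) (y i)).prod.trace := by
  obtain ⟨A, hA, hL⟩ := h
  set i₀ : Fin n := ⟨0, by omega⟩
  have hA' : ∀ i s t, A i (cycleLabel hn i s t) = A i₀ (cycleLabel hn i₀ s t) := by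
    intro i s t
    obtain ⟨k, hk⟩ := (isCycle_finRotate' hn).exists_zpow_eq (finRotate_ne hn i₀)
      (finRotate_ne hn i)
    let g : Subgroup.zpowers (finRotate n) := ⟨finRotate n ^ k, k, rfl⟩
    have hg : (Action.cycleRotate n).vertex g i₀ = i := hk
    rw [← hA g i₀, shift_cycleLabel, hg]
  refine ⟨fun z k => Matrix.of fun s t => A i₀ (cycleLabel hn i₀ s t) z k, fun x y => ?_⟩
  -- Site `i` reads the edges leaving `i - 1` and `i`, while the trace formula reads positions `i`
  -- and `i + 1`; the second reindexing shifts the labels accordingly.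
  rw [Matrix.trace_prod_ofFn (by omega), hL,
    ← (Equiv.arrowCongr (Equiv.ofBijective _ (cycleEdge_bijective hn)) (Equiv.refl _)).sum_comp,
    ← (Equiv.arrowCongr (finRotate n).symm (Equiv.refl (Fin r))).sum_comp]
  refine Finset.sum_congr rfl fun α _ => Finset.prod_congr rfl fun i _ => ?_
  rw [restrict_cycle hn, hA']
  simp only [Matrix.of_apply]
  congr <;>
  · change α (finRotate n ((Equiv.ofBijective _ (cycleEdge_bijective hn)).symm
      (Equiv.ofBijective _ (cycleEdge_bijective hn) _))) = _
    rw [Equiv.symm_apply_apply]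
    try rw [Equiv.apply_symm_apply]

theorem List.countP_ofFn_eq_sum {α : Type*} {n : ℕ} (p : α → Bool) (f : Fin n → α) :
    (List.ofFn f).countP p = ∑ i, if p (f i) then 1 else 0 := by
  induction n with
  | zero => simp
  | succ n ih => rw [List.ofFn_succ, List.countP_cons, ih, Fin.sum_univ_succ, add_comm]

/-- For each outcome 0 and 1, the letters are the matrices over all ancilla values. Words with a
number of 1s other than one have trace zero, hence so has each word with its only 1 in front,
contradicting the support of W. -/
theorem wDist_notMem_CQCorr_cycle {d : ℕ} (hn : 6 ≤ n) (hd : 2 ≤ d) :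
    wDist n d ∉ CQCorr (Action.cycleRotate n) d 2 := by
  intro h
  obtain ⟨-, s, hs, K, L, hP, hdec⟩ := mem_CQCorr_iff.1 h
  obtain ⟨M, hM⟩ := (hdec.mono ⟨0, by omega⟩ hs).exists_trace (by omega)
  obtain ⟨h0, h1⟩ := sum_norm_sq_support_of_wDist hd hP
  let c : Bool → Fin d := fun b => if b then ⟨1, hd⟩ else ⟨0, by omega⟩
  have hV : TraceVanishing n fun b => Submodule.span ℂ (Set.range (M (c b))) := by
    refine TraceVanishing.of_span fun w hw hc hS => ?_
    subst hw
    choose y hy using fun i : Fin w.length => hS (w.get i) (List.get_mem w i)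
    have h2 := h0 (fun i => (w.get i).1) (by
      rintro ⟨i, hi⟩
      refine hc ?_
      conv_lhs => rw [← List.ofFn_get w]
      rw [List.countP_ofFn_eq_sum]
      simp only [hi]
      simp) y
    rw [hM] at h2
    rw [← h2]
    congr 2
    conv_lhs => rw [← List.ofFn_get w, List.map_ofFn]
    congr 1
    funext i
    exact (hy i).symm
  obtain ⟨m, rfl⟩ : ∃ m, n = m + 1 := ⟨n - 1, by omega⟩
  obtain ⟨y, hy⟩ := h1 0
  refine hy ?_
  rw [hM, List.ofFn_succ, List.prod_cons]
  refine hV.trace_eq_zero hn (Submodule.subset_span ⟨y 0, rfl⟩) _ ?_ (by simp)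
  intro U hU
  obtain ⟨i, rfl⟩ := (List.mem_ofFn' _ _).1 hU
  exact Submodule.subset_span ⟨y i.succ, rfl⟩

theorem notClosedAt_cycle {d : ℕ} (hn : 6 ≤ n) (hd : 2 ≤ d) :
    NotClosedAt (CQCorr (Action.cycleRotate n) d 2) (wDist n d) ∧
      NotClosedAt (QQCorr (Action.cycleRotate n) d 2) (diagState (wDist n d)) :=
  notClosedAt_of_mem_closure (wDist_notMem_CQCorr_cycle hn hd)
    (wDist_mem_closure ⟨0, by omega⟩ (isConnected_cycle (by omega)) hd)

end CycleComplex

/-! ### Limits of factorized tensors -/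

section Factorization

/-- A finite family of vectors admits a bounded family, indexed by the same set, for which
`P Pᴴ` fixes the given vectors. -/
theorem exists_bounded_projection {X ι : Type*} [Fintype X] [Fintype ι] (Q : X → ι → ℂ) :
    ∃ P : X → ι → ℂ, (∀ x s, ‖P x s‖ ≤ 1) ∧
      ∀ x t, Q x t = ∑ s, P x s * ∑ x', star (P x' s) * Q x' t := by
  classical
  let q : ι → EuclideanSpace ℂ X := fun t => WithLp.toLp 2 fun x => Q x t
  let U := Submodule.span ℂ (Set.range q)
  -- The new family is an orthonormal basis of the span of the columns, padded by zeros; the claim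
  -- is the expansion of each column in it.
  let b := stdOrthonormalBasis ℂ U
  obtain ⟨e⟩ : Nonempty (Fin (Module.finrank ℂ U) ↪ ι) := by
    rw [Function.Embedding.nonempty_iff_card_le, Fintype.card_fin]
    exact finrank_range_le_card q
  let c : Fin (Module.finrank ℂ U) → X → ℂ := fun k x => (b k : EuclideanSpace ℂ X) x
  have hP : ∀ x s, (∃ k, e k = s ∧ (∑ k, if e k = s then c k x else 0) = c k x) ∨
      (∑ k, if e k = s then c k x else 0) = 0 := by
    intro x s
    by_cases hs : ∃ k, e k = s
    · obtain ⟨k, rfl⟩ := hs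
      exact Or.inl ⟨k, rfl, by simp⟩
    · exact Or.inr (Finset.sum_eq_zero fun k _ => if_neg fun h => hs ⟨k, h⟩)
  refine ⟨fun x s => ∑ k, if e k = s then c k x else 0, fun x s => ?_, fun x t => ?_⟩
  · rcases hP x s with ⟨k, -, h⟩ | h
    · simp only [h]
      refine (PiLp.norm_apply_le (b k : EuclideanSpace ℂ X) x).trans ?_
      exact (b.norm_eq_one k).le
    · simp [h]
  · have h1 : ∀ s, (∑ k, if e k = s then c k x else 0) *
        ∑ x', star (∑ k, if e k = s then c k x' else 0) * Q x' t =
        ∑ k, if e k = s then c k x * ∑ x', star (c k x') * Q x' t else 0 := by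
      intro s
      by_cases hs : ∃ k, e k = s
      · obtain ⟨k, rfl⟩ := hs
        simp
      · have : ∀ k, e k ≠ s := fun k hk => hs ⟨k, hk⟩
        simp [this]
    simp_rw [h1]
    rw [Finset.sum_comm]
    simp only [Finset.sum_ite_eq, Finset.mem_univ, if_true]
    have h2 := b.sum_repr' ⟨q t, Submodule.subset_span ⟨t, rfl⟩⟩
    have h3 := congrArg (fun u : U => (u : EuclideanSpace ℂ X) x) h2
    simp only [AddSubmonoidClass.coe_finsetSum, Submodule.coe_smul, Submodule.coe_inner] at h3
    have h4 : Q x t = (q t) x := rfl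
    rw [h4, ← h3]
    simp only [WithLp.ofLp_sum, WithLp.ofLp_smul, Finset.sum_apply, Pi.smul_apply, smul_eq_mul]
    refine Finset.sum_congr rfl fun k _ => ?_
    rw [mul_comm]
    congr 1
    simp only [PiLp.inner_apply, RCLike.inner_apply, q, c]
    refine Finset.sum_congr rfl fun x' _ => ?_
    rw [mul_comm]
    rfl

/-- Tensors that factor through a closed set, which is invariant under the linear maps on the
factorization index, form a closed set. -/
theorem isClosed_factorizations {W X Y Z ι : Type*} [Finite W] [Finite X] [Finite Z] [Finite ι]
    [Fintype ι] (μ : X → Y → W) (ν : ι → Y → Z) (hν : ∀ z, ∃ s y, ν s y = z) {C : Set (Z → ℂ)}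
    (hC : IsClosed C) (hM : ∀ R ∈ C, ∀ M : ι → ι → ℂ, ∃ R' ∈ C, ∀ s y,
      R' (ν s y) = ∑ t, M s t * R (ν t y)) :
    IsClosed {T : W → ℂ | ∃ Q : X → ι → ℂ, ∃ R ∈ C, ∀ x y,
      T (μ x y) = ∑ s, Q x s * R (ν s y)} := by
  classical
  have := Fintype.ofFinite X
  refine IsSeqClosed.isClosed fun T T' hT hlim => ?_
  choose Q R hR hQR using hT
  -- The factors of a convergent sequence may diverge. Replacing `Q` by the bounded `P` and moving
  -- `Pᴴ Q` into the other factor restores compactness on the first factor.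
  choose P hP1 hPQ using fun k => exists_bounded_projection (Q k)
  have hcomp : IsCompact (Set.univ.pi fun _ : X => Set.univ.pi fun _ : ι =>
      Metric.closedBall (0 : ℂ) 1) :=
    isCompact_univ_pi fun _ => isCompact_univ_pi fun _ => isCompact_closedBall _ _
  obtain ⟨P', -, φ, hφ, hPlim⟩ := hcomp.tendsto_subseq (x := P)
    fun k x _ s _ => by simpa using hP1 k x s
  choose R₂ hR₂ hR₂' using fun k => hM (R k) (hR k) fun s t => ∑ x, star (P k x s) * Q k x t
  -- The second factor is now determined by `P` and the tensor itself, so it converges along the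
  -- subsequence.
  have hS : ∀ k s y, R₂ k (ν s y) = ∑ x, star (P k x s) * T k (μ x y) := by
    intro k s y
    rw [hR₂']
    simp_rw [hQR, Finset.mul_sum, Finset.sum_mul]
    rw [Finset.sum_comm]
    simp only [mul_assoc]
  have hTP : ∀ k x y, T k (μ x y) = ∑ s, P k x s * R₂ k (ν s y) := by
    intro k x y
    rw [hQR]
    simp_rw [hR₂', Finset.mul_sum]
    rw [Finset.sum_comm]
    refine Finset.sum_congr rfl fun t _ => ?_
    rw [hPQ k x t, Finset.sum_mul]
    simp only [mul_assoc]
  have hPlim' : ∀ x s, Filter.Tendsto (fun k => P (φ k) x s) Filter.atTop (𝓝 (P' x s)) :=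
    fun x s => (tendsto_pi_nhds.1 ((tendsto_pi_nhds.1 hPlim) x)) s
  have hTlim : ∀ w, Filter.Tendsto (fun k => T (φ k) w) Filter.atTop (𝓝 (T' w)) :=
    fun w => (tendsto_pi_nhds.1 (hlim.comp hφ.tendsto_atTop)) w
  have hSlim : ∀ s y, Filter.Tendsto (fun k => R₂ (φ k) (ν s y)) Filter.atTop
      (𝓝 (∑ x, star (P' x s) * T' (μ x y))) := by
    intro s y
    simp_rw [hS]
    exact tendsto_finsetSum _ fun x _ => ((hPlim' x s).star).mul (hTlim _)
  choose σ τ hστ using hν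
  let R' : Z → ℂ := fun z => ∑ x, star (P' x (σ z)) * T' (μ x (τ z))
  have hRlim : Filter.Tendsto (fun k => R₂ (φ k)) Filter.atTop (𝓝 R') := by
    rw [tendsto_pi_nhds]
    intro z
    have := hSlim (σ z) (τ z)
    rwa [hστ] at this
  have hR'C : R' ∈ C := hC.mem_of_tendsto hRlim (Filter.Eventually.of_forall fun k => hR₂ (φ k))
  refine ⟨P', R', hR'C, fun x y => ?_⟩
  refine tendsto_nhds_unique (hTlim (μ x y)) ?_
  simp_rw [hTP]
  exact tendsto_finsetSum _ fun s _ => (hPlim' x s).mul ((tendsto_pi_nhds.1 hRlim) _)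

end Factorization

/-! ### Contractions over sets of vertices and removal of leaves -/

section Networks

open WSC

variable {n r : ℕ} {Ω : WSC n} {X : Type*}

/-- The assignment `γ` on the facets inside `A` and `α` on the other facets. -/
def mixAssign (A : Finset (Fin n)) (α γ : Ω.MultiFacet → Fin r) (F : Ω.MultiFacet) : Fin r :=
  if F.collapse ⊆ A then γ F else α F

/-- The contraction of the tensors at the vertices in `A` along the facets inside `A`, up to a
constant factor. The other facets carry open indices. -/
noncomputable def network (A : Finset (Fin n)) (v : (i : Fin n) → (Ω.MultiFacetAt i → Fin r) → X → ℂ)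
    (z : (Fin n → X) × (Ω.MultiFacet → Fin r)) : ℂ :=
  ∑ γ, ∏ i ∈ A, v i (restrict (mixAssign A z.2 γ) i) (z.1 i)

/-- The tensors which are multiples of contractions over `A`. -/
def networkSet (Ω : WSC n) (r : ℕ) (X : Type*) (A : Finset (Fin n)) :
    Set ((Fin n → X) × (Ω.MultiFacet → Fin r) → ℂ) :=
  {R | ∃ (c : ℂ) (v : (i : Fin n) → (Ω.MultiFacetAt i → Fin r) → X → ℂ),
    ∀ z, R z = c * network A v z}

/-- The facets at `l` inside `A`. -/
def IsInner (A : Finset (Fin n)) (l : Fin n) (F : Ω.MultiFacet) : Prop :=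
  l ∈ F.collapse ∧ F.collapse ⊆ A

open Classical in
/-- Overwriting an assignment by a constant on the facets at `l` inside `A`. -/
noncomputable def setInner (A : Finset (Fin n)) (l : Fin n) (α : Ω.MultiFacet → Fin r) (s : Fin r)
    (F : Ω.MultiFacet) : Fin r :=
  if IsInner A l F then s else α F

open Classical in
/-- Overwriting a local assignment by a constant on the facets at `l` inside `A`. -/
noncomputable def setInnerAt (A : Finset (Fin n)) (l : Fin n) {i : Fin n}
    (β : Ω.MultiFacetAt i → Fin r) (s : Fin r) (F : Ω.MultiFacetAt i) : Fin r :=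
  if IsInner A l F.1 then s else β F

open Classical in
/-- The assignment `β` at `l` on the facets not inside `A`, and `α` elsewhere. -/
noncomputable def mergeAt (A : Finset (Fin n)) (l : Fin n) (β : Ω.MultiFacetAt l → Fin r)
    (α : Ω.MultiFacet → Fin r) (F : Ω.MultiFacet) : Fin r :=
  if h : l ∈ F.collapse then (if IsInner A l F then α F else β ⟨F, h⟩) else α F

theorem restrict_setInner (A : Finset (Fin n)) (l : Fin n) (α : Ω.MultiFacet → Fin r) (s : Fin r)
    (i : Fin n) : restrict (setInner A l α s) i = setInnerAt A l (restrict α i) s := rfl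

theorem setInnerAt_setInnerAt (A : Finset (Fin n)) (l : Fin n) {i : Fin n}
    (β : Ω.MultiFacetAt i → Fin r) (s t : Fin r) :
    setInnerAt A l (setInnerAt A l β s) t = setInnerAt A l β t := by
  funext F
  simp only [setInnerAt]
  split_ifs <;> rfl

theorem restrict_setInner_mergeAt (A : Finset (Fin n)) (l : Fin n) (β : Ω.MultiFacetAt l → Fin r)
    (α : Ω.MultiFacet → Fin r) (s : Fin r) :
    restrict (setInner A l (mergeAt A l β α) s) l = setInnerAt A l β s := by
  funext ⟨F, hF⟩
  simp only [restrict, setInner, setInnerAt, mergeAt, dif_pos hF]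
  split_ifs <;> rfl

theorem mergeAt_restrict_setInner (A : Finset (Fin n)) (l : Fin n) (α : Ω.MultiFacet → Fin r)
    (s : Fin r) : mergeAt A l (restrict (setInner A l α s) l) α = α := by
  funext F
  simp only [restrict, setInner, mergeAt]
  split_ifs <;> rfl

theorem mixAssign_setInner (A : Finset (Fin n)) (l : Fin n)
    (α γ : Ω.MultiFacet → Fin r) (s : Fin r) :
    mixAssign A α (setInner A l γ s) = mixAssign (A.erase l) (setInner A l α s) γ := by
  funext F
  by_cases h1 : F.collapse ⊆ A <;> by_cases h2 : l ∈ F.collapse <;>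
    simp [mixAssign, setInner, IsInner, Finset.subset_erase, h1, h2]

/-- Averaging over the values at a single facet does not change sums over assignments. -/
theorem sum_setInner (hr : 0 < r) {A : Finset (Fin n)} {l : Fin n}
    (hJ : ∀ F F' : Ω.MultiFacet, IsInner A l F → IsInner A l F' → F = F')
    (f : (Ω.MultiFacet → Fin r) → ℂ) :
    ∑ γ, f γ = (r : ℂ)⁻¹ * ∑ s, ∑ γ, f (setInner A l γ s) := by
  classical
  have hr' : (r : ℂ) ≠ 0 := by exact_mod_cast hr.ne'
  rw [eq_inv_mul_iff_mul_eq₀ hr']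
  by_cases he : ∃ F : Ω.MultiFacet, IsInner A l F
  · obtain ⟨e, he⟩ := he
    have h1 : ∀ (γ : Ω.MultiFacet → Fin r) s, setInner A l γ s = Function.update γ e s := by
      intro γ s
      funext F
      by_cases hF : F = e
      · subst hF; simp [setInner, he]
      · have : ¬ IsInner A l F := fun h => hF (hJ _ _ h he)
        simp [setInner, this, hF]
    simp_rw [h1]
    have h2 : ∀ s (y : Fin r × ({F // F ≠ e} → Fin r)),
        Function.update ((Equiv.funSplitAt e (Fin r)).symm y) e s =
          (Equiv.funSplitAt e (Fin r)).symm (s, y.2) := by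
      intro s y
      funext F
      by_cases hF : F = e
      · subst hF; simp [Equiv.funSplitAt]
      · simp [Equiv.funSplitAt, hF]
    simp_rw [← (Equiv.funSplitAt e (Fin r)).symm.sum_comp, h2, Fintype.sum_prod_type,
      Finset.sum_const, Finset.card_univ, Fintype.card_fin, nsmul_eq_mul, Finset.mul_sum]
  · have h1 : ∀ (γ : Ω.MultiFacet → Fin r) s, setInner A l γ s = γ := by
      intro γ s
      funext F
      exact if_neg fun h => he ⟨F, h⟩
    simp [h1]

/-- The bond between the leaf and the rest is internal to `A` but open for `A.erase l`, so its value
`s` is summed explicitly. The factor `r⁻¹` compensates for the superfluous summation over its old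
value. -/
theorem network_split (hr : 0 < r) {A : Finset (Fin n)} {l : Fin n} (hl : l ∈ A)
    (hJ : ∀ F F' : Ω.MultiFacet, IsInner A l F → IsInner A l F' → F = F')
    (v : (i : Fin n) → (Ω.MultiFacetAt i → Fin r) → X → ℂ)
    (j : Fin n → X) (α : Ω.MultiFacet → Fin r) :
    network A v (j, α) = (r : ℂ)⁻¹ * ∑ s, v l (restrict (setInner A l α s) l) (j l) *
      network (A.erase l) v (j, setInner A l α s) := by
  rw [network, sum_setInner hr hJ]
  congr 1
  refine Finset.sum_congr rfl fun s _ => ?_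
  rw [network, Finset.mul_sum]
  refine Finset.sum_congr rfl fun γ _ => ?_
  rw [← Finset.mul_prod_erase A _ hl]
  simp only [mixAssign_setInner]
  congr 2
  funext ⟨F, hF⟩
  exact if_neg fun h => (Finset.notMem_erase l A) (h hF)

theorem network_congr {A : Finset (Fin n)}
    {v v' : (i : Fin n) → (Ω.MultiFacetAt i → Fin r) → X → ℂ} (hv : ∀ i ∈ A, v i = v' i)
    {j j' : Fin n → X} (hj : ∀ i ∈ A, j i = j' i) {α α' : Ω.MultiFacet → Fin r}
    (hα : ∀ F : Ω.MultiFacet, ∀ i ∈ A, i ∈ F.collapse → ¬ F.collapse ⊆ A → α F = α' F) :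
    network A v (j, α) = network A v' (j', α') := by
  refine Finset.sum_congr rfl fun γ _ => Finset.prod_congr rfl fun i hi => ?_
  simp only
  rw [hv i hi, hj i hi]
  congr 1
  funext ⟨F, hF⟩
  simp only [restrict, mixAssign]
  split_ifs with h
  · rfl
  · exact hα F i hi hF h

/-- The vertex `l` is a leaf of the part of the complex spanned by `A`. -/
structure IsLeaf (Ω : WSC n) (A : Finset (Fin n)) (l : Fin n) : Prop where
  mem : l ∈ A
  inner_unique : ∀ F F' : Ω.MultiFacet, IsInner A l F → IsInner A l F' → F = F'
  inner_of_mem : ∀ F : Ω.MultiFacet, l ∈ F.collapse → ∀ i ∈ A.erase l, i ∈ F.collapse → IsInner A l F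
  unique_neighbor : ∀ F : Ω.MultiFacet, IsInner A l F → ∀ i ∈ A.erase l, ∀ i' ∈ A.erase l,
    i ∈ F.collapse → i' ∈ F.collapse → i = i'

open Classical in
theorem IsLeaf.network_erase_merge {A : Finset (Fin n)} {l : Fin n} (hl : IsLeaf Ω A l)
    (v : (i : Fin n) → (Ω.MultiFacetAt i → Fin r) → X → ℂ) (a : X) (j : Fin n → X)
    (β : Ω.MultiFacetAt l → Fin r) (α : Ω.MultiFacet → Fin r) (s : Fin r) :
    network (A.erase l) v (Function.update j l a, setInner A l (mergeAt A l β α) s) =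
      network (A.erase l) v (j, setInner A l α s) := by
  refine network_congr (fun _ _ => rfl) (fun i hi => ?_) fun F i hi hiF _ => ?_
  · exact Function.update_of_ne (Finset.ne_of_mem_erase hi) _ _
  · simp only [setInner, mergeAt]
    by_cases h : IsInner A l F
    · simp only [if_pos h]
    · have : l ∉ F.collapse := fun hlF => h (hl.inner_of_mem F hlF i hi hiF)
      simp only [if_neg h, dif_neg this]

open Classical in
theorem network_split_merge (hr : 0 < r) {A : Finset (Fin n)} {l : Fin n} (hl : IsLeaf Ω A l)
    (v : (i : Fin n) → (Ω.MultiFacetAt i → Fin r) → X → ℂ) (a : X) (j : Fin n → X)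
    (β : Ω.MultiFacetAt l → Fin r) (α : Ω.MultiFacet → Fin r) :
    network A v (Function.update j l a, mergeAt A l β α) =
      (r : ℂ)⁻¹ * ∑ s, v l (setInnerAt A l β s) a *
        network (A.erase l) v (j, setInner A l α s) := by
  rw [network_split hr hl.mem hl.inner_unique]
  congr 1
  refine Finset.sum_congr rfl fun s _ => ?_
  rw [hl.network_erase_merge, restrict_setInner_mergeAt, Function.update_self]

/-- The network factors into the leaf and the rest along the single bond `e`, and a matrix acting on
this bond can be absorbed into the tensor at the neighbour `p`. This is the setting of
`isClosed_factorizations`. -/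
theorem isClosed_networkSet_of_leaf_of_edge [Finite X] (hr : 0 < r) {A : Finset (Fin n)}
    {l p : Fin n} (hl : IsLeaf Ω A l) {e : Ω.MultiFacet} (he : IsInner A l e)
    (hp : p ∈ A.erase l) (hpe : p ∈ e.collapse)
    (hC : IsClosed (networkSet Ω r X (A.erase l))) : IsClosed (networkSet Ω r X A) := by
  classical
  have hr' : (r : ℂ) ≠ 0 := by exact_mod_cast hr.ne'
  have hJ : ∀ F : Ω.MultiFacet, IsInner A l F ↔ F = e :=
    fun F => ⟨fun h => hl.inner_unique _ _ h he, fun h => h ▸ he⟩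
  let μ : X × (Ω.MultiFacetAt l → Fin r) → (Fin n → X) × (Ω.MultiFacet → Fin r) →
      (Fin n → X) × (Ω.MultiFacet → Fin r) :=
    fun x y => (Function.update y.1 l x.1, mergeAt A l x.2 y.2)
  let ν : Fin r → (Fin n → X) × (Ω.MultiFacet → Fin r) → (Fin n → X) × (Ω.MultiFacet → Fin r) :=
    fun s y => (y.1, setInner A l y.2 s)
  have hν : ∀ z, ∃ s y, ν s y = z := by
    rintro ⟨j, α⟩
    refine ⟨α e, (j, α), Prod.ext rfl ?_⟩
    funext F
    simp only [ν, setInner, hJ]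
    split_ifs with h
    · rw [h]
    · rfl
  have heA : ¬ e.collapse ⊆ A.erase l := fun h => Finset.notMem_erase l A (h he.1)
  have hM : ∀ R ∈ networkSet Ω r X (A.erase l), ∀ M : Fin r → Fin r → ℂ,
      ∃ R' ∈ networkSet Ω r X (A.erase l), ∀ s y, R' (ν s y) = ∑ t, M s t * R (ν t y) := by
    rintro R ⟨c, v, hR⟩ M
    let v' := Function.update v p fun β a => ∑ t, M (β ⟨e, hpe⟩) t * v p (setInnerAt A l β t) a
    refine ⟨fun z => c * network (A.erase l) v' z, ⟨c, v', fun z => rfl⟩, fun s ⟨j, α⟩ => ?_⟩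
    simp only [hR, ν, network, Finset.mul_sum]
    rw [Finset.sum_comm]
    refine Finset.sum_congr rfl fun γ _ => ?_
    have h1 : ∀ t, ∏ i ∈ A.erase l, v i (restrict (mixAssign (A.erase l) (setInner A l α t) γ) i)
        (j i) = v p (setInnerAt A l (restrict (mixAssign (A.erase l) (setInner A l α s) γ) p) t)
        (j p) * ∏ i ∈ (A.erase l).erase p,
          v i (restrict (mixAssign (A.erase l) (setInner A l α s) γ) i) (j i) := by
      intro t
      rw [← Finset.mul_prod_erase _ _ hp]
      congr 1
      · congr 1
        funext ⟨F, hF⟩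
        simp only [restrict, mixAssign, setInner, setInnerAt, hJ]
        by_cases hFe : F = e
        · subst hFe; simp [heA]
        · simp [hFe]
      · refine Finset.prod_congr rfl fun i hi => ?_
        congr 1
        funext ⟨F, hF⟩
        simp only [restrict, mixAssign, setInner, hJ]
        by_cases hFe : F = e
        · subst hFe
          exact absurd (hl.unique_neighbor _ he i (Finset.mem_of_mem_erase hi) p hp hF hpe)
            (Finset.ne_of_mem_erase hi)
        · simp [hFe]
    simp_rw [h1]
    rw [← Finset.mul_prod_erase _ _ hp]
    have h2 : restrict (mixAssign (A.erase l) (setInner A l α s) γ) p ⟨e, hpe⟩ = s := by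
      simp [restrict, mixAssign, setInner, heA, he]
    have h3 : ∏ i ∈ (A.erase l).erase p,
        v' i (restrict (mixAssign (A.erase l) (setInner A l α s) γ) i) (j i) =
        ∏ i ∈ (A.erase l).erase p,
          v i (restrict (mixAssign (A.erase l) (setInner A l α s) γ) i) (j i) :=
      Finset.prod_congr rfl fun i hi => by
        simp only [v', Function.update_of_ne (Finset.ne_of_mem_erase hi)]
    rw [h3]
    simp only [v', Function.update_self, h2]
    rw [Finset.sum_mul, Finset.mul_sum]
    refine Finset.sum_congr rfl fun t _ => ?_
    ring
  convert isClosed_factorizations μ ν hν hC hM using 1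
  ext R
  constructor
  · rintro ⟨c, v, hR⟩
    refine ⟨fun x s => (r : ℂ)⁻¹ * v l (setInnerAt A l x.2 s) x.1,
      fun z => c * network (A.erase l) v z, ⟨c, v, fun z => rfl⟩, fun ⟨a, β⟩ ⟨j, α⟩ => ?_⟩
    simp only [μ, ν, hR, network_split_merge hr hl, Finset.mul_sum]
    refine Finset.sum_congr rfl fun s _ => ?_
    ring
  · rintro ⟨Q, R', ⟨c, v, hR'⟩, hR⟩
    let s₀ : Fin r := ⟨0, hr⟩
    -- The bond value is read off from the label of `e`; the value `s₀` is an arbitrary filler at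
    -- that place in the first argument of `Q`.
    let v' := Function.update v l fun β a => Q (a, setInnerAt A l β s₀) (β ⟨e, he.1⟩)
    refine ⟨r * c, v', fun ⟨j, α⟩ => ?_⟩
    have h1 := hR (j l, restrict (setInner A l α s₀) l) (j, α)
    simp only [μ, ν, mergeAt_restrict_setInner, Function.update_eq_self] at h1
    rw [h1, network_split hr hl.mem hl.inner_unique, Finset.mul_sum, Finset.mul_sum]
    refine Finset.sum_congr rfl fun s _ => ?_
    have h2 : network (A.erase l) v' (j, setInner A l α s) =
        network (A.erase l) v (j, setInner A l α s) :=
      network_congr (fun i hi => Function.update_of_ne (Finset.ne_of_mem_erase hi) _ _)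
        (fun _ _ => rfl) fun _ _ _ _ _ => rfl
    have h3 : restrict (setInner A l α s) l ⟨e, he.1⟩ = s := by simp [restrict, setInner, he]
    rw [h2, hR']
    simp only [v', Function.update_self, h3]
    rw [restrict_setInner, restrict_setInner, setInnerAt_setInnerAt]
    field_simp

/-- No inner bond joins `l` to the rest, so the network is a plain product: the factorization index
is a single point and its matrices are scalars, which `networkSet` allows. -/
theorem isClosed_networkSet_of_leaf_of_isolated [Finite X] (hr : 0 < r) {A : Finset (Fin n)}
    {l : Fin n} (hl : IsLeaf Ω A l)
    (hJ : ∀ F : Ω.MultiFacet, IsInner A l F → ∀ i ∈ A.erase l, i ∉ F.collapse)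
    (hC : IsClosed (networkSet Ω r X (A.erase l))) : IsClosed (networkSet Ω r X A) := by
  classical
  have hr' : (r : ℂ) ≠ 0 := by exact_mod_cast hr.ne'
  let μ : X × (Ω.MultiFacetAt l → Fin r) → (Fin n → X) × (Ω.MultiFacet → Fin r) →
      (Fin n → X) × (Ω.MultiFacet → Fin r) :=
    fun x y => (Function.update y.1 l x.1, mergeAt A l x.2 y.2)
  let ν : Unit → (Fin n → X) × (Ω.MultiFacet → Fin r) → (Fin n → X) × (Ω.MultiFacet → Fin r) :=
    fun _ y => y
  have hM : ∀ R ∈ networkSet Ω r X (A.erase l), ∀ M : Unit → Unit → ℂ,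
      ∃ R' ∈ networkSet Ω r X (A.erase l), ∀ s y, R' (ν s y) = ∑ t, M s t * R (ν t y) := by
    rintro R ⟨c, v, hR⟩ M
    exact ⟨fun z => M () () * R z, ⟨M () () * c, v, fun z => by simp only [hR, mul_assoc]⟩,
      fun s y => by simp [ν]⟩
  have hins : ∀ (v : (i : Fin n) → (Ω.MultiFacetAt i → Fin r) → X → ℂ) j α s,
      network (A.erase l) v (j, setInner A l α s) = network (A.erase l) v (j, α) := by
    intro v j α s
    refine network_congr (fun _ _ => rfl) (fun _ _ => rfl) fun F i hi hiF _ => ?_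
    exact if_neg fun h => hJ F h i hi hiF
  convert isClosed_factorizations μ ν (fun z => ⟨(), z, rfl⟩) hC hM using 1
  ext R
  constructor
  · rintro ⟨c, v, hR⟩
    refine ⟨fun x _ => (r : ℂ)⁻¹ * ∑ s, v l (setInnerAt A l x.2 s) x.1,
      fun z => c * network (A.erase l) v z, ⟨c, v, fun z => rfl⟩, fun ⟨a, β⟩ ⟨j, α⟩ => ?_⟩
    simp only [μ, ν, hR, network_split_merge hr hl, hins, ← Finset.sum_mul,
      Finset.univ_unique, Finset.sum_singleton]
    ring
  · rintro ⟨Q, R', ⟨c, v, hR'⟩, hR⟩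
    let s₀ : Fin r := ⟨0, hr⟩
    let v' := Function.update v l fun β a => Q (a, setInnerAt A l β s₀) ()
    refine ⟨c, v', fun ⟨j, α⟩ => ?_⟩
    have h1 := hR (j l, restrict (setInner A l α s₀) l) (j, α)
    simp only [μ, ν, mergeAt_restrict_setInner, Function.update_eq_self,
      Finset.univ_unique, Finset.sum_singleton] at h1
    rw [h1, network_split hr hl.mem hl.inner_unique]
    have h2 : network (A.erase l) v' (j, α) = network (A.erase l) v (j, α) :=
      network_congr (fun i hi => Function.update_of_ne (Finset.ne_of_mem_erase hi) _ _)
        (fun _ _ => rfl) fun _ _ _ _ _ => rfl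
    simp only [hins, h2, hR', v', Function.update_self, restrict_setInner, setInnerAt_setInnerAt,
      Finset.sum_const, Finset.card_univ, Fintype.card_fin, nsmul_eq_mul]
    field_simp

theorem isClosed_networkSet [Finite X] (hr : 0 < r)
    (hΩ : ∀ A : Finset (Fin n), A.Nonempty → ∃ l, IsLeaf Ω A l) (A : Finset (Fin n)) :
    IsClosed (networkSet Ω r X A) := by
  classical
  induction A using Finset.strongInduction with
  | H A ih =>
    rcases A.eq_empty_or_nonempty with rfl | hA
    · have : networkSet Ω r X ∅ = {R | ∀ z z', R z = R z'} := by
        ext R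
        constructor
        · rintro ⟨c, v, hR⟩ z z'
          rw [hR, hR]
          simp [network]
        · intro h
          have hr' : (r : ℂ) ≠ 0 := by exact_mod_cast hr.ne'
          rcases isEmpty_or_nonempty ((Fin n → X) × (Ω.MultiFacet → Fin r)) with hz | ⟨⟨z₀⟩⟩
          · exact ⟨0, fun _ _ _ => 0, fun z => hz.elim z⟩
          -- The empty network sums 1 over all assignments of the facets.
          · refine ⟨R z₀ * ((r : ℂ) ^ Fintype.card Ω.MultiFacet)⁻¹, fun _ _ _ => 0, fun z => ?_⟩
            rw [h z z₀]
            simp [network, hr']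
      rw [this]
      simp only [Set.ofPred_forall]
      exact isClosed_iInter fun z => isClosed_iInter fun z' =>
        isClosed_eq (continuous_apply z) (continuous_apply z')
    · obtain ⟨l, hl⟩ := hΩ A hA
      have hC := ih _ (Finset.erase_ssubset hl.mem)
      by_cases h : ∃ e : Ω.MultiFacet, IsInner A l e ∧ ∃ p ∈ A.erase l, p ∈ e.collapse
      · obtain ⟨e, he, p, hp, hpe⟩ := h
        exact isClosed_networkSet_of_leaf_of_edge hr hl he hp hpe hC
      · push Not at h
        exact isClosed_networkSet_of_leaf_of_isolated hr hl h hC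

end Networks

/-! ### Closedness for trees -/

section Trees

open WSC

variable {n r : ℕ} {Ω : WSC n} {X : Type*}

/-- The vertex is an end of a longest path: a neighbour off the path would extend it, and one on the
path other than the penultimate vertex would close a cycle. -/
theorem SimpleGraph.IsAcyclic.exists_unique_neighbor {V : Type*} [Finite V] [Nonempty V]
    {G : SimpleGraph V} (hG : G.IsAcyclic) :
    ∃ l, ∀ w w', G.Adj l w → G.Adj l w' → w = w' := by
  obtain ⟨u, l, p, hp, hmax⟩ := SimpleGraph.Walk.exists_isPath_forall_isPath_length_le_length G
  have key : ∀ w, G.Adj l w → w = p.penultimate := by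
    intro w hw
    refine hG.eq_penultimate_of_adj_end hp hw ?_
    by_contra hs
    have := hmax _ _ _ (hp.concat hs hw)
    rw [SimpleGraph.Walk.length_concat] at this
    omega
  exact ⟨l, fun w w' hw hw' => (key w hw).trans (key w' hw').symm⟩

theorem WSC.IsTree.collapse_eq_pair (hΩ : Ω.IsTree) {F : Ω.MultiFacet} {i j : Fin n}
    (hij : i ≠ j) (hi : i ∈ F.collapse) (hj : j ∈ F.collapse) : F.collapse = {i, j} := by
  refine (Finset.eq_of_subset_of_card_le (Finset.insert_subset hi (by simpa using hj)) ?_).symm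
  rw [Finset.card_pair hij]
  exact hΩ.2.1 _ F.1.2

theorem WSC.IsTree.exists_isLeaf (hΩ : Ω.IsTree) {A : Finset (Fin n)} (hA : A.Nonempty) :
    ∃ l, IsLeaf Ω A l := by
  have : Nonempty (A : Set (Fin n)) := hA.to_subtype
  obtain ⟨⟨l, hl⟩, h⟩ := (hΩ.2.2.induce (A : Set (Fin n))).exists_unique_neighbor
  have hl' : l ∈ A := hl
  have hne : ∀ F : Ω.MultiFacet, l ∈ F.collapse → (∀ i ∈ F.collapse, i = l) →
      F.collapse = {l} := fun F h1 h2 => Finset.eq_singleton_iff_unique_mem.2 ⟨h1, h2⟩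
  have hadj : ∀ F : Ω.MultiFacet, IsInner A l F → ∀ w ∈ F.collapse, w ≠ l →
      ∃ hw : w ∈ (A : Set (Fin n)), (Ω.graph.induce (A : Set (Fin n))).Adj ⟨l, hl⟩ ⟨w, hw⟩ := by
    intro F hF w hw hwl
    refine ⟨hF.2 hw, hwl.symm, ?_⟩
    change Ω.IsFacet {l, w}
    rw [← hΩ.collapse_eq_pair hwl.symm hF.1 hw]
    exact F.1.2
  refine ⟨l, hl', fun F F' hF hF' => ?_, fun F hlF i hi hiF => ⟨hlF, ?_⟩,
    fun F hF i hi i' hi' hiF hiF' => ?_⟩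
  · refine MultiFacet.ext_of_weight_le_one hΩ.1 ?_
    -- A facet equal to `{l}` is contained in every other facet at `l`, so maximality makes it the
    -- only one. Otherwise both facets are edges inside `A`.
    by_cases h1 : ∀ i ∈ F.collapse, i = l
    · have h2 : F.collapse ⊆ F'.collapse := by
        rw [hne F hF.1 h1]; simpa using hF'.1
      exact h2.antisymm (F.1.2.2 F'.1.2.1 h2)
    by_cases h1' : ∀ i ∈ F'.collapse, i = l
    · have h2 : F'.collapse ⊆ F.collapse := by
        rw [hne F' hF'.1 h1']; simpa using hF.1
      exact (F'.1.2.2 F.1.2.1 h2).antisymm h2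
    push Not at h1 h1'
    obtain ⟨w, hw, hwl⟩ := h1
    obtain ⟨w', hw', hwl'⟩ := h1'
    obtain ⟨hwA, h2⟩ := hadj F hF w hw hwl
    obtain ⟨hwA', h2'⟩ := hadj F' hF' w' hw' hwl'
    have h3 : w = w' := congrArg Subtype.val (h _ _ h2 h2')
    rw [hΩ.collapse_eq_pair hwl.symm hF.1 hw, hΩ.collapse_eq_pair hwl'.symm hF'.1 hw', h3]
  · rw [hΩ.collapse_eq_pair (Finset.ne_of_mem_erase hi).symm hlF hiF]
    exact Finset.insert_subset hl' (by simpa using Finset.mem_of_mem_erase hi)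
  · have h1 := hΩ.collapse_eq_pair (Finset.ne_of_mem_erase hi).symm hF.1 hiF
    rw [h1] at hiF'
    simpa [Finset.ne_of_mem_erase hi', eq_comm] using hiF'

/-- The tensors with a decomposition over a tree form a closed set. -/
theorem WSC.IsTree.isClosed_decomp [Finite X] (hΩ : Ω.IsTree) (i₀ : Fin n) (r : ℕ) :
    IsClosed {T : (Fin n → X) → ℂ | ∃ v : (i : Fin n) → (Ω.MultiFacetAt i → Fin r) → X → ℂ,
      ∀ j, T j = ∑ α : Ω.MultiFacet → Fin r, ∏ i, v i (restrict α i) (j i)} := by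
  classical
  rcases Nat.eq_zero_or_pos r with rfl | hr
  · obtain ⟨F⟩ := nonempty_multiFacetAt Ω i₀
    have : IsEmpty (Ω.MultiFacet → Fin 0) := ⟨fun α => (α F.1).elim0⟩
    simp only [Finset.univ_eq_empty, Finset.sum_empty]
    refine Set.Subsingleton.isClosed ?_
    rintro T ⟨_, hT⟩ T' ⟨_, hT'⟩
    funext j
    rw [hT, hT']
  · have hc := isClosed_networkSet (X := X) hr (fun A hA => hΩ.exists_isLeaf hA) Finset.univ
    convert hc.preimage (f := fun (T : (Fin n → X) → ℂ) z => T z.1) (by fun_prop) using 1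
    have hnet : ∀ (v : (i : Fin n) → (Ω.MultiFacetAt i → Fin r) → X → ℂ) z,
        network Finset.univ v z = ∑ α : Ω.MultiFacet → Fin r, ∏ i, v i (restrict α i) (z.1 i) := by
      intro v z
      have : ∀ γ, mixAssign Finset.univ z.2 γ = γ :=
        fun γ => funext fun F => if_pos (Finset.subset_univ _)
      simp only [network, this]
    ext T
    constructor
    · rintro ⟨v, hv⟩
      exact ⟨1, v, fun z => by rw [hnet, one_mul]; exact hv z.1⟩
    · rintro ⟨c, v, hv⟩
      -- The scalar of the network is absorbed at one vertex.
      refine ⟨Function.update v i₀ fun β x => c * v i₀ β x, fun j => ?_⟩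
      have h1 := hv (j, fun _ => ⟨0, hr⟩)
      simp only [hnet] at h1
      rw [h1, Finset.mul_sum]
      refine Finset.sum_congr rfl fun α _ => ?_
      rw [← Finset.mul_prod_erase _ _ (Finset.mem_univ i₀),
        ← Finset.mul_prod_erase _ _ (Finset.mem_univ i₀), Function.update_self, mul_assoc]
      congr 2
      refine Finset.prod_congr rfl fun i hi => ?_
      rw [Function.update_of_ne (Finset.ne_of_mem_erase hi)]

theorem hasMatrixDecomp_trivial_iff {d K : ℕ} {L : Matrix (Fin n → Fin d) (Fin n → Fin K) ℂ} :
    HasMatrixDecomp (WSC.Action.trivial Ω) L r ↔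
      ∃ A : (i : Fin n) → (Ω.MultiFacetAt i → Fin r) → Matrix (Fin d) (Fin K) ℂ,
        ∀ x y, L x y = ∑ α : Ω.MultiFacet → Fin r, ∏ i, A i (restrict α i) (x i) (y i) :=
  ⟨fun ⟨A, _, h⟩ => ⟨A, h⟩, fun ⟨A, h⟩ => ⟨A, fun _ _ _ => rfl, h⟩⟩

/-- The ancillary dimension of a purification can be bounded. -/
theorem HasMatrixDecomp.exists_fixed_dim {d K : ℕ}
    {L : Matrix (Fin n → Fin d) (Fin n → Fin K) ℂ}
    (h : HasMatrixDecomp (WSC.Action.trivial Ω) L r) :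
    ∃ L' : Matrix (Fin n → Fin d)
        (Fin n → Fin (∑ i, Fintype.card ((Ω.MultiFacetAt i → Fin r) × Fin d))) ℂ,
      L * L.conjTranspose = L' * L'.conjTranspose ∧
        HasMatrixDecomp (WSC.Action.trivial Ω) L' r := by
  obtain ⟨A, hA⟩ := hasMatrixDecomp_trivial_iff.1 h
  -- Only the local Gram matrices enter `L * Lᴴ`, so the local vectors may be replaced by others of
  -- bounded dimension with the same Gram matrices.
  have hG : ∀ i, ∃ B : Fin (∑ i, Fintype.card ((Ω.MultiFacetAt i → Fin r) × Fin d)) →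
      (Ω.MultiFacetAt i → Fin r) × Fin d → ℂ, ∀ p q,
      ∑ k, A i p.1 p.2 k * star (A i q.1 q.2 k) = ∑ k, B k p * star (B k q) := fun i =>
    (Matrix.PosSemidef.of_gram fun (k : Fin K) (p : (Ω.MultiFacetAt i → Fin r) × Fin d) =>
      A i p.1 p.2 k).exists_gram (Finset.single_le_sum
        (f := fun i => Fintype.card ((Ω.MultiFacetAt i → Fin r) × Fin d))
        (fun _ _ => Nat.zero_le _) (Finset.mem_univ i))
  choose B hB using hG
  refine ⟨Matrix.of fun x y => ∑ α : Ω.MultiFacet → Fin r, ∏ i, B i (y i) (restrict α i, x i), ?_,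
    hasMatrixDecomp_trivial_iff.2
      ⟨fun i β => Matrix.of fun x k => B i k (β, x), fun x y => rfl⟩⟩
  ext x x'
  simp only [Matrix.mul_apply, Matrix.conjTranspose_apply, Matrix.of_apply, hA]
  rw [sum_prod_mul_star (fun i α k => A i (restrict α i) (x i) k)
    (fun i α k => A i (restrict α i) (x' i) k),
    sum_prod_mul_star (fun i α k => B i k (restrict α i, x i))
    (fun i α k => B i k (restrict α i, x' i))]
  refine Finset.sum_congr rfl fun α _ => Finset.sum_congr rfl fun α' _ =>
    Finset.prod_congr rfl fun i _ => hB i (restrict α i, x i) (restrict α' i, x' i)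

theorem WSC.IsTree.isClosed_hasMatrixDecomp (hΩ : Ω.IsTree) (i₀ : Fin n) (d K r : ℕ) :
    IsClosed {L : Matrix (Fin n → Fin d) (Fin n → Fin K) ℂ |
      HasMatrixDecomp (WSC.Action.trivial Ω) L r} := by
  have hc := hΩ.isClosed_decomp (X := Fin d × Fin K) i₀ r
  convert hc.preimage (f := fun (L : Matrix (Fin n → Fin d) (Fin n → Fin K) ℂ)
    (z : Fin n → Fin d × Fin K) => L (fun i => (z i).1) (fun i => (z i).2)) (by fun_prop) using 1
  ext L
  rw [Set.mem_ofPred_eq, hasMatrixDecomp_trivial_iff]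
  constructor
  · rintro ⟨A, hA⟩
    exact ⟨fun i β p => A i β p.1 p.2, fun j => hA _ _⟩
  · rintro ⟨v, hv⟩
    exact ⟨fun i β => Matrix.of fun x y => v i β (x, y), fun x y => hv fun i => (x i, y i)⟩

theorem isCompact_setOf_sum_norm_sq_eq_one {ι κ : Type*} [Fintype ι] [Fintype κ] :
    IsCompact {L : Matrix ι κ ℂ | ∑ x, ∑ y, ‖L x y‖ ^ 2 = 1} := by
  have hcomp : IsCompact (Set.univ.pi fun _ : ι => Set.univ.pi fun _ : κ =>
      Metric.closedBall (0 : ℂ) 1) :=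
    isCompact_univ_pi fun _ => isCompact_univ_pi fun _ => isCompact_closedBall _ _
  refine hcomp.of_isClosed_subset (isClosed_eq ?_ continuous_const) fun L hL x _ y _ => ?_
  · refine continuous_finsetSum _ fun x _ => continuous_finsetSum _ fun y _ => ?_
    exact ((continuous_apply_apply x y).norm).pow 2
  · rw [mem_closedBall_zero_iff, ← sq_le_one_iff₀ (norm_nonneg _), ← show _ = (1 : ℝ) from hL]
    exact (Finset.single_le_sum (f := fun y => ‖L x y‖ ^ 2) (fun _ _ => by positivity)
      (Finset.mem_univ y)).trans (Finset.single_le_sum (f := fun x => ∑ y, ‖L x y‖ ^ 2)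
      (fun _ _ => by positivity) (Finset.mem_univ x))

/-- With the ancillary dimension fixed, the purifications form a closed subset of a unit sphere,
hence a compact set, and the states are its continuous image. Without vertices there is at most one
state. -/
theorem WSC.IsTree.isClosed_QQCorr (hΩ : Ω.IsTree) (d r : ℕ) :
    IsClosed (QQCorr (WSC.Action.trivial Ω) d r) := by
  rcases isEmpty_or_nonempty (Fin n) with hn | ⟨⟨i₀⟩⟩
  · refine Set.Subsingleton.isClosed ?_
    rintro ρ ⟨⟨-, hρ⟩, -⟩ ρ' ⟨⟨-, hρ'⟩, -⟩
    ext x y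
    simp only [Matrix.trace, Fintype.sum_unique, Matrix.diag_apply] at hρ hρ'
    rw [Subsingleton.elim x default, Subsingleton.elim y default, hρ, hρ']
  · have h1 := (isCompact_setOf_sum_norm_sq_eq_one.inter_right
      (hΩ.isClosed_hasMatrixDecomp i₀ d
        (∑ i, Fintype.card ((Ω.MultiFacetAt i → Fin r) × Fin d)) r)).image
      (f := fun L => L * L.conjTranspose) (by fun_prop)
    convert h1.isClosed using 1
    ext ρ
    rw [mem_QQCorr_iff]
    constructor
    · rintro ⟨hρ, s, hs, K, L, hL, h⟩
      obtain ⟨L', hL', h'⟩ := (h.mono i₀ hs).exists_fixed_dim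
      exact ⟨L', ⟨hρ.sum_norm_sq (hL.trans hL'), h'⟩, (hL.trans hL').symm⟩
    · rintro ⟨L, ⟨hL, h⟩, rfl⟩
      refine ⟨⟨Matrix.posSemidef_self_mul_conjTranspose L, ?_⟩, r, le_rfl, _, L, rfl, h⟩
      simp only [Matrix.trace, Matrix.diag_apply, Matrix.mul_conjTranspose_apply_self]
      exact_mod_cast hL

theorem WSC.IsTree.isClosed_CQCorr (hΩ : Ω.IsTree) (d r : ℕ) :
    IsClosed (CQCorr (WSC.Action.trivial Ω) d r) := by
  convert (hΩ.isClosed_QQCorr d r).preimage continuous_diagState using 1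
  ext P
  exact diagState_mem_QQCorr_iff.symm

end Trees

theorem mainTheorem7 :
    -- a gap between rank and border rank makes the correlation sets non-closed
    (∀ (n : ℕ) (Ω : WSC n) (G : Type*) [Group G] (a : WSC.Action G Ω), a.IsExternal →
      ∀ d r : ℕ,
        (∀ (P : ℕ → (Fin n → Fin d) → ℝ) (P' : (Fin n → Fin d) → ℝ),
          (∀ k, P k ∈ stdSimplex ℝ (Fin n → Fin d)) →
          Filter.Tendsto P Filter.atTop (𝓝 P') →
          (∀ k, psdRank a (P k) ≤ r) → (r : ℕ∞) < psdRank a P' →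
          (∀ k, P k ∈ CQCorr a d r) ∧ NotClosedAt (CQCorr a d r) P') ∧
        (∀ (ρ : ℕ → Matrix (Fin n → Fin d) (Fin n → Fin d) ℂ)
          (ρ' : Matrix (Fin n → Fin d) (Fin n → Fin d) ℂ),
          (∀ k, IsDensity (ρ k)) →
          Filter.Tendsto ρ Filter.atTop (𝓝 ρ') →
          (∀ k, puriRank a (ρ k) ≤ r) → (r : ℕ∞) < puriRank a ρ' →
          (∀ k, ρ k ∈ QQCorr a d r) ∧ NotClosedAt (QQCorr a d r) ρ')) ∧
    -- (i) the standard tensor rank, `n ≥ 5`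
    (∀ n d : ℕ, 5 ≤ n → 2 ≤ d →
      NotClosedAt (CQCorr (WSC.Action.trivial (WSC.simplex n)) d 2) (wDist n d) ∧
      NotClosedAt (QQCorr (WSC.Action.trivial (WSC.simplex n)) d 2) (diagState (wDist n d))) ∧
    -- (ii) the symmetric tensor rank, `n ≥ 3`
    (∀ n d : ℕ, 3 ≤ n → 2 ≤ d →
      NotClosedAt (CQCorr (WSC.Action.simplexPerm n) d 2) (wDist n d) ∧
      NotClosedAt (QQCorr (WSC.Action.simplexPerm n) d 2) (diagState (wDist n d))) ∧
    -- (iii) the translational invariant operator Schmidt rank, `n ≥ 17`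
    (∀ n d : ℕ, 17 ≤ n → 2 ≤ d →
      NotClosedAt (CQCorr (WSC.Action.cycleRotate n) d 2) (wDist n d) ∧
      NotClosedAt (QQCorr (WSC.Action.cycleRotate n) d 2) (diagState (wDist n d))) ∧
    -- the classical sets are closed, and every non-member is detected by a witness
    (∀ n d r : ℕ, IsClosed (CCorr n d r) ∧ ∀ P ∉ CCorr n d r, ∃ f, IsWitness (CCorr n d r) P f) ∧
    -- the quantum sets of trees are closed
    (∀ (n : ℕ) (Ω : WSC n), Ω.IsTree → ∀ d r : ℕ,
      IsClosed (CQCorr (WSC.Action.trivial Ω) d r) ∧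
      IsClosed (QQCorr (WSC.Action.trivial Ω) d r)) := by
  refine ⟨fun n Ω G _ a ha d r => ⟨fun P P' => cqCorr_gap ha, fun ρ ρ' => qqCorr_gap⟩,
    -- The simplex argument works from three sites on, the cycle argument from six.
    fun n d hn hd => notClosedAt_simplex _ (by omega) hd,
    fun n d hn hd => notClosedAt_simplex _ hn hd,
    fun n d hn hd => notClosedAt_cycle (by omega) hd,
    fun n d r => ⟨(isCompact_CCorr n d r).isClosed, fun P hP =>
      exists_isWitness_of_isClosed (isCompact_CCorr n d r).isClosed hP⟩,
    fun n Ω hΩ d r => ⟨hΩ.isClosed_CQCorr d r, hΩ.isClosed_QQCorr d r⟩⟩
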